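/- **Setting.** Let $n\ge 1$ and $0<a_1<\cdots<a_{n+1}$, set $a_0=0$, and consider the billiard inside the ellipsoid $Q=\{x\in\mathbb{R}^{n+1}:\sum_i x_i^2/a_i=1\}$, with confocal quadrics $Q_\mu=\{\sum_i x_i^2/(a_i-\mu)=1\}$. The *nonsingular caustic space* is $$\Lambda=\{\lambda\in\mathbb{R}^n: 0<\lambda_1<\cdots<\lambda_n,\ \lambda_i\in(a_{i-1},a_i)\cup(a_i,a_{i+1})\text{ for } 1\le i\le n\}.$$ A billiard trajectory has caustic parameter $\lambda\in\Lambda$ when all its lines are tangent to $Q_{\lambda_1},\dots,Q_{\lambda_n}$ (points of tangency at infinity being allowed). For $\lambda\in\Lambda$ let $c_0=0<c_1<\cdots<c_{2n+1}$, where $\{c_1,\dots,c_{2n+1}\}=\{a_1,\dots,a_{n+1}\}\cup\{\lambda_1,\dots,\lambda_n\}$, let $T(s)=\prod_{i=1}^{2n+1}(c_i-s)$, and let $K_j\in\mathbb{R}^n$, $0\le j\le n$, be the vector with components $K_{ij}=\int_{c_{2j}}^{c_{2j+1}}s^i\,T(s)^{-1/2}\,ds$, $0\le i\le n-1$. The *frequency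 map* $\omega:\Lambda\to\mathbb{R}^n$ is given by the unique solution $\omega=\omega(\lambda)$ of the linear system $K_0+2\sum_{j=1}^n(-1)^j\omega_jK_j=0$; $\omega(\lambda)$ is called the frequency of the trajectories with caustic parameter $\lambda$. **Local-diffeomorphism conjecture.** For every $n\ge1$ and all $0<a_1<\cdots<a_{n+1}$, $\det\big(\partial\omega_j/\partial\lambda_i(\lambda)\big)_{1\le i,j\le n}\neq0$ for all $\lambda\in\Lambda$. **Notation for $n=2$.** Let $P=\{(b,c)\in\mathbb{R}^2:0<c<b<1\}$; the point $(b,c)\in P$ represents the triaxial ellipsoid $x^2+y^2/b+z^2/c=1$ of $\mathbb{R}^3$, so $(a_1,a_2,a_3)=(c,b,1)$. Let $\Omega=\{(\omega_1,\omega_2)\in\mathbb{R}^2:0<\omega_2<\omega_1<1/2\}$. For $\omega^0=(\omega^0_1,\omega^0_2)\in\Omega$, let $P^0_1$ be the set of $(b,c)\in P$ whose ellipsoid has a billiard trajectory of frequency $\omega^0$ and type EH1, that is, with caustic parameter satisfying $0<\lambda_1<c<\lambda_2<b$, and let $P^0_2$ be the set of $(b,c)\in P$ whose ellipsoid has a billiard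 trajectory of frequency $\omega^0$ and type H1H1, that is, with caustic parameter satisfying $c<\lambda_1<\lambda_2<b$. **Proposition.** Assume the local-diffeomorphism conjecture. Let $\omega^0\in\Omega$. Then $P^0_2\subset P^0_1$; the set $P^0_2$ depends only on $\omega^0_2$; and $$P^0_2=\{(b,c)\in P: c<g(b)\}$$ for some (strictly) increasing analytic function $g:(0,1)\to\mathbb{R}$ such that $0<g(b)<b$ for all $b\in(0,1)$. Besides, $\lim_{b\to1^-}g(b)=\sin^2\pi\omega^0_2$. Finally, for all $b\in(0,1)$, $$g(b)=\frac{3b}{1+b+2\sqrt{1-b+b^2}}\ \text{ if }\omega^0_2=\tfrac13,\qquad g(b)=\frac{b}{1+b}\ \text{ if }\omega^0_2=\tfrac14 .$$ -/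

import Mathlib

open Set Filter Topology

noncomputable section

namespace EllipsoidBilliard

variable {n : ℕ}

/-! ### Billiard trajectories inside an ellipsoid and their caustics -/

/-- `a = (a₁, …, aₙ₊₁)` (indexed from `0` in the code) are the parameters of a nondegenerate
ellipsoid `∑ xᵢ² / aᵢ = 1` of `ℝⁿ⁺¹`: `0 < a₁ < ⋯ < aₙ₊₁`. -/
def IsNondegenerate (a : Fin (n + 1) → ℝ) : Prop :=
  0 < a 0 ∧ StrictMono a

/-- The bilinear form `∑ xᵢ yᵢ / (aᵢ - μ)` of the confocal quadric
`Q_μ = {x : ∑ xᵢ² / (aᵢ - μ) = 1}`. -/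
def confocalForm (a : Fin (n + 1) → ℝ) (μ : ℝ) (x y : EuclideanSpace ℝ (Fin (n + 1))) : ℝ :=
  ∑ i, x i * y i / (a i - μ)

/-- The confocal quadric `Q_μ`. -/
def confocalQuadric (a : Fin (n + 1) → ℝ) (μ : ℝ) : Set (EuclideanSpace ℝ (Fin (n + 1))) :=
  {x | confocalForm a μ x x = 1}

/-- The ellipsoid `Q = Q₀`. -/
def ellipsoid (a : Fin (n + 1) → ℝ) : Set (EuclideanSpace ℝ (Fin (n + 1))) :=
  confocalQuadric a 0

/-- A normal vector `(xᵢ / aᵢ)ᵢ` to the ellipsoid at its point `x`. -/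
def ellipsoidNormal (a : Fin (n + 1) → ℝ) (x : EuclideanSpace ℝ (Fin (n + 1))) :
    EuclideanSpace ℝ (Fin (n + 1)) :=
  WithLp.toLp 2 fun i => x i / a i

/-- The unit velocity on the segment from the `k`-th to the `(k+1)`-st impact point. -/
def velocity (q : ℤ → EuclideanSpace ℝ (Fin (n + 1))) (k : ℤ) : EuclideanSpace ℝ (Fin (n + 1)) :=
  ‖q (k + 1) - q k‖⁻¹ • (q (k + 1) - q k)

/-- `(q_k)_{k ∈ ℤ}` is the sequence of impact points of a billiard trajectory inside the ellipsoid: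
consecutive impact points are distinct points of the ellipsoid, and at each impact the velocity is
reflected with respect to the tangent hyperplane. -/
structure IsBilliardTrajectory (a : Fin (n + 1) → ℝ)
    (q : ℤ → EuclideanSpace ℝ (Fin (n + 1))) : Prop where
  mem : ∀ k, q k ∈ ellipsoid a
  ne : ∀ k, q k ≠ q (k + 1)
  reflect : ∀ k, velocity q (k + 1) =
    (Submodule.span ℝ {ellipsoidNormal a (q (k + 1))})ᗮ.reflection (velocity q k)

/-- The line `{x + t v}` is tangent to `Q_μ`: the quadratic polynomial
`t ↦ ∑ (xᵢ + t vᵢ)² / (aᵢ - μ) - 1` has zero discriminant. (So a point of tangency may lie at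
infinity, which occurs for hyperboloids.) The condition depends only on the line. -/
def LineTangent (a : Fin (n + 1) → ℝ) (μ : ℝ) (x v : EuclideanSpace ℝ (Fin (n + 1))) : Prop :=
  confocalForm a μ x v ^ 2 = confocalForm a μ v v * (confocalForm a μ x x - 1)

/-- The nonsingular caustic space `Λ`: `0 < λ₁ < ⋯ < λₙ` and
`λᵢ ∈ (aᵢ₋₁, aᵢ) ∪ (aᵢ, aᵢ₊₁)`, where `a₀ = 0`. -/
def causticSpace (a : Fin (n + 1) → ℝ) : Set (Fin n → ℝ) :=
  {lam | (∀ i, 0 < lam i) ∧ StrictMono lam ∧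
    ∀ i : Fin n, lam i ∈
      Ioo ((Fin.cons 0 a : Fin (n + 2) → ℝ) i.castSucc.castSucc) (a i.castSucc) ∪
      Ioo (a i.castSucc) (a i.succ)}

/-- `lam ∈ Λ` is the caustic parameter of the (nonsingular) trajectory `q`: all the lines of the
trajectory are tangent to `Q_{λ₁}, …, Q_{λₙ}`. -/
def HasCausticParameter (a : Fin (n + 1) → ℝ) (q : ℤ → EuclideanSpace ℝ (Fin (n + 1)))
    (lam : Fin n → ℝ) : Prop :=
  lam ∈ causticSpace a ∧ ∀ k i, LineTangent a (lam i) (q k) (velocity q k)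

/-! ### The frequency map -/

/-- The numbers `c₀ = 0`, `c₁ ≤ ⋯ ≤ c₂ₙ₊₁`, where `c₁, …, c₂ₙ₊₁` is the increasing rearrangement of
`a₁, …, aₙ₊₁, λ₁, …, λₙ`. -/
def branchPoint (a : Fin (n + 1) → ℝ) (lam : Fin n → ℝ) : Fin (n + 1 + n + 1) → ℝ :=
  Fin.cons 0 (Fin.append a lam ∘ Tuple.sort (Fin.append a lam))

/-- `T(s) = ∏ (c_i - s) = ∏ (a_i - s) ∏ (λ_i - s)`. -/
def hyperellipticT (a : Fin (n + 1) → ℝ) (lam : Fin n → ℝ) (s : ℝ) : ℝ :=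
  (∏ i, (a i - s)) * ∏ i, (lam i - s)

/-- `K_{ij} = ∫_{c_{2j}}^{c_{2j+1}} s^i / √T(s) ds`, for `0 ≤ i ≤ n - 1` and `0 ≤ j ≤ n`. -/
def hyperellipticK (a : Fin (n + 1) → ℝ) (lam : Fin n → ℝ) (i : Fin n) (j : Fin (n + 1)) : ℝ :=
  ∫ s in (branchPoint a lam ⟨2 * j, by omega⟩)..(branchPoint a lam ⟨2 * j + 1, by omega⟩),
    s ^ (i : ℕ) / √(hyperellipticT a lam s)

/-- The matrix with columns `2 (-1)^j K_j`, `1 ≤ j ≤ n`. -/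
def frequencyMatrix (a : Fin (n + 1) → ℝ) (lam : Fin n → ℝ) : Matrix (Fin n) (Fin n) ℝ :=
  Matrix.of fun i j => 2 * (-1) ^ ((j : ℕ) + 1) * hyperellipticK a lam i j.succ

/-- The frequency map: `ω(λ)` is the solution of the linear system
`K₀ + 2 ∑_{j=1}^n (-1)^j ω_j K_j = 0`. (On `Λ` the vectors `K₁, …, Kₙ` are linearly independent.) -/
def frequencyMap (a : Fin (n + 1) → ℝ) (lam : Fin n → ℝ) : Fin n → ℝ :=
  (frequencyMatrix a lam)⁻¹.mulVec fun i => -hyperellipticK a lam i 0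

/-- The local diffeomorphism conjecture: for every nondegenerate ellipsoid (in every dimension) the
Jacobian determinant of the frequency map vanishes nowhere on the nonsingular caustic space. -/
def LocalDiffeoConjecture : Prop :=
  ∀ n : ℕ, 1 ≤ n → ∀ a : Fin (n + 1) → ℝ, IsNondegenerate a →
    ∀ lam ∈ causticSpace a, (fderiv ℝ (frequencyMap a) lam).det ≠ 0

/-! ### Triaxial ellipsoids of `ℝ³` with longest parameter `1` -/

/-- The parameter space `P = {(b, c) : 0 < c < b < 1}`. -/
def paramSpace : Set (ℝ × ℝ) :=
  {p | 0 < p.2 ∧ p.2 < p.1 ∧ p.1 < 1}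

/-- The parameters `(a₁, a₂, a₃) = (c, b, 1)` of the ellipsoid represented by `(b, c)`. -/
def triaxial (p : ℝ × ℝ) : Fin 3 → ℝ := ![p.2, p.1, 1]

/-- The frequency space `Ω = {(ω₁, ω₂) : 0 < ω₂ < ω₁ < 1/2}`. -/
def frequencySpace : Set (Fin 2 → ℝ) :=
  {w | 0 < w 1 ∧ w 1 < w 0 ∧ w 0 < 1 / 2}

/-- The component `E × H₁` of the caustic space, `E = (0, c)` and `H₁ = (c, b)`: the first caustic
is an ellipsoid and the second one is a one-sheet hyperboloid. -/
def typeEH1 (p : ℝ × ℝ) : Set (Fin 2 → ℝ) :=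
  {lam | lam 0 ∈ Ioo 0 p.2 ∧ lam 1 ∈ Ioo p.2 p.1}

/-- The component `H₁ ⊗ H₁` of the caustic space: both caustics are one-sheet hyperboloids. -/
def typeH1H1 (p : ℝ × ℝ) : Set (Fin 2 → ℝ) :=
  {lam | lam 0 ∈ Ioo p.2 p.1 ∧ lam 1 ∈ Ioo p.2 p.1 ∧ lam 0 < lam 1}

/-- The ellipsoids of `P` that have a billiard trajectory of frequency `w` whose caustic parameter
belongs to `C`. -/
def frequencyRegion (C : ℝ × ℝ → Set (Fin 2 → ℝ)) (w : Fin 2 → ℝ) : Set (ℝ × ℝ) :=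
  {p | p ∈ paramSpace ∧ ∃ (q : ℤ → EuclideanSpace ℝ (Fin 3)) (lam : Fin 2 → ℝ),
    IsBilliardTrajectory (triaxial p) q ∧ HasCausticParameter (triaxial p) q lam ∧
    lam ∈ C p ∧ frequencyMap (triaxial p) lam = w}

/-- The region of the ellipsoids with trajectories of type EH1 and frequency `w`. -/
def regionEH1 (w : Fin 2 → ℝ) : Set (ℝ × ℝ) := frequencyRegion typeEH1 w

/-- The region of the ellipsoids with trajectories of type H1H1 and frequency `w`. -/
def regionH1H1 (w : Fin 2 → ℝ) : Set (ℝ × ℝ) := frequencyRegion typeH1H1 w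

end EllipsoidBilliard

end

noncomputable section

namespace EllipsoidBilliard

open MeasureTheory
open scoped Real

/-! ### Billiard orbits through a given line -/

section Orbit

variable {n : ℕ}

local notation "E" => EuclideanSpace ℝ (Fin (n + 1))

/-! Write ρ(c, b) for `ellipticFrequency c b 1`, the planar billiard frequency with branch points c
< b < 1. The core fact is that the frequency map sends the component H1H1 exactly onto the part ω₂ >
ρ(c, b) of Ω (`LocalDiffeoConjecture.image_typeH1H1`), while its image of EH1 contains that part
(`LocalDiffeoConjecture.subset_image_typeEH1`). Hence P₂⁰ ⊂ P₁⁰, and P₂⁰ is the set ρ(c, b) < ω₂,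
which involves ω₂ only.

Both range statements are connectedness arguments. The conjecture for n = 2 makes the images open.
When caustic parameters approach the boundary of their component, either neighbouring branch points
merge or c₀ tends to 0, and each case pushes the limiting frequency to an edge: c₂ = c₃ gives ω₁ =
ω₂, c₀ = c₁ gives ω₁ = 1/2, c₀ = 0 gives ω₁ ≤ 0, and c₁ = c₂ drops the genus and turns ω₂ into a
planar frequency. So the images are relatively closed in convex strips of frequency space bounded by
the level ω₂ = ρ(c, b).

The edge estimates come from testing the linear system for ω on suitable polynomials of degree one.
The main tool is `BranchOrdered.lowPeriod_eq`: writing inverse square roots as Stieltjes transforms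
turns the period over (0, c₀) into periods over the two other intervals, weighted by the decreasing
function `angle` with values in (0, 1/2). The same device shows that differences of divergent
periods stay bounded (`BranchOrdered.leftPeriod_sub_rightPeriod`).

The conjecture for n = 1 makes ρ strictly increasing in c and strictly decreasing in b, so ρ(c, b) <
ω₂ means c < g(b), where g solves ρ(g(b), b) = ω₂ and increases. Analyticity of g follows from the
implicit function theorem for complexified periods. The limit at b = 1 follows from `angle c 1` ≤
ρ(c, b) ≤ `angle c b`. The two closed forms follow from translation by a 2-torsion point and
duplication on the elliptic curve y² = v (v + B) (v - A).

Since the regions ask for actual trajectories, it is also shown that every caustic parameter of the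
two types is realized, from an explicit line tangent to both caustics (`exists_trajectory`). -/

theorem confocalForm_comm (a : Fin (n + 1) → ℝ) (μ : ℝ) (x y : E) :
    confocalForm a μ x y = confocalForm a μ y x := by
  simp [confocalForm, mul_comm]

theorem confocalForm_add_left (a : Fin (n + 1) → ℝ) (μ : ℝ) (x y z : E) :
    confocalForm a μ (x + y) z = confocalForm a μ x z + confocalForm a μ y z := by
  simp only [confocalForm, PiLp.add_apply, ← Finset.sum_add_distrib]
  exact Finset.sum_congr rfl fun i _ => by ring

theorem confocalForm_smul_left (a : Fin (n + 1) → ℝ) (μ r : ℝ) (x y : E) :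
    confocalForm a μ (r • x) y = r * confocalForm a μ x y := by
  simp only [confocalForm, PiLp.smul_apply, smul_eq_mul, Finset.mul_sum]
  exact Finset.sum_congr rfl fun i _ => by ring

theorem confocalForm_add_right (a : Fin (n + 1) → ℝ) (μ : ℝ) (x y z : E) :
    confocalForm a μ x (y + z) = confocalForm a μ x y + confocalForm a μ x z := by
  simp only [confocalForm_comm a μ x, confocalForm_add_left]

theorem confocalForm_smul_right (a : Fin (n + 1) → ℝ) (μ r : ℝ) (x y : E) :
    confocalForm a μ x (r • y) = r * confocalForm a μ x y := by
  simp only [confocalForm_comm a μ x, confocalForm_smul_left]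

theorem confocalForm_neg_right (a : Fin (n + 1) → ℝ) (μ : ℝ) (x y : E) :
    confocalForm a μ x (-y) = -confocalForm a μ x y := by
  rw [← neg_one_smul ℝ y, confocalForm_smul_right]; ring

theorem confocalForm_neg_left (a : Fin (n + 1) → ℝ) (μ : ℝ) (x y : E) :
    confocalForm a μ (-x) y = -confocalForm a μ x y := by
  simp only [confocalForm_comm a μ _ y, confocalForm_neg_right]

theorem inner_ellipsoidNormal (a : Fin (n + 1) → ℝ) (x v : E) :
    inner ℝ (ellipsoidNormal a x) v = confocalForm a 0 x v := by
  simp only [PiLp.inner_apply, confocalForm, ellipsoidNormal, RCLike.inner_apply, conj_trivial,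
    sub_zero]
  exact Finset.sum_congr rfl fun i _ => by ring

/-- Partial fractions, 1/(a (a - μ)) = (1/(a - μ) - 1/a)/μ. This expresses every pairing with the
normal through the forms at μ and at 0, which is what makes tangency stable under reflection. -/
theorem confocalForm_ellipsoidNormal {a : Fin (n + 1) → ℝ} (ha : ∀ i, a i ≠ 0) {μ : ℝ}
    (hμ : μ ≠ 0) (hμa : ∀ i, a i ≠ μ) (x v : E) :
    confocalForm a μ (ellipsoidNormal a x) v
      = (confocalForm a μ x v - confocalForm a 0 x v) / μ := by
  simp only [confocalForm, ellipsoidNormal, ← Finset.sum_sub_distrib, Finset.sum_div, sub_zero]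
  refine Finset.sum_congr rfl fun i _ => ?_
  have := ha i
  have := sub_ne_zero.2 (hμa i)
  field_simp
  ring

theorem confocalForm_zero_pos {a : Fin (n + 1) → ℝ} (ha : ∀ i, 0 < a i) {v : E} (hv : v ≠ 0) :
    0 < confocalForm a 0 v v := by
  obtain ⟨i, hi⟩ : ∃ i, v i ≠ 0 := by
    by_contra! h
    exact hv (by ext i; simpa using h i)
  refine Finset.sum_pos' (fun j _ => ?_) ⟨i, Finset.mem_univ i, ?_⟩
  · have := ha j
    rw [sub_zero]
    exact div_nonneg (mul_self_nonneg _) this.le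
  · have := ha i
    rw [sub_zero]
    exact div_pos (mul_self_pos.2 hi) this

/-- The pairs of a point of the ellipsoid and a unit vector pointing to its interior. -/
def inwardVectors (a : Fin (n + 1) → ℝ) : Set (E × E) :=
  {z | z.1 ∈ ellipsoid a ∧ ‖z.2‖ = 1 ∧ confocalForm a 0 z.1 z.2 < 0}

/-- The other end of the chord of the ellipsoid from `x` in direction `v`. -/
def chordEnd (a : Fin (n + 1) → ℝ) (x v : E) : E :=
  x + (-2 * confocalForm a 0 x v / confocalForm a 0 v v) • v

/-- The reversal of the bounce at `x`. -/
def bounce (a : Fin (n + 1) → ℝ) (x v : E) : E :=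
  (Submodule.span ℝ {ellipsoidNormal a x}).reflection v

variable {a : Fin (n + 1) → ℝ}

theorem confocalForm_chordEnd (x v : E) (hv : confocalForm a 0 v v ≠ 0) :
    confocalForm a 0 (chordEnd a x v) v = -confocalForm a 0 x v := by
  rw [chordEnd, confocalForm_add_left, confocalForm_smul_left]
  field_simp
  ring

theorem chordEnd_mem {x v : E} (hx : x ∈ ellipsoid a) (hv : confocalForm a 0 v v ≠ 0) :
    chordEnd a x v ∈ ellipsoid a := by
  have h : confocalForm a 0 x x = 1 := hx
  change confocalForm a 0 _ _ = 1
  simp only [chordEnd, confocalForm_add_left, confocalForm_add_right, confocalForm_smul_left,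
    confocalForm_smul_right, h, confocalForm_comm a 0 v x]
  field_simp
  ring

theorem lineTangent_add_smul {μ : ℝ} {x v : E} (r : ℝ) :
    LineTangent a μ (x + r • v) v ↔ LineTangent a μ x v := by
  simp only [LineTangent, confocalForm_add_left, confocalForm_add_right, confocalForm_smul_left,
    confocalForm_smul_right, confocalForm_comm a μ v x]
  constructor <;> intro h <;> linear_combination h

theorem lineTangent_neg {μ : ℝ} {x v : E} : LineTangent a μ x (-v) ↔ LineTangent a μ x v := by
  simp only [LineTangent, confocalForm_neg_right, confocalForm_neg_left, neg_neg, neg_sq]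

theorem ellipsoidNormal_ne_zero {x : E} (hx : x ∈ ellipsoid a) : ellipsoidNormal a x ≠ 0 := by
  intro h0
  have h : confocalForm a 0 x x = 1 := hx
  rw [← inner_ellipsoidNormal, h0, inner_zero_left] at h
  exact zero_ne_one h

theorem bounce_eq (x v : E) : bounce a x v =
    (2 * confocalForm a 0 x v / confocalForm a 0 x (ellipsoidNormal a x)) •
      ellipsoidNormal a x + -v := by
  rw [bounce, Submodule.reflection_singleton_apply, ← inner_ellipsoidNormal,
    ← inner_ellipsoidNormal, real_inner_self_eq_norm_sq, two_nsmul, ← add_smul, sub_eq_add_neg]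
  simp only [RCLike.ofReal_real_eq_id, id]
  congr 2
  ring

theorem confocalForm_bounce {x v : E} (hx : x ∈ ellipsoid a) :
    confocalForm a 0 x (bounce a x v) = confocalForm a 0 x v := by
  have hN : confocalForm a 0 x (ellipsoidNormal a x) ≠ 0 := by
    rw [← inner_ellipsoidNormal]
    exact inner_self_ne_zero.2 (ellipsoidNormal_ne_zero hx)
  rw [bounce_eq, confocalForm_add_right, confocalForm_smul_right, confocalForm_neg_right]
  field_simp
  ring

/-- Tangency to a confocal quadric is preserved by the reflection at an impact point. -/
theorem lineTangent_bounce (ha : ∀ i, a i ≠ 0) {μ : ℝ} (hμ : μ ≠ 0) (hμa : ∀ i, a i ≠ μ)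
    {x v : E} (hx : x ∈ ellipsoid a) :
    LineTangent a μ x (bounce a x v) ↔ LineTangent a μ x v := by
  have hN : confocalForm a 0 x (ellipsoidNormal a x) ≠ 0 := by
    rw [← inner_ellipsoidNormal]
    exact inner_self_ne_zero.2 (ellipsoidNormal_ne_zero hx)
  have h1 : confocalForm a 0 x x = 1 := hx
  set ν := ellipsoidNormal a x with hν
  have e1 : confocalForm a μ ν v = (confocalForm a μ x v - confocalForm a 0 x v) / μ :=
    confocalForm_ellipsoidNormal ha hμ hμa x v
  have e2 : confocalForm a μ ν x = (confocalForm a μ x x - 1) / μ := by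
    rw [hν, confocalForm_ellipsoidNormal ha hμ hμa x x, h1]
  have e3 : confocalForm a μ ν ν
      = ((confocalForm a μ x x - 1) / μ - confocalForm a 0 x ν) / μ := by
    rw [← e2, confocalForm_comm a μ ν x]
    exact confocalForm_ellipsoidNormal ha hμ hμa x ν
  simp only [LineTangent, bounce_eq, confocalForm_add_left, confocalForm_add_right,
    confocalForm_smul_left, confocalForm_smul_right, confocalForm_neg_left,
    confocalForm_neg_right, confocalForm_comm a μ v ν, confocalForm_comm a μ x ν, ← hν, e1, e2, e3]
  generalize confocalForm a 0 x ν = N at *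
  -- With X = ⟨x, x⟩_μ - 1, Y = ⟨x, v⟩_μ, Z = ⟨v, v⟩_μ and m = ⟨x, v⟩₀, the tangency discriminant Y²
  -- - ZX is invariant under the reflection.
  have key : ∀ X Y Z m : ℝ,
      (2 * m / N * (X / μ) + -Y) ^ 2 -
      (2 * m / N * (2 * m / N * ((X / μ - N) / μ) + -((Y - m) / μ)) +
          -(2 * m / N * ((Y - m) / μ) + -Z)) * X = Y ^ 2 - Z * X := by
    intro X Y Z m
    field_simp
    ring
  have := key (confocalForm a μ x x - 1) (confocalForm a μ x v) (confocalForm a μ v v)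
    (confocalForm a 0 x v)
  constructor <;> intro h
  · linear_combination h - this
  · linear_combination h + this

theorem ne_zero_of_mem_inwardVectors {z : E × E} (hz : z ∈ inwardVectors a) : z.2 ≠ 0 := by
  intro h
  have := hz.2.1
  simp [h] at this

theorem bounce_mem_inwardVectors {z : E × E} (hz : z ∈ inwardVectors a) :
    (z.1, bounce a z.1 z.2) ∈ inwardVectors a :=
  ⟨hz.1, by simpa [bounce] using hz.2.1, by simpa [confocalForm_bounce hz.1] using hz.2.2⟩

theorem chordEnd_mem_inwardVectors (ha : ∀ i, 0 < a i) {z : E × E} (hz : z ∈ inwardVectors a) :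
    (chordEnd a z.1 z.2, -z.2) ∈ inwardVectors a := by
  have hv := (confocalForm_zero_pos ha (ne_zero_of_mem_inwardVectors hz)).ne'
  refine ⟨chordEnd_mem hz.1 hv, by simpa using hz.2.1, ?_⟩
  simpa [confocalForm_neg_right, confocalForm_chordEnd _ _ hv] using hz.2.2

theorem chordEnd_chordEnd {x v : E} (hv : confocalForm a 0 v v ≠ 0) :
    chordEnd a (chordEnd a x v) (-v) = x := by
  have h : confocalForm a 0 (chordEnd a x v) (-v) = confocalForm a 0 x v := by
    rw [confocalForm_neg_right, confocalForm_chordEnd x v hv, neg_neg]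
  rw [chordEnd, h, confocalForm_neg_left, confocalForm_neg_right, neg_neg, chordEnd, smul_neg,
    add_assoc, add_neg_cancel, add_zero]

/-- The billiard map on the inward unit vectors, as a composition of two involutions. -/
def billiardMap (ha : ∀ i, 0 < a i) : Equiv.Perm (inwardVectors a) :=
  (Function.Involutive.toPerm
    (fun z : inwardVectors a => ⟨_, chordEnd_mem_inwardVectors ha z.2⟩) (by
      rintro ⟨⟨x, v⟩, hz⟩
      have hv := (confocalForm_zero_pos ha (ne_zero_of_mem_inwardVectors hz)).ne'
      simp [chordEnd_chordEnd hv])).trans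
  (Function.Involutive.toPerm
    (fun z : inwardVectors a => ⟨_, bounce_mem_inwardVectors z.2⟩) (by
      rintro ⟨⟨x, v⟩, hz⟩
      simp [bounce]))

theorem billiardMap_apply (ha : ∀ i, 0 < a i) (z : inwardVectors a) :
    (billiardMap ha z : E × E) =
      (chordEnd a z.1.1 z.1.2, bounce a (chordEnd a z.1.1 z.1.2) (-z.1.2)) := rfl

/-- Every inward unit vector generates a billiard trajectory, and all lines of the trajectory are
tangent to the confocal quadrics to which the first one is tangent. -/
theorem exists_billiardTrajectory (ha : ∀ i, 0 < a i) (z₀ : E × E) (hz₀ : z₀ ∈ inwardVectors a) :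
    ∃ q : ℤ → E, IsBilliardTrajectory a q ∧ ∀ μ, μ ≠ 0 → (∀ i, a i ≠ μ) →
      LineTangent a μ z₀.1 z₀.2 → ∀ k, LineTangent a μ (q k) (velocity q k) := by
  set f := billiardMap ha with hf
  set z : ℤ → inwardVectors a := fun k => (f ^ k) ⟨z₀, hz₀⟩ with hzdef
  have hsucc : ∀ k, z (k + 1) = f (z k) := fun k => by
    simp only [hzdef, add_comm k 1, zpow_add, zpow_one, Equiv.Perm.mul_apply]
  have hne : ∀ k, confocalForm a 0 (z k).1.2 (z k).1.2 ≠ 0 := fun k =>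
    (confocalForm_zero_pos ha (ne_zero_of_mem_inwardVectors (z k).2)).ne'
  have hfst : ∀ k, (z (k + 1)).1.1 = chordEnd a (z k).1.1 (z k).1.2 := fun k => by
    rw [hsucc, hf, billiardMap_apply]
  have hsnd : ∀ k, (z (k + 1)).1.2 = bounce a (z (k + 1)).1.1 (-(z k).1.2) := fun k => by
    rw [hfst, hsucc, hf, billiardMap_apply]
  have hpos : ∀ k, 0 < -2 * confocalForm a 0 (z k).1.1 (z k).1.2 /
      confocalForm a 0 (z k).1.2 (z k).1.2 := fun k =>
    div_pos (by linarith [(z k).2.2.2])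
      (confocalForm_zero_pos ha (ne_zero_of_mem_inwardVectors (z k).2))
  set q : ℤ → E := fun k => (z k).1.1 with hq
  have hdiff : ∀ k, q (k + 1) - q k = (-2 * confocalForm a 0 (z k).1.1 (z k).1.2 /
      confocalForm a 0 (z k).1.2 (z k).1.2) • (z k).1.2 := fun k => by
    simp only [hq, hfst, chordEnd, add_sub_cancel_left]
  have hvel : ∀ k, velocity q k = (z k).1.2 := fun k => by
    rw [velocity, hdiff, norm_smul, (z k).2.2.1, mul_one, smul_smul, Real.norm_eq_abs,
      abs_of_pos (hpos k), inv_mul_cancel₀ (hpos k).ne', one_smul]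
  refine ⟨q, ⟨fun k => (z k).2.1, fun k h => ?_, fun k => ?_⟩, fun μ hμ hμa h0 k => ?_⟩
  · have h1 := hdiff k
    rw [← h, sub_self] at h1
    exact (smul_ne_zero (hpos k).ne' (ne_zero_of_mem_inwardVectors (z k).2)) h1.symm
  -- Reflecting -v in the normal line is the same as reflecting v in the tangent hyperplane.
  · rw [hvel, hvel, hsnd, bounce, Submodule.reflection_orthogonal_apply, map_neg]
  · have hstep : ∀ w : inwardVectors a,
        LineTangent a μ (f w).1.1 (f w).1.2 ↔ LineTangent a μ w.1.1 w.1.2 := by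
      intro w
      rw [hf, billiardMap_apply]
      simp only
      rw [lineTangent_bounce (fun i => (ha i).ne') hμ hμa
        (chordEnd_mem_inwardVectors ha w.2).1, lineTangent_neg, chordEnd, lineTangent_add_smul]
    rw [hvel]
    change LineTangent a μ (z k).1.1 (z k).1.2
    induction k using Int.induction_on with
    | zero => simpa [hzdef] using h0
    | succ k ih => rw [hsucc]; exact (hstep _).2 ih
    | pred k ih =>
      have := hsucc (-(k : ℤ) - 1)
      rw [sub_add_cancel] at this
      rw [this] at ih
      exact (hstep _).1 ih

end Orbit

/-! ### Lines tangent to two given caustics of a triaxial ellipsoid -/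

theorem triaxial_pos {p : ℝ × ℝ} (hp : p ∈ paramSpace) (i : Fin 3) : 0 < triaxial p i := by
  obtain ⟨h1, h2, h3⟩ := hp
  fin_cases i <;> simp [triaxial] <;> linarith

theorem confocalForm_three (a : Fin 3 → ℝ) (μ : ℝ) (x y : EuclideanSpace ℝ (Fin 3)) :
    confocalForm (n := 2) a μ x y =
      x 0 * y 0 / (a 0 - μ) + x 1 * y 1 / (a 1 - μ) + x 2 * y 2 / (a 2 - μ) :=
  Fin.sum_univ_three _

/-- Through a point of intersection of the ellipsoid, the one-sheet hyperboloid `Q_ν` and the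
plane `x₃ = 0` there is a line tangent to `Q_ν` and to `Q_μ`. -/
theorem exists_inwardVector_lineTangent {p : ℝ × ℝ} (hp : p ∈ paramSpace) {μ ν : ℝ}
    (hν : ν ∈ Ioo p.2 p.1) (hμ : μ ∈ Ioo 0 1) (hμb : μ ≠ p.1) (hμc : μ ≠ p.2) :
    ∃ z ∈ inwardVectors (triaxial p),
      LineTangent (triaxial p) ν z.1 z.2 ∧ LineTangent (triaxial p) μ z.1 z.2 := by
  obtain ⟨b, c⟩ := p
  obtain ⟨hc, hcb, hb⟩ := hp
  obtain ⟨h1, h2⟩ := hν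
  obtain ⟨h3, h4⟩ := hμ
  simp only at *
  have hX : 0 ≤ c * (ν - c) / (b - c) := by
    apply div_nonneg (mul_nonneg _ _) <;> linarith
  have hY : 0 ≤ b * (b - ν) / (b - c) := by
    apply div_nonneg (mul_nonneg _ _) <;> linarith
  set X := √(c * (ν - c) / (b - c)) with hXdef
  set Y := √(b * (b - ν) / (b - c)) with hYdef
  have hX2 : X ^ 2 = c * (ν - c) / (b - c) := Real.sq_sqrt hX
  have hY2 : Y ^ 2 = b * (b - ν) / (b - c) := Real.sq_sqrt hY
  have hbc : b - c ≠ 0 := by linarith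
  have hb0 : b ≠ 0 := by linarith
  have hc0 : c ≠ 0 := hc.ne'
  have hν0 : ν ≠ 0 := by linarith
  have hcν : c - ν ≠ 0 := by linarith
  have hbν : b - ν ≠ 0 := by linarith
  have hcμ : c - μ ≠ 0 := sub_ne_zero.2 hμc.symm
  have hbμ : b - μ ≠ 0 := sub_ne_zero.2 hμb.symm
  have h1μ : 1 - μ ≠ 0 := by linarith
  have h1ν : 1 - ν ≠ 0 := by linarith
  set N := X ^ 2 / c ^ 2 + Y ^ 2 / b ^ 2 with hN
  have hNval : N = ν / (b * c) := by
    rw [hN, hX2, hY2]; field_simp; ring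
  have hNpos : 0 < N := by rw [hNval]; exact div_pos (by linarith) (by nlinarith)
  -- N is the squared norm of the normal (X/c, Y/b, 0). The choice A² N = μ, B² = 1 - μ gives a unit
  -- vector and, as checked below, tangency to Q_μ.
  set A := √(μ / N) with hA
  have hA2 : A ^ 2 = μ / N := Real.sq_sqrt (div_nonneg h3.le hNpos.le)
  have hApos : 0 < A := Real.sqrt_pos.2 (div_pos h3 hNpos)
  set B := √(1 - μ) with hB
  have hB2 : B ^ 2 = 1 - μ := Real.sq_sqrt (by linarith)
  -- The direction combines the inward normal of Q with e₃. Both lie in the tangent plane of Q_ν at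
  -- this point: the first because confocal quadrics meet orthogonally, the second because the point
  -- is on the symmetry plane. Hence tangency to Q_ν holds for every such combination.
  refine ⟨(!₂[X, Y, 0], !₂[-A * (X / c), -A * (Y / b), B]), ⟨?_, ?_, ?_⟩, ?_, ?_⟩
  · simp only [ellipsoid, confocalQuadric, confocalForm_three, triaxial, mem_ofPred_eq]
    simp
    rw [← pow_two, ← pow_two, hX2, hY2]; field_simp; ring
  · rw [EuclideanSpace.norm_eq, Real.sqrt_eq_one]
    refine (Fin.sum_univ_three _).trans ?_
    simp only [Real.norm_eq_abs, sq_abs]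
    simp
    have : (A * (X / c)) ^ 2 + (A * (Y / b)) ^ 2 + B ^ 2 = A ^ 2 * N + B ^ 2 := by rw [hN]; ring
    rw [this, hA2, hB2]
    field_simp
    ring
  · simp only [confocalForm_three, triaxial]
    simp
    have : -(X * (A * (X / c))) / c + -(Y * (A * (Y / b))) / b = -(A * N) := by rw [hN]; ring
    rw [this]
    nlinarith
  · simp only [LineTangent, confocalForm_three, triaxial]
    simp
    have e1 : -(X * (A * (X / c))) / (c - ν) + -(Y * (A * (Y / b))) / (b - ν) = 0 := by
      have : -(X * (A * (X / c))) / (c - ν) + -(Y * (A * (Y / b))) / (b - ν)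
        = -A * (X ^ 2 / (c * (c - ν)) + Y ^ 2 / (b * (b - ν))) := by field_simp; ring
      rw [this, hX2, hY2]; field_simp; ring
    have e2 : X * X / (c - ν) + Y * Y / (b - ν) - 1 = 0 := by
      rw [← pow_two, ← pow_two, hX2, hY2]; field_simp; ring
    rw [e1, e2]; ring
  · simp only [LineTangent, confocalForm_three, triaxial]
    simp
    have e1 : -(X * (A * (X / c))) / (c - μ) + -(Y * (A * (Y / b))) / (b - μ)
        = -A * (X ^ 2 / (c * (c - μ)) + Y ^ 2 / (b * (b - μ))) := by field_simp; ring
    have e2 : A * (X / c) * (A * (X / c)) / (c - μ) + A * (Y / b) * (A * (Y / b)) / (b - μ)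
        + B * B / (1 - μ)
        = A ^ 2 * (X ^ 2 / (c ^ 2 * (c - μ)) + Y ^ 2 / (b ^ 2 * (b - μ))) + B ^ 2 / (1 - μ) := by
      field_simp
    have e3 : X * X / (c - μ) + Y * Y / (b - μ) - 1
        = X ^ 2 / (c - μ) + Y ^ 2 / (b - μ) - 1 := by ring
    rw [e1, e2, e3, mul_pow, neg_sq, hA2, hB2, hNval, hX2, hY2]
    field_simp
    ring

/-! ### Integrals of continuous functions against compactly supported measures -/

theorem integrable_of_ae_mem {X : Type*} [TopologicalSpace X] [MeasurableSpace X]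
    [OpensMeasurableSpace X] [T2Space X] {μ : Measure X} [IsFiniteMeasure μ]
    {K : Set X} (hK : IsCompact K) (hμ : ∀ᵐ x ∂μ, x ∈ K) {f : X → ℝ} (hf : ContinuousOn f K) :
    Integrable f μ := by
  have h := hf.integrableOn_compact' hK hK.measurableSet (μ := μ)
  rwa [IntegrableOn, Measure.restrict_eq_self_of_ae_mem hμ] at h

theorem integral_integral_swap_of_ae_mem {μ ν : Measure ℝ} [IsFiniteMeasure μ]
    [IsFiniteMeasure ν] {K L : Set ℝ} (hK : IsCompact K) (hL : IsCompact L)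
    (hμ : ∀ᵐ x ∂μ, x ∈ K) (hν : ∀ᵐ x ∂ν, x ∈ L) {f : ℝ → ℝ → ℝ}
    (hf : ContinuousOn (Function.uncurry f) (K ×ˢ L)) :
    ∫ x, ∫ y, f x y ∂ν ∂μ = ∫ y, ∫ x, f x y ∂μ ∂ν := by
  refine integral_integral_swap (integrable_of_ae_mem (hK.prod hL) ?_ hf)
  have h1 := Measure.quasiMeasurePreserving_fst (μ := μ) (ν := ν) |>.ae hμ
  have h2 := Measure.quasiMeasurePreserving_snd (μ := μ) (ν := ν) |>.ae hν
  filter_upwards [h1, h2] with z hz1 hz2 using ⟨hz1, hz2⟩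

theorem integral_pos_of_ae_mem {μ : Measure ℝ} [IsFiniteMeasure μ] (hμ0 : μ ≠ 0) {K : Set ℝ}
    (hK : IsCompact K) (hμ : ∀ᵐ x ∂μ, x ∈ K) {f : ℝ → ℝ} (hf : ContinuousOn f K)
    (hpos : ∀ x ∈ K, 0 < f x) : 0 < ∫ x, f x ∂μ := by
  refine (integral_pos_iff_support_of_nonneg_ae ?_ (integrable_of_ae_mem hK hμ hf)).2 ?_
  · filter_upwards [hμ] with x hx using (hpos x hx).le
  · rw [pos_iff_ne_zero]
    intro h0
    refine hμ0 (ae_eq_bot.1 ?_)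
    rw [← Filter.empty_mem_iff_bot]
    filter_upwards [hμ, measure_eq_zero_iff_ae_notMem.1 h0] with x hx hx'
    exact hx' (hpos x hx).ne'

/-! ### The measures `ds / √(c - s)` on `[0, c]` and `dt / √((t - c) (d - t))` on `[c, d]` -/

/-- Parametrization of `[c, d]` by `[0, π / 2]`. -/
def arcPoint (c d φ : ℝ) : ℝ := c + (d - c) * Real.sin φ ^ 2

/-- The measure `dt / √((t - c) (d - t))` on `[c, d]`; it is `π` times a Dirac measure if
`c = d`. -/
def arcMeasure (c d : ℝ) : Measure ℝ :=
  ((2 : NNReal) • volume.restrict (Ioo 0 (π / 2))).map (arcPoint c d)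

/-- The measure `ds / √(c - s)` on `[0, c]`. -/
def lowMeasure (c : ℝ) : Measure ℝ :=
  ((2 * √c).toNNReal • volume.restrict (Ioo (0 : ℝ) 1)).map fun u => c * (1 - u ^ 2)

theorem continuous_arcPoint (c d : ℝ) : Continuous (arcPoint c d) := by
  unfold arcPoint; fun_prop

instance (c d : ℝ) : IsFiniteMeasure (arcMeasure c d) := by
  unfold arcMeasure; infer_instance

instance (c : ℝ) : IsFiniteMeasure (lowMeasure c) := by
  unfold lowMeasure; infer_instance

theorem arcPoint_mem {c d : ℝ} (h : c ≤ d) (φ : ℝ) : arcPoint c d φ ∈ Icc c d := by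
  have h1 := Real.sin_sq_le_one φ
  have h2 := sq_nonneg (Real.sin φ)
  constructor <;> unfold arcPoint <;> nlinarith

theorem ae_arcMeasure {c d : ℝ} (h : c ≤ d) : ∀ᵐ t ∂arcMeasure c d, t ∈ Icc c d := by
  rw [arcMeasure, ae_map_iff (p := (· ∈ Icc c d)) (continuous_arcPoint c d).aemeasurable
    measurableSet_Icc]
  exact Eventually.of_forall (arcPoint_mem h)

theorem ae_lowMeasure {c : ℝ} (h : 0 ≤ c) : ∀ᵐ t ∂lowMeasure c, t ∈ Icc 0 c := by
  rw [lowMeasure, ae_map_iff (p := (· ∈ Icc 0 c)) (by fun_prop) measurableSet_Icc]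
  refine Measure.ae_smul_measure ?_ _
  filter_upwards [ae_restrict_mem measurableSet_Ioo] with u hu
  have h1 : 0 ≤ u ^ 2 := sq_nonneg u
  have h2 : u ^ 2 ≤ 1 := by nlinarith [hu.1, hu.2]
  constructor <;> nlinarith

theorem integral_arcMeasure {c d : ℝ} (h : c ≤ d) {f : ℝ → ℝ} (hf : ContinuousOn f (Icc c d)) :
    ∫ t, f t ∂arcMeasure c d = 2 * ∫ φ in (0)..(π / 2), f (arcPoint c d φ) := by
  have := (integrable_of_ae_mem isCompact_Icc (ae_arcMeasure h) hf).aestronglyMeasurable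
  rw [arcMeasure] at this ⊢
  rw [integral_map (continuous_arcPoint c d).aemeasurable this, integral_smul_nnreal_measure,
    intervalIntegral.integral_of_le (by positivity), integral_Ioc_eq_integral_Ioo]
  rfl

theorem integral_lowMeasure {c : ℝ} (h : 0 ≤ c) {f : ℝ → ℝ} (hf : ContinuousOn f (Icc 0 c)) :
    ∫ s, f s ∂lowMeasure c = 2 * √c * ∫ u in (0 : ℝ)..1, f (c * (1 - u ^ 2)) := by
  have := (integrable_of_ae_mem isCompact_Icc (ae_lowMeasure h) hf).aestronglyMeasurable
  rw [lowMeasure] at this ⊢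
  rw [integral_map (by fun_prop) this, integral_smul_nnreal_measure,
    intervalIntegral.integral_of_le zero_le_one, integral_Ioc_eq_integral_Ioo, NNReal.smul_def,
    Real.coe_toNNReal _ (by positivity)]
  rfl

theorem arcMeasure_real_univ (c d : ℝ) : (arcMeasure c d).real univ = π := by
  rw [arcMeasure, Measure.real, Measure.map_apply (continuous_arcPoint c d).measurable .univ]
  simp only [preimage_univ, Measure.smul_apply, Measure.restrict_apply_univ, Real.volume_Ioo,
    sub_zero]
  rw [ENNReal.smul_def, smul_eq_mul, ENNReal.toReal_mul, ENNReal.toReal_ofReal (by positivity)]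
  simp
  ring

theorem arcMeasure_ne_zero (c d : ℝ) : arcMeasure c d ≠ 0 := by
  intro h
  have := arcMeasure_real_univ c d
  simp [h] at this
  exact Real.pi_pos.ne this

theorem lowMeasure_real_univ (c : ℝ) : (lowMeasure c).real univ = 2 * √c := by
  rw [lowMeasure, Measure.real, Measure.map_apply (by fun_prop) .univ]
  simp only [preimage_univ, Measure.smul_apply, Measure.restrict_apply_univ, Real.volume_Ioo,
    sub_zero]
  rw [ENNReal.smul_def, smul_eq_mul, ENNReal.toReal_mul, ENNReal.toReal_ofReal (by positivity)]
  simp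

theorem lowMeasure_ne_zero {c : ℝ} (h : 0 < c) : lowMeasure c ≠ 0 := by
  intro h0
  have := lowMeasure_real_univ c
  simp [h0] at this
  linarith [Real.sqrt_eq_zero'.1 this]

theorem integrable_arcMeasure {c d : ℝ} (h : c ≤ d) {f : ℝ → ℝ} (hf : ContinuousOn f (Icc c d)) :
    Integrable f (arcMeasure c d) :=
  integrable_of_ae_mem isCompact_Icc (ae_arcMeasure h) hf

theorem integrable_lowMeasure {c : ℝ} (h : 0 ≤ c) {f : ℝ → ℝ} (hf : ContinuousOn f (Icc 0 c)) :
    Integrable f (lowMeasure c) :=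
  integrable_of_ae_mem isCompact_Icc (ae_lowMeasure h) hf

theorem integral_arcMeasure_pos {c d : ℝ} (h : c ≤ d) {f : ℝ → ℝ} (hf : ContinuousOn f (Icc c d))
    (hpos : ∀ t ∈ Icc c d, 0 < f t) : 0 < ∫ t, f t ∂arcMeasure c d :=
  integral_pos_of_ae_mem (arcMeasure_ne_zero c d) isCompact_Icc (ae_arcMeasure h) hf hpos

theorem integral_lowMeasure_pos {c : ℝ} (h : 0 < c) {f : ℝ → ℝ} (hf : ContinuousOn f (Icc 0 c))
    (hpos : ∀ t ∈ Icc 0 c, 0 < f t) : 0 < ∫ t, f t ∂lowMeasure c :=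
  integral_pos_of_ae_mem (lowMeasure_ne_zero h) isCompact_Icc (ae_lowMeasure h.le) hf hpos

theorem integral_arcMeasure_mono {c d : ℝ} (h : c ≤ d) {f g : ℝ → ℝ}
    (hf : ContinuousOn f (Icc c d)) (hg : ContinuousOn g (Icc c d))
    (hle : ∀ t ∈ Icc c d, f t ≤ g t) : ∫ t, f t ∂arcMeasure c d ≤ ∫ t, g t ∂arcMeasure c d := by
  refine integral_mono_ae (integrable_arcMeasure h hf) (integrable_arcMeasure h hg) ?_
  filter_upwards [ae_arcMeasure h] with t ht using hle t ht

theorem integral_lowMeasure_mono {c : ℝ} (h : 0 ≤ c) {f g : ℝ → ℝ}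
    (hf : ContinuousOn f (Icc 0 c)) (hg : ContinuousOn g (Icc 0 c))
    (hle : ∀ t ∈ Icc 0 c, f t ≤ g t) : ∫ t, f t ∂lowMeasure c ≤ ∫ t, g t ∂lowMeasure c := by
  refine integral_mono_ae (integrable_lowMeasure h hf) (integrable_lowMeasure h hg) ?_
  filter_upwards [ae_lowMeasure h] with t ht using hle t ht

theorem integral_arcMeasure_congr {c d : ℝ} (h : c ≤ d) {f g : ℝ → ℝ}
    (hle : ∀ t ∈ Icc c d, f t = g t) : ∫ t, f t ∂arcMeasure c d = ∫ t, g t ∂arcMeasure c d := by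
  refine integral_congr_ae ?_
  filter_upwards [ae_arcMeasure h] with t ht using hle t ht

theorem integral_lowMeasure_congr {c : ℝ} (h : 0 ≤ c) {f g : ℝ → ℝ}
    (hle : ∀ t ∈ Icc 0 c, f t = g t) : ∫ t, f t ∂lowMeasure c = ∫ t, g t ∂lowMeasure c := by
  refine integral_congr_ae ?_
  filter_upwards [ae_lowMeasure h] with t ht using hle t ht

/-! ### Substitutions -/

theorem intervalIntegral_div_sqrt_eq_lowMeasure {c : ℝ} (hc : 0 < c) {f : ℝ → ℝ}
    (hf : ContinuousOn f (Icc 0 c)) :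
    ∫ s in (0)..c, f s / √(c - s) = ∫ s, f s ∂lowMeasure c := by
  rw [integral_lowMeasure hc.le hf, intervalIntegral.integral_of_le hc.le,
    integral_Ioc_eq_integral_Ioo, intervalIntegral.integral_of_le zero_le_one,
    integral_Ioc_eq_integral_Ioo, ← integral_const_mul]
  have himg : (fun u : ℝ => c * (1 - u ^ 2)) '' Ioo 0 1 = Ioo 0 c := by
    ext s
    constructor
    · rintro ⟨u, ⟨h0, h1⟩, rfl⟩
      have h2 : u ^ 2 < 1 := by nlinarith
      constructor
      · exact mul_pos hc (by linarith)
      · nlinarith [mul_pos hc (pow_pos h0 2)]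
    · rintro ⟨h0, h1⟩
      refine ⟨√(1 - s / c), ⟨Real.sqrt_pos.2 ?_, ?_⟩, ?_⟩
      · rw [sub_pos, div_lt_one hc]; exact h1
      · rw [Real.sqrt_lt' one_pos]; linarith [div_pos h0 hc]
      · have : 0 ≤ 1 - s / c := by rw [sub_nonneg, div_le_one hc]; exact h1.le
        simp only [Real.sq_sqrt this]
        field_simp
        ring
  have hder : ∀ u ∈ Ioo (0 : ℝ) 1, HasDerivWithinAt (fun u : ℝ => c * (1 - u ^ 2))
      (c * (-(2 * u))) (Ioo 0 1) u := fun u _ => by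
    have := (((hasDerivAt_id u).pow 2).const_sub 1).const_mul c
    simpa using this.hasDerivWithinAt
  rw [← himg, integral_image_eq_integral_abs_deriv_smul measurableSet_Ioo
    (f' := fun u => c * (-(2 * u))) hder ?_]
  · refine setIntegral_congr_fun measurableSet_Ioo fun u hu => ?_
    have h1 : c - c * (1 - u ^ 2) = c * u ^ 2 := by ring
    have h2 : |c * (-(2 * u))| = 2 * (√c * √c) * u := by
      rw [Real.mul_self_sqrt hc.le, mul_neg, abs_neg, abs_of_pos (mul_pos hc (by linarith [hu.1]))]
      ring
    have h3 := (Real.sqrt_pos.2 hc).ne'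
    have h4 := hu.1.ne'
    simp only [h1, h2, Real.sqrt_mul hc.le, Real.sqrt_sq hu.1.le, smul_eq_mul]
    field_simp
  · intro u hu v hv huv
    have h1 : u ^ 2 = v ^ 2 := by
      have := mul_left_cancel₀ hc.ne' huv
      linarith
    exact (sq_eq_sq₀ hu.1.le hv.1.le).1 h1

theorem intervalIntegral_div_sqrt_eq_arcMeasure {c d : ℝ} (hcd : c < d) {f : ℝ → ℝ}
    (hf : ContinuousOn f (Icc c d)) :
    ∫ t in c..d, f t / √((t - c) * (d - t)) = ∫ t, f t ∂arcMeasure c d := by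
  rw [integral_arcMeasure hcd.le hf, intervalIntegral.integral_of_le hcd.le,
    integral_Ioc_eq_integral_Ioo, intervalIntegral.integral_of_le (by positivity),
    integral_Ioc_eq_integral_Ioo, ← integral_const_mul]
  have hd : 0 < d - c := sub_pos.2 hcd
  have hsin : ∀ φ ∈ Ioo 0 (π / 2), 0 < Real.sin φ := fun φ hφ =>
    Real.sin_pos_of_pos_of_lt_pi hφ.1 (by linarith [hφ.2, Real.pi_pos])
  have hcos : ∀ φ ∈ Ioo 0 (π / 2), 0 < Real.cos φ := fun φ hφ =>
    Real.cos_pos_of_mem_Ioo ⟨by linarith [hφ.1, Real.pi_pos], hφ.2⟩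
  have himg : arcPoint c d '' Ioo 0 (π / 2) = Ioo c d := by
    ext s
    constructor
    · rintro ⟨φ, hφ, rfl⟩
      have h1 := hsin φ hφ
      have h2 := hcos φ hφ
      have h3 := Real.sin_sq_add_cos_sq φ
      constructor
      · have := mul_pos hd (pow_pos h1 2)
        unfold arcPoint; linarith
      · have := mul_pos hd (pow_pos h2 2)
        unfold arcPoint; nlinarith
    · rintro ⟨h0, h1⟩
      have h2 : 0 < (s - c) / (d - c) := div_pos (by linarith) hd
      have h3 : (s - c) / (d - c) < 1 := by rw [div_lt_one hd]; linarith
      refine ⟨Real.arcsin √((s - c) / (d - c)), ⟨Real.arcsin_pos.2 (Real.sqrt_pos.2 h2), ?_⟩, ?_⟩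
      · rw [Real.arcsin_lt_pi_div_two, Real.sqrt_lt' one_pos]; linarith
      · rw [arcPoint, Real.sin_arcsin (by linarith [Real.sqrt_nonneg ((s - c) / (d - c))])
          (Real.sqrt_le_one.2 h3.le), Real.sq_sqrt h2.le]
        field_simp
        ring
  have hder : ∀ φ ∈ Ioo 0 (π / 2), HasDerivWithinAt (arcPoint c d)
      ((d - c) * (2 * Real.sin φ * Real.cos φ)) (Ioo 0 (π / 2)) φ := fun φ _ => by
    have := ((((Real.hasDerivAt_sin φ).pow 2).const_mul (d - c)).const_add c)
    refine (this.congr_deriv ?_).hasDerivWithinAt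
    norm_num
  rw [← himg, integral_image_eq_integral_abs_deriv_smul measurableSet_Ioo
    (f' := fun φ => (d - c) * (2 * Real.sin φ * Real.cos φ)) hder ?_]
  · refine setIntegral_congr_fun measurableSet_Ioo fun φ hφ => ?_
    have h1 := hsin φ hφ
    have h2 := hcos φ hφ
    have h3 := Real.sin_sq_add_cos_sq φ
    have h4 : (arcPoint c d φ - c) * (d - arcPoint c d φ)
        = ((d - c) * (Real.sin φ * Real.cos φ)) ^ 2 := by
      have : Real.cos φ ^ 2 = 1 - Real.sin φ ^ 2 := by linarith
      rw [arcPoint, mul_pow, mul_pow, this]; ring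
    have h5 : 0 < (d - c) * (Real.sin φ * Real.cos φ) := mul_pos hd (mul_pos h1 h2)
    simp only [h4, Real.sqrt_sq h5.le, smul_eq_mul]
    rw [show (d - c) * (2 * Real.sin φ * Real.cos φ)
      = 2 * ((d - c) * (Real.sin φ * Real.cos φ)) by ring, abs_of_pos (by linarith)]
    generalize (d - c) * (Real.sin φ * Real.cos φ) = w at h5 ⊢
    field_simp
  · intro φ hφ ψ hψ h
    have h1 : Real.sin φ ^ 2 = Real.sin ψ ^ 2 := by
      have := add_left_cancel h
      exact mul_left_cancel₀ hd.ne' this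
    have h2 := (sq_eq_sq₀ (hsin φ hφ).le (hsin ψ hψ).le).1 h1
    refine Real.injOn_sin ⟨?_, hφ.2.le⟩ ⟨?_, hψ.2.le⟩ h2 <;> linarith [hφ.1, hψ.1, Real.pi_pos]

/-! ### Stieltjes transforms -/

theorem integral_inv_cos_sq_add_sin_sq {α β : ℝ} (hα : 0 < α) (hβ : 0 < β) :
    ∫ φ in (0)..(π / 2), (α + (β - α) * Real.sin φ ^ 2)⁻¹ = π / (2 * √(α * β)) := by
  set r := √(β / α) with hr
  have hr0 : 0 < r := Real.sqrt_pos.2 (div_pos hβ hα)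
  have hr2 : r ^ 2 = β / α := Real.sq_sqrt (div_pos hβ hα).le
  have hβ' : β = α * r ^ 2 := by rw [hr2]; field_simp
  have hsq : √(α * β) = α * r := by
    rw [hβ', show α * (α * r ^ 2) = (α * r) ^ 2 by ring, Real.sqrt_sq (mul_pos hα hr0).le]
  have hden : ∀ φ : ℝ, 0 < Real.cos φ ^ 2 + r * Real.sin φ ^ 2 := fun φ => by
    have := Real.sin_sq_add_cos_sq φ
    rcases le_or_gt r 1 with h | h
    · nlinarith [sq_nonneg (Real.cos φ), sq_nonneg (Real.sin φ)]
    · nlinarith [sq_nonneg (Real.cos φ), sq_nonneg (Real.sin φ)]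
  have hden2 : ∀ φ : ℝ, 0 < α + (β - α) * Real.sin φ ^ 2 := fun φ => by
    have h1 := Real.sin_sq_add_cos_sq φ
    rcases (sq_nonneg (Real.sin φ)).eq_or_lt with h2 | h2
    · rw [← h2]; linarith
    · nlinarith [sq_nonneg (Real.cos φ), mul_pos hβ h2]
  -- The primitive is arctan (r tan φ)/(α r), rewritten by the subtraction formula for arctan so
  -- that it stays smooth at φ = π / 2.
  have hderiv : ∀ φ : ℝ, HasDerivAt (fun φ => (φ + Real.arctan
      ((r - 1) * (Real.sin φ * Real.cos φ) / (Real.cos φ ^ 2 + r * Real.sin φ ^ 2))) / (α * r))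
      ((α + (β - α) * Real.sin φ ^ 2)⁻¹) φ := fun φ => by
    have hd := hden φ
    have h1 := ((Real.hasDerivAt_sin φ).mul (Real.hasDerivAt_cos φ)).const_mul (r - 1)
    have h2 := ((Real.hasDerivAt_cos φ).pow 2).add
      (((Real.hasDerivAt_sin φ).pow 2).const_mul r)
    have h4 := ((hasDerivAt_id φ).add (h1.div h2 hd.ne').arctan).div_const (α * r)
    refine h4.congr_deriv ?_
    have hc : Real.cos φ ^ 2 = 1 - Real.sin φ ^ 2 := by linarith [Real.sin_sq_add_cos_sq φ]
    have hd2 := hden2 φ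
    have e1 : 1 + ((r - 1) * (Real.sin φ * Real.cos φ) /
        (Real.cos φ ^ 2 + r * Real.sin φ ^ 2)) ^ 2 =
        (1 + (r ^ 2 - 1) * Real.sin φ ^ 2) / (Real.cos φ ^ 2 + r * Real.sin φ ^ 2) ^ 2 := by
      rw [div_pow, eq_div_iff (by positivity), add_mul, div_mul_cancel₀ _ (by positivity)]
      rw [mul_pow, mul_pow, hc]
      ring
    have e2 : α + (β - α) * Real.sin φ ^ 2 = α * (1 + (r ^ 2 - 1) * Real.sin φ ^ 2) := by
      rw [hβ']; ring
    have hd3 : 0 < 1 + (r ^ 2 - 1) * Real.sin φ ^ 2 := by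
      rw [e2] at hd2; exact (mul_pos_iff_of_pos_left hα).1 hd2
    change (1 + 1 / (1 + ((r - 1) * (Real.sin φ * Real.cos φ) /
        (Real.cos φ ^ 2 + r * Real.sin φ ^ 2)) ^ 2) *
          (((r - 1) * (Real.cos φ * Real.cos φ + Real.sin φ * -Real.sin φ) *
                (Real.cos φ ^ 2 + r * Real.sin φ ^ 2) -
              (r - 1) * (Real.sin φ * Real.cos φ) *
                (((2 : ℕ) : ℝ) * Real.cos φ ^ (2 - 1) * -Real.sin φ +
                  r * (((2 : ℕ) : ℝ) * Real.sin φ ^ (2 - 1) * Real.cos φ))) /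
            (Real.cos φ ^ 2 + r * Real.sin φ ^ 2) ^ 2)) / (α * r) = _
    rw [e1, e2]
    set D := Real.cos φ ^ 2 + r * Real.sin φ ^ 2 with hD
    have hD' : D = 1 + (r - 1) * Real.sin φ ^ 2 := by rw [hD, hc]; ring
    field_simp
    simp only [Nat.cast_ofNat, Nat.add_one_sub_one, pow_one]
    rw [hD']
    generalize Real.sin φ = S at *
    generalize Real.cos φ = Cc at *
    have hc' : Cc ^ 2 = 1 - S ^ 2 := hc
    have hc4 : Cc ^ 4 = (1 - S ^ 2) ^ 2 := by rw [← hc']; ring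
    ring_nf
    simp only [hc']
    ring
  rw [intervalIntegral.integral_eq_sub_of_hasDerivAt (fun φ _ => hderiv φ)
    (Continuous.intervalIntegrable (by
      refine Continuous.inv₀ (by fun_prop) fun φ => (hden2 φ).ne') _ _)]
  simp [hsq]
  field_simp

/-- Stieltjes transform of the arc measure. It is used in both directions: to evaluate such
integrals, and to trade the inverse root of two linear factors for an integral over the interval
between their zeros. -/
theorem integral_arcMeasure_inv_sub_left {c d s : ℝ} (h : c ≤ d) (hs : s < c) :
    ∫ t, (t - s)⁻¹ ∂arcMeasure c d = π / √((c - s) * (d - s)) := by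
  rw [integral_arcMeasure (f := fun t => (t - s)⁻¹) h (ContinuousOn.inv₀ (by fun_prop)
    fun t ht => (sub_pos.2 (hs.trans_le ht.1)).ne')]
  have := integral_inv_cos_sq_add_sin_sq (sub_pos.2 hs) (sub_pos.2 (hs.trans_le h))
  rw [show (fun φ => (arcPoint c d φ - s)⁻¹)
    = fun φ => (c - s + (d - s - (c - s)) * Real.sin φ ^ 2)⁻¹ by
      ext φ; rw [arcPoint]; congr 1; ring, this]
  field_simp

theorem integral_arcMeasure_inv_sub_right {c d s : ℝ} (h : c ≤ d) (hs : d < s) :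
    ∫ t, (s - t)⁻¹ ∂arcMeasure c d = π / √((s - c) * (s - d)) := by
  rw [integral_arcMeasure (f := fun t => (s - t)⁻¹) h (ContinuousOn.inv₀ (by fun_prop)
    fun t ht => (sub_pos.2 (ht.2.trans_lt hs)).ne')]
  have := integral_inv_cos_sq_add_sin_sq (sub_pos.2 (h.trans_lt hs)) (sub_pos.2 hs)
  rw [show (fun φ => (s - arcPoint c d φ)⁻¹)
    = fun φ => (s - c + (s - d - (s - c)) * Real.sin φ ^ 2)⁻¹ by
      ext φ; rw [arcPoint]; congr 1; ring, this]
  field_simp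

/-- The decreasing function `t ↦ arcsin √(c / t) / π` on `(c, ∞)`. -/
def angle (c t : ℝ) : ℝ := Real.arctan √(c / (t - c)) / π

theorem integral_lowMeasure_inv_sub {c t : ℝ} (hc : 0 < c) (ht : c < t) :
    ∫ s, (t - s)⁻¹ ∂lowMeasure c = 2 * π * angle c t / √(t - c) := by
  rw [integral_lowMeasure (f := fun s => (t - s)⁻¹) hc.le (ContinuousOn.inv₀ (by fun_prop)
    fun s hs => (sub_pos.2 (hs.2.trans_lt ht)).ne')]
  have h0 : 0 < t - c := sub_pos.2 ht
  set r := √(c / (t - c)) with hr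
  have hr0 : 0 < r := Real.sqrt_pos.2 (div_pos hc h0)
  have hr2 : r ^ 2 = c / (t - c) := Real.sq_sqrt (div_pos hc h0).le
  have hcr : √c = r * √(t - c) := by
    rw [hr, ← Real.sqrt_mul (div_pos hc h0).le, div_mul_cancel₀ _ h0.ne']
  have hderiv : ∀ u : ℝ, HasDerivAt (fun u => Real.arctan (r * u) / (r * (t - c)))
      ((t - c * (1 - u ^ 2))⁻¹) u := fun u => by
    have h1 := (((hasDerivAt_id u).const_mul r).arctan).div_const (r * (t - c))
    refine h1.congr_deriv ?_
    have h2 : t - c * (1 - u ^ 2) = (t - c) * (1 + (r * u) ^ 2) := by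
      rw [mul_pow, hr2]; field_simp; ring
    have h3 : 0 < 1 + (r * u) ^ 2 := by positivity
    simp only [id, mul_one, h2]
    field_simp
  rw [intervalIntegral.integral_eq_sub_of_hasDerivAt (fun u _ => hderiv u)
    (Continuous.intervalIntegrable (by
      refine Continuous.inv₀ (by fun_prop) fun u => ?_
      have : 0 < t - c * (1 - u ^ 2) := by nlinarith [mul_nonneg hc.le (sq_nonneg u)]
      exact this.ne') _ _)]
  have h5 := Real.sqrt_pos.2 h0
  have h6 : (t - c) = √(t - c) ^ 2 := (Real.sq_sqrt h0.le).symm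
  rw [angle, ← hr, hcr]
  simp only [mul_one, mul_zero, Real.arctan_zero, zero_div, sub_zero]
  have h7 := Real.pi_pos
  generalize √(t - c) = w at *
  rw [h6]
  field_simp

/-! ### The angle function -/

theorem angle_pos {c t : ℝ} (hc : 0 < c) (ht : c < t) : 0 < angle c t :=
  div_pos (Real.arctan_pos.2 (Real.sqrt_pos.2 (div_pos hc (sub_pos.2 ht)))) Real.pi_pos

theorem half_sub_angle {c t : ℝ} (hc : 0 < c) (ht : c < t) :
    1 / 2 - angle c t = Real.arctan √((t - c) / c) / π := by
  have h := Real.arctan_inv_of_pos (Real.sqrt_pos.2 (div_pos (sub_pos.2 ht) hc))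
  rw [← Real.sqrt_inv, inv_div] at h
  rw [angle, h]
  have := Real.pi_pos
  field_simp
  ring

theorem angle_lt_half {c t : ℝ} (hc : 0 < c) (ht : c < t) : angle c t < 1 / 2 := by
  have := half_sub_angle hc ht
  have : 0 < Real.arctan √((t - c) / c) / π :=
    div_pos (Real.arctan_pos.2 (Real.sqrt_pos.2 (div_pos (sub_pos.2 ht) hc))) Real.pi_pos
  linarith

/-- From arctan x ≤ x. It cancels the singular factor 1/√(t - c), so integrals containing 1/2 -
`angle` stay bounded while those without it diverge logarithmically. -/
theorem half_sub_angle_le {c t : ℝ} (hc : 0 < c) (ht : c < t) :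
    1 / 2 - angle c t ≤ √(t - c) / (π * √c) := by
  rw [half_sub_angle hc ht, Real.sqrt_div (sub_pos.2 ht).le, div_mul_eq_div_div_swap]
  gcongr
  set x := √(t - c) / √c
  have hx : 0 ≤ x := by positivity
  rcases hx.eq_or_lt with h | h
  · simp [← h]
  · have h1 := Real.lt_tan (Real.arctan_pos.2 h) (Real.arctan_lt_pi_div_two x)
    rw [Real.tan_arctan] at h1
    exact h1.le

theorem angle_strictAntiOn {c : ℝ} (hc : 0 < c) : StrictAntiOn (angle c) (Ioi c) := by
  intro s hs t ht hst
  have hs' : 0 < s - c := sub_pos.2 hs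
  refine div_lt_div_of_pos_right (Real.arctan_strictMono (Real.sqrt_lt_sqrt ?_ ?_)) Real.pi_pos
  · exact (div_pos hc (sub_pos.2 ht)).le
  · exact div_lt_div_of_pos_left hc hs' (by linarith)

theorem continuousOn_angle (c : ℝ) : ContinuousOn (angle c) (Ioi c) := by
  have : ContinuousOn (fun t => c / (t - c)) (Ioi c) :=
    continuousOn_const.div (by fun_prop) fun t ht => (sub_pos.2 ht).ne'
  exact (Real.continuous_arctan.comp_continuousOn this.sqrt).div_const _

theorem sin_sq_pi_mul_angle {c t : ℝ} (hc : 0 < c) (ht : c < t) :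
    Real.sin (π * angle c t) ^ 2 = c / t := by
  have h0 : 0 < t - c := sub_pos.2 ht
  rw [angle, mul_div_cancel₀ _ Real.pi_ne_zero, Real.sin_sq_arctan,
    Real.sq_sqrt (div_pos hc h0).le]
  have : t ≠ 0 := by linarith
  field_simp
  ring

/-! ### Double integrals over two disjoint intervals -/

/-- Each inverse root is a Stieltjes transform of the arc measure of the other interval, so both
terms become double integrals of h against 1/(u - t), and their difference involves a divided
difference of h. The bound obtained from it need not degenerate as the intervals approach each
other. -/
theorem integral_arcMeasure_sub {a b c d : ℝ} (hab : a ≤ b) (hbc : b < c) (hcd : c ≤ d)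
    {h : ℝ → ℝ} (h1 : ContinuousOn h (Icc a b)) (h2 : ContinuousOn h (Icc c d)) :
    ∫ t, h t * (√((c - t) * (d - t)))⁻¹ ∂arcMeasure a b
      - ∫ u, h u * (√((u - a) * (u - b)))⁻¹ ∂arcMeasure c d
      = π⁻¹ * ∫ t, ∫ u, (h t - h u) / (u - t) ∂arcMeasure c d ∂arcMeasure a b := by
  have hpi := Real.pi_ne_zero
  have hden : ∀ z ∈ Icc a b ×ˢ Icc c d, z.2 - z.1 ≠ 0 := fun z hz =>
    (sub_pos.2 ((hz.1.2.trans_lt hbc).trans_le hz.2.1)).ne'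
  have e1 : ∫ t, h t * (√((c - t) * (d - t)))⁻¹ ∂arcMeasure a b
      = π⁻¹ * ∫ t, ∫ u, h t * (u - t)⁻¹ ∂arcMeasure c d ∂arcMeasure a b := by
    rw [← integral_const_mul]
    refine integral_arcMeasure_congr hab fun t ht => ?_
    rw [integral_const_mul, integral_arcMeasure_inv_sub_left hcd (ht.2.trans_lt hbc)]
    field_simp
  have e2 : ∫ u, h u * (√((u - a) * (u - b)))⁻¹ ∂arcMeasure c d
      = π⁻¹ * ∫ t, ∫ u, h u * (u - t)⁻¹ ∂arcMeasure c d ∂arcMeasure a b := by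
    rw [integral_integral_swap_of_ae_mem isCompact_Icc isCompact_Icc (ae_arcMeasure hab)
      (ae_arcMeasure hcd) (f := fun t u => h u * (u - t)⁻¹), ← integral_const_mul]
    · refine integral_arcMeasure_congr hcd fun u hu => ?_
      rw [integral_const_mul, integral_arcMeasure_inv_sub_right hab (hbc.trans_le hu.1)]
      field_simp
    · refine ContinuousOn.mul (h2.comp continuousOn_snd fun z hz => hz.2) ?_
      exact ContinuousOn.inv₀ (by fun_prop) hden
  have hinv : ∀ t ∈ Icc a b, ContinuousOn (fun u => (u - t)⁻¹) (Icc c d) := fun t ht =>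
    ContinuousOn.inv₀ (by fun_prop) fun u hu => hden (t, u) ⟨ht, hu⟩
  have hint : ∀ f : ℝ → ℝ → ℝ, ContinuousOn (Function.uncurry f) (Icc a b ×ˢ Icc c d) →
      Integrable (fun t => ∫ u, f t u ∂arcMeasure c d) (arcMeasure a b) := fun f hf => by
    refine Integrable.integral_prod_left (f := Function.uncurry f)
      (integrable_of_ae_mem (isCompact_Icc.prod isCompact_Icc) ?_ hf)
    have h1 := Measure.quasiMeasurePreserving_fst (ν := arcMeasure c d) |>.ae (ae_arcMeasure hab)
    have h2 := Measure.quasiMeasurePreserving_snd (μ := arcMeasure a b) |>.ae (ae_arcMeasure hcd)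
    filter_upwards [h1, h2] with z hz1 hz2 using ⟨hz1, hz2⟩
  have hc1 : ContinuousOn (Function.uncurry fun t u => h t * (u - t)⁻¹) (Icc a b ×ˢ Icc c d) :=
    ContinuousOn.mul (h1.comp continuousOn_fst fun z hz => hz.1)
      (ContinuousOn.inv₀ (by fun_prop) hden)
  have hc2 : ContinuousOn (Function.uncurry fun t u => h u * (u - t)⁻¹) (Icc a b ×ˢ Icc c d) :=
    ContinuousOn.mul (h2.comp continuousOn_snd fun z hz => hz.2)
      (ContinuousOn.inv₀ (by fun_prop) hden)
  rw [e1, e2, ← mul_sub, ← integral_sub (hint _ hc1) (hint _ hc2)]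
  congr 1
  refine integral_arcMeasure_congr hab fun t ht => ?_
  rw [← integral_sub]
  · simp only [div_eq_mul_inv, sub_mul]
  · exact integrable_arcMeasure hcd (continuousOn_const.mul (hinv t ht))
  · exact integrable_arcMeasure hcd (h2.mul (hinv t ht))

/-! ### Hyperelliptic integrals of genus two -/

/-- Five branch points `0 < c₀ < c₁ < c₂ < c₃ < c₄`. -/
structure BranchOrdered (c : Fin 5 → ℝ) : Prop where
  pos : 0 < c 0
  h01 : c 0 < c 1
  h12 : c 1 < c 2
  h23 : c 2 < c 3
  h34 : c 3 < c 4

/-- These weights are what remains of 1/√T once the factors singular at the endpoints of the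
respective interval have been absorbed into `lowMeasure` or `arcMeasure`; they are continuous up to
the endpoints. -/
def lowWeight (c : Fin 5 → ℝ) (s : ℝ) : ℝ :=
  (√((c 1 - s) * (c 2 - s)) * √((c 3 - s) * (c 4 - s)))⁻¹

def leftWeight (c : Fin 5 → ℝ) (t : ℝ) : ℝ := (√(t - c 0) * √((c 3 - t) * (c 4 - t)))⁻¹

def rightWeight (c : Fin 5 → ℝ) (u : ℝ) : ℝ := (√(u - c 0) * √((u - c 1) * (u - c 2)))⁻¹

/-- The integral of `f / √T` over `(0, c₀)`. -/
def lowPeriod (c : Fin 5 → ℝ) (f : ℝ → ℝ) : ℝ := ∫ s, f s * lowWeight c s ∂lowMeasure (c 0)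

/-- The integral of `f / √T` over `(c₁, c₂)`. -/
def leftPeriod (c : Fin 5 → ℝ) (f : ℝ → ℝ) : ℝ :=
  ∫ t, f t * leftWeight c t ∂arcMeasure (c 1) (c 2)

/-- The integral of `f / √T` over `(c₃, c₄)`. -/
def rightPeriod (c : Fin 5 → ℝ) (f : ℝ → ℝ) : ℝ :=
  ∫ u, f u * rightWeight c u ∂arcMeasure (c 3) (c 4)

namespace BranchOrdered

variable {c : Fin 5 → ℝ} (hc : BranchOrdered c)
include hc

theorem pos_low {s : ℝ} (hs : s ∈ Icc 0 (c 0)) :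
    0 < c 1 - s ∧ 0 < c 2 - s ∧ 0 < c 3 - s ∧ 0 < c 4 - s := by
  obtain ⟨h0, h1, h2, h3, h4⟩ := hc
  obtain ⟨h5, h6⟩ := hs
  refine ⟨?_, ?_, ?_, ?_⟩ <;> linarith

theorem pos_left {t : ℝ} (ht : t ∈ Icc (c 1) (c 2)) :
    0 < t - c 0 ∧ 0 < c 3 - t ∧ 0 < c 4 - t := by
  obtain ⟨h0, h1, h2, h3, h4⟩ := hc
  obtain ⟨h5, h6⟩ := ht
  refine ⟨?_, ?_, ?_⟩ <;> linarith

theorem pos_right {u : ℝ} (hu : u ∈ Icc (c 3) (c 4)) :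
    0 < u - c 0 ∧ 0 < u - c 1 ∧ 0 < u - c 2 := by
  obtain ⟨h0, h1, h2, h3, h4⟩ := hc
  obtain ⟨h5, h6⟩ := hu
  refine ⟨?_, ?_, ?_⟩ <;> linarith

theorem lowWeight_pos {s : ℝ} (hs : s ∈ Icc 0 (c 0)) : 0 < lowWeight c s := by
  obtain ⟨h1, h2, h3, h4⟩ := hc.pos_low hs
  unfold lowWeight; positivity

theorem leftWeight_pos {t : ℝ} (ht : t ∈ Icc (c 1) (c 2)) : 0 < leftWeight c t := by
  obtain ⟨h1, h2, h3⟩ := hc.pos_left ht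
  unfold leftWeight; positivity

theorem rightWeight_pos {u : ℝ} (hu : u ∈ Icc (c 3) (c 4)) : 0 < rightWeight c u := by
  obtain ⟨h1, h2, h3⟩ := hc.pos_right hu
  unfold rightWeight; positivity

theorem continuousOn_lowWeight : ContinuousOn (lowWeight c) (Icc 0 (c 0)) := by
  refine ContinuousOn.inv₀ (by fun_prop) fun s hs => ?_
  obtain ⟨h1, h2, h3, h4⟩ := hc.pos_low hs
  positivity

theorem continuousOn_leftWeight : ContinuousOn (leftWeight c) (Icc (c 1) (c 2)) := by
  refine ContinuousOn.inv₀ (by fun_prop) fun s hs => ?_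
  obtain ⟨h1, h2, h3⟩ := hc.pos_left hs
  positivity

theorem continuousOn_rightWeight : ContinuousOn (rightWeight c) (Icc (c 3) (c 4)) := by
  refine ContinuousOn.inv₀ (by fun_prop) fun s hs => ?_
  obtain ⟨h1, h2, h3⟩ := hc.pos_right hs
  positivity

theorem continuousOn_angle_left : ContinuousOn (angle (c 0)) (Icc (c 1) (c 2)) :=
  (continuousOn_angle _).mono fun _ ht => sub_pos.1 (hc.pos_left ht).1

theorem continuousOn_angle_right : ContinuousOn (angle (c 0)) (Icc (c 3) (c 4)) :=
  (continuousOn_angle _).mono fun _ ht => sub_pos.1 (hc.pos_right ht).1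

theorem lowPeriod_pos {f : ℝ → ℝ} (hf : ContinuousOn f (Icc 0 (c 0)))
    (hpos : ∀ s ∈ Icc 0 (c 0), 0 < f s) : 0 < lowPeriod c f :=
  integral_lowMeasure_pos hc.pos (hf.mul hc.continuousOn_lowWeight)
    fun s hs => mul_pos (hpos s hs) (hc.lowWeight_pos hs)

theorem leftPeriod_pos {f : ℝ → ℝ} (hf : ContinuousOn f (Icc (c 1) (c 2)))
    (hpos : ∀ s ∈ Icc (c 1) (c 2), 0 < f s) : 0 < leftPeriod c f :=
  integral_arcMeasure_pos hc.h12.le (hf.mul hc.continuousOn_leftWeight)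
    fun s hs => mul_pos (hpos s hs) (hc.leftWeight_pos hs)

theorem rightPeriod_pos {f : ℝ → ℝ} (hf : ContinuousOn f (Icc (c 3) (c 4)))
    (hpos : ∀ s ∈ Icc (c 3) (c 4), 0 < f s) : 0 < rightPeriod c f :=
  integral_arcMeasure_pos hc.h34.le (hf.mul hc.continuousOn_rightWeight)
    fun s hs => mul_pos (hpos s hs) (hc.rightWeight_pos hs)

theorem leftPeriod_mono {f g : ℝ → ℝ} (hf : ContinuousOn f (Icc (c 1) (c 2)))
    (hg : ContinuousOn g (Icc (c 1) (c 2)))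
    (hle : ∀ s ∈ Icc (c 1) (c 2), f s ≤ g s) : leftPeriod c f ≤ leftPeriod c g :=
  integral_arcMeasure_mono hc.h12.le (hf.mul hc.continuousOn_leftWeight)
    (hg.mul hc.continuousOn_leftWeight)
    fun s hs => mul_le_mul_of_nonneg_right (hle s hs) (hc.leftWeight_pos hs).le

theorem rightPeriod_mono {f g : ℝ → ℝ} (hf : ContinuousOn f (Icc (c 3) (c 4)))
    (hg : ContinuousOn g (Icc (c 3) (c 4)))
    (hle : ∀ s ∈ Icc (c 3) (c 4), f s ≤ g s) : rightPeriod c f ≤ rightPeriod c g :=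
  integral_arcMeasure_mono hc.h34.le (hf.mul hc.continuousOn_rightWeight)
    (hg.mul hc.continuousOn_rightWeight)
    fun s hs => mul_le_mul_of_nonneg_right (hle s hs) (hc.rightWeight_pos hs).le

theorem leftPeriod_add_const_mul {f g : ℝ → ℝ} (r : ℝ) (hf : ContinuousOn f (Icc (c 1) (c 2)))
    (hg : ContinuousOn g (Icc (c 1) (c 2))) :
    leftPeriod c (fun t => f t + r * g t) = leftPeriod c f + r * leftPeriod c g := by
  rw [leftPeriod, leftPeriod, leftPeriod, ← integral_const_mul, ← integral_add]
  · exact integral_congr_ae (Eventually.of_forall fun t => by ring)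
  · exact integrable_arcMeasure hc.h12.le (hf.mul hc.continuousOn_leftWeight)
  · exact integrable_arcMeasure hc.h12.le
      (continuousOn_const.mul (hg.mul hc.continuousOn_leftWeight))

theorem rightPeriod_add_const_mul {f g : ℝ → ℝ} (r : ℝ) (hf : ContinuousOn f (Icc (c 3) (c 4)))
    (hg : ContinuousOn g (Icc (c 3) (c 4))) :
    rightPeriod c (fun t => f t + r * g t) = rightPeriod c f + r * rightPeriod c g := by
  rw [rightPeriod, rightPeriod, rightPeriod, ← integral_const_mul, ← integral_add]
  · exact integral_congr_ae (Eventually.of_forall fun t => by ring)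
  · exact integrable_arcMeasure hc.h34.le (hf.mul hc.continuousOn_rightWeight)
  · exact integrable_arcMeasure hc.h34.le
      (continuousOn_const.mul (hg.mul hc.continuousOn_rightWeight))

theorem lowPeriod_add_const_mul {f g : ℝ → ℝ} (r : ℝ) (hf : ContinuousOn f (Icc 0 (c 0)))
    (hg : ContinuousOn g (Icc 0 (c 0))) :
    lowPeriod c (fun t => f t + r * g t) = lowPeriod c f + r * lowPeriod c g := by
  rw [lowPeriod, lowPeriod, lowPeriod, ← integral_const_mul, ← integral_add]
  · exact integral_congr_ae (Eventually.of_forall fun t => by ring)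
  · exact integrable_lowMeasure hc.pos.le (hf.mul hc.continuousOn_lowWeight)
  · exact integrable_lowMeasure hc.pos.le
      (continuousOn_const.mul (hg.mul hc.continuousOn_lowWeight))

/-- The difference of the periods over `(c₁, c₂)` and `(c₃, c₄)` as a double integral. -/
theorem leftPeriod_sub_rightPeriod {f : ℝ → ℝ} (hf1 : ContinuousOn f (Icc (c 1) (c 2)))
    (hf2 : ContinuousOn f (Icc (c 3) (c 4))) :
    leftPeriod c f - rightPeriod c f = π⁻¹ * ∫ t, ∫ u,
      (f t / √(t - c 0) - f u / √(u - c 0)) / (u - t) ∂arcMeasure (c 3) (c 4)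
        ∂arcMeasure (c 1) (c 2) := by
  rw [← integral_arcMeasure_sub hc.h12.le hc.h23 hc.h34.le (h := fun t => f t / √(t - c 0))]
  · simp only [leftPeriod, rightPeriod, leftWeight, rightWeight, mul_inv, div_eq_mul_inv, mul_assoc]
  · refine hf1.div (by fun_prop) fun t ht => ?_
    have := (hc.pos_left ht).1
    positivity
  · refine hf2.div (by fun_prop) fun t ht => ?_
    have := (hc.pos_right ht).1
    positivity

/-- The period over `(0, c₀)` of a polynomial of degree at most one in terms of weighted periods
over the other two intervals. -/
theorem lowPeriod_eq (α β : ℝ) :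
    lowPeriod c (fun s => α + β * s) = 2 * leftPeriod c (fun t => (α + β * t) * angle (c 0) t)
      - 2 * rightPeriod c (fun t => (α + β * t) * angle (c 0) t) := by
  have hpi := Real.pi_pos
  have hp : Continuous fun s : ℝ => α + β * s := by fun_prop
  have hL : ∀ z ∈ Icc 0 (c 0) ×ˢ Icc (c 1) (c 2), z.2 - z.1 ≠ 0 := fun z hz =>
    (sub_pos.2 ((hz.1.2.trans_lt hc.h01).trans_le hz.2.1)).ne'
  have hR : ∀ z ∈ Icc 0 (c 0) ×ˢ Icc (c 3) (c 4), z.2 - z.1 ≠ 0 := fun z hz =>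
    (sub_pos.2 ((hz.1.2.trans_lt (hc.h01.trans (hc.h12.trans hc.h23))).trans_le hz.2.1)).ne'
  have hwL : ContinuousOn (fun t => (√((c 3 - t) * (c 4 - t)))⁻¹) (Icc (c 1) (c 2)) := by
    refine ContinuousOn.inv₀ (by fun_prop) fun t ht => ?_
    obtain ⟨h1, h2, h3⟩ := hc.pos_left ht
    positivity
  have hwR : ContinuousOn (fun t => (√((t - c 1) * (t - c 2)))⁻¹) (Icc (c 3) (c 4)) := by
    refine ContinuousOn.inv₀ (by fun_prop) fun t ht => ?_
    obtain ⟨h1, h2, h3⟩ := hc.pos_right ht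
    positivity
  have hcL : ContinuousOn (Function.uncurry fun s t =>
      (α + β * t) / (t - s) * (√((c 3 - t) * (c 4 - t)))⁻¹) (Icc 0 (c 0) ×ˢ Icc (c 1) (c 2)) := by
    refine ContinuousOn.mul (ContinuousOn.div (by fun_prop) (by fun_prop) hL) ?_
    exact hwL.comp continuousOn_snd fun z hz => hz.2
  have hcR : ContinuousOn (Function.uncurry fun s t =>
      (α + β * t) / (t - s) * (√((t - c 1) * (t - c 2)))⁻¹) (Icc 0 (c 0) ×ˢ Icc (c 3) (c 4)) := by
    refine ContinuousOn.mul (ContinuousOn.div (by fun_prop) (by fun_prop) hR) ?_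
    exact hwR.comp continuousOn_snd fun z hz => hz.2
  have hint : ∀ a b : ℝ, a ≤ b → ∀ f : ℝ → ℝ → ℝ,
      ContinuousOn (Function.uncurry f) (Icc 0 (c 0) ×ˢ Icc a b) →
      Integrable (fun t => ∫ u, f t u ∂arcMeasure a b) (lowMeasure (c 0)) := fun a b hab f hf => by
    refine Integrable.integral_prod_left (f := Function.uncurry f)
      (integrable_of_ae_mem (isCompact_Icc.prod isCompact_Icc) ?_ hf)
    have h1 := Measure.quasiMeasurePreserving_fst (ν := arcMeasure a b) |>.ae
      (ae_lowMeasure hc.pos.le)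
    have h2 := Measure.quasiMeasurePreserving_snd (μ := lowMeasure (c 0)) |>.ae (ae_arcMeasure hab)
    filter_upwards [h1, h2] with z hz1 hz2 using ⟨hz1, hz2⟩
  -- Take h(t) = p(t)/(t - s) with p(t) = α + β t. As p has degree at most one, (h(t) - h(u))/(u -
  -- t) = p(s)/((t - s)(u - s)), and the double integral splits into two Stieltjes transforms whose
  -- product is the weight at s. Integrating over s and swapping then produces `angle`.
  have key : ∀ s ∈ Icc 0 (c 0), π * ((α + β * s) * lowWeight c s)
      = ∫ t, (α + β * t) / (t - s) * (√((c 3 - t) * (c 4 - t)))⁻¹ ∂arcMeasure (c 1) (c 2)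
        - ∫ t, (α + β * t) / (t - s) * (√((t - c 1) * (t - c 2)))⁻¹ ∂arcMeasure (c 3) (c 4) := by
    intro s hs
    have hs0 : s < c 1 := hs.2.trans_lt hc.h01
    have hs3 : s < c 3 := hs0.trans (hc.h12.trans hc.h23)
    rw [integral_arcMeasure_sub hc.h12.le hc.h23 hc.h34.le (h := fun t => (α + β * t) / (t - s))]
    · have e : ∀ t ∈ Icc (c 1) (c 2), ∫ u, ((α + β * t) / (t - s) - (α + β * u) / (u - s)) / (u - t)
          ∂arcMeasure (c 3) (c 4)
          = (α + β * s) * (π / √((c 3 - s) * (c 4 - s))) * (t - s)⁻¹ := by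
        intro t ht
        rw [← integral_arcMeasure_inv_sub_left hc.h34.le hs3, mul_right_comm,
          ← integral_const_mul]
        refine integral_arcMeasure_congr hc.h34.le fun u hu => ?_
        have h1 : t - s ≠ 0 := hL (s, t) ⟨hs, ht⟩
        have h2 : u - s ≠ 0 := hR (s, u) ⟨hs, hu⟩
        have h3 : u - t ≠ 0 := (sub_pos.2 ((ht.2.trans_lt hc.h23).trans_le hu.1)).ne'
        field_simp
        ring
      rw [integral_arcMeasure_congr hc.h12.le e, integral_const_mul,
        integral_arcMeasure_inv_sub_left hc.h12.le hs0, lowWeight, mul_inv]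
      field_simp
    · exact ContinuousOn.div (by fun_prop) (by fun_prop) fun t ht => hL (s, t) ⟨hs, ht⟩
    · exact ContinuousOn.div (by fun_prop) (by fun_prop) fun t ht => hR (s, t) ⟨hs, ht⟩
  have h1 : π * lowPeriod c (fun s => α + β * s) = 2 * π *
      leftPeriod c (fun t => (α + β * t) * angle (c 0) t)
      - 2 * π * rightPeriod c (fun t => (α + β * t) * angle (c 0) t) := by
    rw [lowPeriod, ← integral_const_mul, integral_lowMeasure_congr hc.pos.le key, integral_sub
      (hint _ _ hc.h12.le _ hcL) (hint _ _ hc.h34.le _ hcR),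
      integral_integral_swap_of_ae_mem isCompact_Icc isCompact_Icc (ae_lowMeasure hc.pos.le)
        (ae_arcMeasure hc.h12.le) hcL,
      integral_integral_swap_of_ae_mem isCompact_Icc isCompact_Icc (ae_lowMeasure hc.pos.le)
        (ae_arcMeasure hc.h34.le) hcR, leftPeriod, rightPeriod, ← integral_const_mul,
      ← integral_const_mul]
    congr 1
    · refine integral_arcMeasure_congr hc.h12.le fun t ht => ?_
      have := integral_lowMeasure_inv_sub hc.pos (sub_pos.1 (hc.pos_left ht).1)
      simp only [div_eq_mul_inv, mul_right_comm (α + β * t) _ (√((c 3 - t) * (c 4 - t)))⁻¹]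
      rw [integral_const_mul, this, leftWeight, mul_inv]
      ring
    · refine integral_arcMeasure_congr hc.h34.le fun t ht => ?_
      have := integral_lowMeasure_inv_sub hc.pos (sub_pos.1 (hc.pos_right ht).1)
      simp only [div_eq_mul_inv, mul_right_comm (α + β * t) _ (√((t - c 1) * (t - c 2)))⁻¹]
      rw [integral_const_mul, this, rightWeight, mul_inv]
      ring
  have h2 := mul_left_cancel₀ hpi.ne' (h1.trans (by ring : _ = π *
    (2 * leftPeriod c (fun t => (α + β * t) * angle (c 0) t)
      - 2 * rightPeriod c (fun t => (α + β * t) * angle (c 0) t))))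
  exact h2

end BranchOrdered

/-! ### Further estimates of integrals -/

theorem integral_integral_arcMeasure_mono {a b c d : ℝ} (hab : a ≤ b) (hcd : c ≤ d)
    {f g : ℝ → ℝ → ℝ} (hf : ContinuousOn (Function.uncurry f) (Icc a b ×ˢ Icc c d))
    (hg : ContinuousOn (Function.uncurry g) (Icc a b ×ˢ Icc c d))
    (hle : ∀ t ∈ Icc a b, ∀ u ∈ Icc c d, f t u ≤ g t u) :
    ∫ t, ∫ u, f t u ∂arcMeasure c d ∂arcMeasure a b
      ≤ ∫ t, ∫ u, g t u ∂arcMeasure c d ∂arcMeasure a b := by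
  have hae : ∀ᵐ z ∂((arcMeasure a b).prod (arcMeasure c d)), z ∈ Icc a b ×ˢ Icc c d := by
    have h1 := Measure.quasiMeasurePreserving_fst (ν := arcMeasure c d) |>.ae (ae_arcMeasure hab)
    have h2 := Measure.quasiMeasurePreserving_snd (μ := arcMeasure a b) |>.ae (ae_arcMeasure hcd)
    filter_upwards [h1, h2] with z hz1 hz2 using ⟨hz1, hz2⟩
  have hint : ∀ f : ℝ → ℝ → ℝ, ContinuousOn (Function.uncurry f) (Icc a b ×ˢ Icc c d) →
      Integrable (fun t => ∫ u, f t u ∂arcMeasure c d) (arcMeasure a b) := fun f hf =>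
    Integrable.integral_prod_left (f := Function.uncurry f)
      (integrable_of_ae_mem (isCompact_Icc.prod isCompact_Icc) hae hf)
  refine integral_mono_ae (hint f hf) (hint g hg) ?_
  filter_upwards [ae_arcMeasure hab] with t ht
  have hslice : ∀ f : ℝ → ℝ → ℝ, ContinuousOn (Function.uncurry f) (Icc a b ×ˢ Icc c d) →
      ContinuousOn (f t) (Icc c d) := fun f hf =>
    hf.comp (f := fun u => (t, u)) (by fun_prop) fun u hu => ⟨ht, hu⟩
  exact integral_arcMeasure_mono hcd (hslice f hf) (hslice g hg) (hle t ht)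

theorem integral_arcMeasure_const (c d r : ℝ) : ∫ _, r ∂arcMeasure c d = π * r := by
  rw [integral_const, arcMeasure_real_univ, smul_eq_mul]

theorem integral_lowMeasure_const (c r : ℝ) : ∫ _, r ∂lowMeasure c = 2 * √c * r := by
  rw [integral_const, lowMeasure_real_univ, smul_eq_mul]

/-- A logarithmic lower bound for integrals that diverge as `x` tends to `c`. -/
theorem log_le_integral_arcMeasure {c d x K : ℝ} (hx : x < c) (hcd : c ≤ d) (hd : d - c ≤ 1)
    (hK : 0 ≤ K) {f : ℝ → ℝ} (hf : ContinuousOn f (Icc c d))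
    (hle : ∀ φ ∈ Icc 0 (π / 2), K * (Real.cos φ / √(arcPoint c d φ - x)) ≤ f (arcPoint c d φ)) :
    2 * K * Real.log (1 + 1 / √(c - x)) ≤ ∫ t, f t ∂arcMeasure c d := by
  have hpi := Real.pi_pos
  have he : 0 < √(c - x) := Real.sqrt_pos.2 (sub_pos.2 hx)
  have hsin : ∀ φ ∈ Icc 0 (π / 2), 0 ≤ Real.sin φ := fun φ hφ =>
    Real.sin_nonneg_of_nonneg_of_le_pi hφ.1 (by linarith [hφ.2])
  have hcos : ∀ φ ∈ Icc 0 (π / 2), 0 ≤ Real.cos φ := fun φ hφ =>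
    Real.cos_nonneg_of_mem_Icc ⟨by linarith [hφ.1], hφ.2⟩
  have huIcc : uIcc 0 (π / 2) = Icc 0 (π / 2) := uIcc_of_le (by positivity)
  have hFc : ContinuousOn (fun φ => Real.cos φ / (√(c - x) + Real.sin φ)) (Icc 0 (π / 2)) :=
    ContinuousOn.div (by fun_prop) (by fun_prop) fun φ hφ => by
      have := hsin φ hφ
      positivity
  have h1 : ∫ φ in (0)..(π / 2), Real.cos φ / (√(c - x) + Real.sin φ)
      = Real.log (1 + 1 / √(c - x)) := by
    rw [intervalIntegral.integral_eq_sub_of_hasDerivAt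
      (f := fun φ => Real.log (√(c - x) + Real.sin φ))]
    · simp only [Real.sin_pi_div_two, Real.sin_zero, add_zero]
      rw [← Real.log_div (by positivity) (by positivity)]
      congr 1
      field_simp
    · intro φ hφ
      rw [huIcc] at hφ
      have := hsin φ hφ
      exact ((Real.hasDerivAt_sin φ).const_add _).log (by positivity)
    · exact (hFc.mono huIcc.subset).intervalIntegrable
  rw [integral_arcMeasure hcd hf, mul_assoc, ← h1, ← intervalIntegral.integral_const_mul]
  refine mul_le_mul_of_nonneg_left ?_ zero_le_two
  refine intervalIntegral.integral_mono_on (by positivity)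
    ((continuousOn_const.mul hFc).mono huIcc.subset).intervalIntegrable
    (hf.comp_continuous (continuous_arcPoint c d) (arcPoint_mem hcd)).continuousOn.intervalIntegrable
    fun φ hφ => ?_
  refine le_trans ?_ (hle φ hφ)
  have h2 := hsin φ hφ
  have h3 := hcos φ hφ
  have h4 : c ≤ arcPoint c d φ := (arcPoint_mem hcd φ).1
  have h5 : √(arcPoint c d φ - x) ≤ √(c - x) + Real.sin φ := by
    rw [Real.sqrt_le_left (by positivity)]
    have h6 := Real.sq_sqrt (sub_pos.2 hx).le
    have : arcPoint c d φ ≤ c + Real.sin φ ^ 2 := by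
      unfold arcPoint; nlinarith [sq_nonneg (Real.sin φ)]
    nlinarith [mul_nonneg he.le h2]
  have h7 : 0 < √(arcPoint c d φ - x) := Real.sqrt_pos.2 (by linarith)
  gcongr

/-! ### The frequency in genus one -/

/-- With `ellipticHigh`, these are the periods of 1/√((x - s)(y - s)(z - s)) over (0, x) and (y, z),
with the endpoint singularities carried by the measures. -/
def ellipticLow (x y z : ℝ) : ℝ := ∫ s, (√((y - s) * (z - s)))⁻¹ ∂lowMeasure x

def ellipticHigh (x y z : ℝ) : ℝ := ∫ u, (√(u - x))⁻¹ ∂arcMeasure y z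

/-- The frequency of the billiard inside an ellipse, as a function of the branch points. -/
def ellipticFrequency (x y z : ℝ) : ℝ := ellipticLow x y z / (2 * ellipticHigh x y z)

section Elliptic

variable {x y z : ℝ}

theorem continuousOn_ellipticLow (hxy : x < y) (hyz : y ≤ z) :
    ContinuousOn (fun s => (√((y - s) * (z - s)))⁻¹) (Icc 0 x) := by
  refine ContinuousOn.inv₀ (by fun_prop) fun s hs => ?_
  have h1 : 0 < y - s := by linarith [hs.2]
  have h2 : 0 < z - s := by linarith
  positivity

theorem continuousOn_ellipticHigh (hxy : x < y) :
    ContinuousOn (fun u => (√(u - x))⁻¹) (Icc y z) := by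
  refine ContinuousOn.inv₀ (by fun_prop) fun u hu => ?_
  have h1 : 0 < u - x := by linarith [hu.1]
  positivity

theorem ellipticLow_pos (hx : 0 < x) (hxy : x < y) (hyz : y ≤ z) : 0 < ellipticLow x y z := by
  refine integral_lowMeasure_pos hx (continuousOn_ellipticLow hxy hyz) fun s hs => ?_
  have h1 : 0 < y - s := by linarith [hs.2]
  have h2 : 0 < z - s := by linarith
  positivity

theorem ellipticHigh_pos (hxy : x < y) (hyz : y ≤ z) : 0 < ellipticHigh x y z := by
  refine integral_arcMeasure_pos hyz (continuousOn_ellipticHigh hxy) fun u hu => ?_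
  have h1 : 0 < u - x := by linarith [hu.1]
  positivity

theorem ellipticFrequency_pos (hx : 0 < x) (hxy : x < y) (hyz : y ≤ z) :
    0 < ellipticFrequency x y z :=
  div_pos (ellipticLow_pos hx hxy hyz) (mul_pos two_pos (ellipticHigh_pos hxy hyz))

/-- The genus one analogue of `BranchOrdered.lowPeriod_eq`. It exhibits the planar frequency as a
weighted mean of `angle x` over [y, z], whence the bounds by its values at y and z. -/
theorem ellipticLow_eq (hx : 0 < x) (hxy : x < y) (hyz : y ≤ z) :
    ellipticLow x y z = 2 * ∫ u, angle x u * (√(u - x))⁻¹ ∂arcMeasure y z := by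
  have h1 : ellipticLow x y z
      = ∫ s, ∫ u, π⁻¹ * (u - s)⁻¹ ∂arcMeasure y z ∂lowMeasure x := by
    refine integral_lowMeasure_congr hx.le fun s hs => ?_
    rw [integral_const_mul, integral_arcMeasure_inv_sub_left hyz (hs.2.trans_lt hxy)]
    field_simp [Real.pi_ne_zero]
  rw [h1, integral_integral_swap_of_ae_mem isCompact_Icc isCompact_Icc (ae_lowMeasure hx.le)
    (ae_arcMeasure hyz) (f := fun s u => π⁻¹ * (u - s)⁻¹), ← integral_const_mul]
  · refine integral_arcMeasure_congr hyz fun u hu => ?_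
    rw [integral_const_mul, integral_lowMeasure_inv_sub hx (hxy.trans_le hu.1)]
    field_simp [Real.pi_ne_zero]
  · exact continuousOn_const.mul (ContinuousOn.inv₀ (by fun_prop) fun w hw =>
      (sub_pos.2 ((hw.1.2.trans_lt hxy).trans_le hw.2.1)).ne')

theorem continuousOn_angle_mul (hxy : x < y) :
    ContinuousOn (fun u => angle x u * (√(u - x))⁻¹) (Icc y z) :=
  ((continuousOn_angle x).mono fun _ hu => hxy.trans_le hu.1).mul (continuousOn_ellipticHigh hxy)

theorem ellipticFrequency_le (hx : 0 < x) (hxy : x < y) (hyz : y ≤ z) :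
    ellipticFrequency x y z ≤ angle x y := by
  rw [ellipticFrequency, div_le_iff₀ (mul_pos two_pos (ellipticHigh_pos hxy hyz)),
    ellipticLow_eq hx hxy hyz, mul_left_comm, ellipticHigh, ← integral_const_mul (angle x y)]
  refine mul_le_mul_of_nonneg_left (integral_arcMeasure_mono hyz (continuousOn_angle_mul hxy)
    (continuousOn_const.mul (continuousOn_ellipticHigh hxy)) fun u hu => ?_) zero_le_two
  exact mul_le_mul_of_nonneg_right ((angle_strictAntiOn hx).antitoneOn hxy
    (hxy.trans_le hu.1) hu.1) (by positivity)

theorem le_ellipticFrequency (hx : 0 < x) (hxy : x < y) (hyz : y ≤ z) :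
    angle x z ≤ ellipticFrequency x y z := by
  rw [ellipticFrequency, le_div_iff₀ (mul_pos two_pos (ellipticHigh_pos hxy hyz)),
    ellipticLow_eq hx hxy hyz, mul_left_comm, ellipticHigh, ← integral_const_mul]
  refine mul_le_mul_of_nonneg_left (integral_arcMeasure_mono hyz
    (continuousOn_const.mul (continuousOn_ellipticHigh hxy)) (continuousOn_angle_mul hxy)
    fun u hu => ?_) zero_le_two
  exact mul_le_mul_of_nonneg_right ((angle_strictAntiOn hx).antitoneOn (hxy.trans_le hu.1)
    (hxy.trans_le hyz) hu.2) (by positivity)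

theorem ellipticFrequency_lt_half (hx : 0 < x) (hxy : x < y) (hyz : y ≤ z) :
    ellipticFrequency x y z < 1 / 2 :=
  (ellipticFrequency_le hx hxy hyz).trans_lt (angle_lt_half hx hxy)

/-- As `x` tends to `y`, the frequency tends to `1 / 2`. -/
theorem half_sub_ellipticFrequency_mul_log_le (hx : 0 < x) (hxy : x < y) (hyz : y ≤ z)
    (hz : z - y ≤ 1) :
    (1 / 2 - ellipticFrequency x y z) * (2 * Real.log (1 + 1 / √(y - x))) ≤ 1 / √x := by
  have hH := ellipticHigh_pos hxy hyz
  have h1 : 2 * 1 * Real.log (1 + 1 / √(y - x)) ≤ ellipticHigh x y z := by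
    refine log_le_integral_arcMeasure hxy hyz hz zero_le_one (continuousOn_ellipticHigh hxy)
      fun φ hφ => ?_
    rw [one_mul, div_eq_mul_inv]
    exact mul_le_of_le_one_left (by positivity) (Real.cos_le_one φ)
  -- The left side is the integral of (1/2 - angle)/√(u - x), which is bounded, whereas
  -- `ellipticHigh` itself grows logarithmically by the previous step.
  have h2 : ellipticHigh x y z / 2 - ellipticLow x y z / 2 ≤ 1 / √x := by
    rw [ellipticLow_eq hx hxy hyz, mul_div_cancel_left₀ _ two_ne_zero, ellipticHigh,
      ← integral_div, ← integral_sub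
      (integrable_arcMeasure hyz ((continuousOn_ellipticHigh hxy).div_const _))
      (integrable_arcMeasure hyz (continuousOn_angle_mul hxy))]
    have : 1 / √x = ∫ _, 1 / (π * √x) ∂arcMeasure y z := by
      rw [integral_arcMeasure_const]; field_simp [Real.pi_ne_zero]
    rw [this]
    refine integral_arcMeasure_mono hyz (((continuousOn_ellipticHigh hxy).div_const _).sub
      (continuousOn_angle_mul hxy)) continuousOn_const fun u hu => ?_
    have hu' : x < u := hxy.trans_le hu.1
    have h3 := half_sub_angle_le hx hu'
    have h4 : 0 < √(u - x) := Real.sqrt_pos.2 (sub_pos.2 hu')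
    calc (√(u - x))⁻¹ / 2 - angle x u * (√(u - x))⁻¹
        = (1 / 2 - angle x u) * (√(u - x))⁻¹ := by ring
      _ ≤ √(u - x) / (π * √x) * (√(u - x))⁻¹ := by gcongr
      _ = 1 / (π * √x) := by field_simp
  have h3 := ellipticFrequency_lt_half hx hxy hyz
  calc (1 / 2 - ellipticFrequency x y z) * (2 * Real.log (1 + 1 / √(y - x)))
      ≤ (1 / 2 - ellipticFrequency x y z) * ellipticHigh x y z :=
        mul_le_mul_of_nonneg_left (by linarith) (by linarith)
    _ = ellipticHigh x y z / 2 - ellipticLow x y z / 2 := by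
        rw [ellipticFrequency]; field_simp
    _ ≤ _ := h2

end Elliptic

/-! ### Estimates of the frequencies in genus two -/

/-- `w` solves the linear system that defines the frequencies. -/
def IsFrequency (c : Fin 5 → ℝ) (w : Fin 2 → ℝ) : Prop :=
  ∀ α β : ℝ, lowPeriod c (fun s => α + β * s) =
    2 * w 0 * leftPeriod c (fun s => α + β * s) - 2 * w 1 * rightPeriod c (fun s => α + β * s)

theorem leftPeriod_const_mul (c : Fin 5 → ℝ) (r : ℝ) (f : ℝ → ℝ) :
    leftPeriod c (fun t => r * f t) = r * leftPeriod c f := by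
  rw [leftPeriod, leftPeriod, ← integral_const_mul]
  exact integral_congr_ae (Eventually.of_forall fun t => by ring)

theorem rightPeriod_const_mul (c : Fin 5 → ℝ) (r : ℝ) (f : ℝ → ℝ) :
    rightPeriod c (fun t => r * f t) = r * rightPeriod c f := by
  rw [rightPeriod, rightPeriod, ← integral_const_mul]
  exact integral_congr_ae (Eventually.of_forall fun t => by ring)

namespace BranchOrdered

variable {c : Fin 5 → ℝ} (hc : BranchOrdered c)
include hc

theorem leftPeriod_affine (α β : ℝ) : leftPeriod c (fun s => α + β * s)
    = α * leftPeriod c (fun _ => 1) + β * leftPeriod c (fun s => s) := by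
  have h1 := hc.leftPeriod_add_const_mul (f := fun _ => α) (g := fun s => s) β (by fun_prop)
    (by fun_prop)
  have h2 := hc.leftPeriod_add_const_mul (f := fun _ => 0) (g := fun _ => 1) α (by fun_prop)
    (by fun_prop)
  simp only [mul_one, zero_add] at h2
  rw [h1, h2]
  simp [leftPeriod]

theorem rightPeriod_affine (α β : ℝ) : rightPeriod c (fun s => α + β * s)
    = α * rightPeriod c (fun _ => 1) + β * rightPeriod c (fun s => s) := by
  have h1 := hc.rightPeriod_add_const_mul (f := fun _ => α) (g := fun s => s) β (by fun_prop)
    (by fun_prop)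
  have h2 := hc.rightPeriod_add_const_mul (f := fun _ => 0) (g := fun _ => 1) α (by fun_prop)
    (by fun_prop)
  simp only [mul_one, zero_add] at h2
  rw [h1, h2]
  simp [rightPeriod]

theorem lowPeriod_affine (α β : ℝ) : lowPeriod c (fun s => α + β * s)
    = α * lowPeriod c (fun _ => 1) + β * lowPeriod c (fun s => s) := by
  have h1 := hc.lowPeriod_add_const_mul (f := fun _ => α) (g := fun s => s) β (by fun_prop)
    (by fun_prop)
  have h2 := hc.lowPeriod_add_const_mul (f := fun _ => 0) (g := fun _ => 1) α (by fun_prop)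
    (by fun_prop)
  simp only [mul_one, zero_add] at h2
  rw [h1, h2]
  simp [lowPeriod]

theorem leftPeriod_one_pos : 0 < leftPeriod c (fun _ => 1) :=
  hc.leftPeriod_pos continuousOn_const fun _ _ => one_pos

theorem rightPeriod_one_pos : 0 < rightPeriod c (fun _ => 1) :=
  hc.rightPeriod_pos continuousOn_const fun _ _ => one_pos

theorem lowPeriod_one_pos : 0 < lowPeriod c (fun _ => 1) :=
  hc.lowPeriod_pos continuousOn_const fun _ _ => one_pos

theorem leftPeriod_id_le : leftPeriod c (fun s => s) ≤ c 2 * leftPeriod c (fun _ => 1) := by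
  have h := hc.leftPeriod_mono (f := fun s => 0 + 1 * s) (g := fun s => c 2 + 0 * s) (by fun_prop)
    (by fun_prop) fun s hs => by linarith [hs.2]
  simp only [hc.leftPeriod_affine] at h
  linarith

theorem le_leftPeriod_id : c 1 * leftPeriod c (fun _ => 1) ≤ leftPeriod c (fun s => s) := by
  have h := hc.leftPeriod_mono (f := fun s => c 1 + 0 * s) (g := fun s => 0 + 1 * s) (by fun_prop)
    (by fun_prop) fun s hs => by linarith [hs.1]
  simp only [hc.leftPeriod_affine] at h
  linarith

theorem rightPeriod_id_le : rightPeriod c (fun s => s) ≤ c 4 * rightPeriod c (fun _ => 1) := by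
  have h := hc.rightPeriod_mono (f := fun s => 0 + 1 * s) (g := fun s => c 4 + 0 * s) (by fun_prop)
    (by fun_prop) fun s hs => by linarith [hs.2]
  simp only [hc.rightPeriod_affine] at h
  linarith

theorem le_rightPeriod_id : c 3 * rightPeriod c (fun _ => 1) ≤ rightPeriod c (fun s => s) := by
  have h := hc.rightPeriod_mono (f := fun s => c 3 + 0 * s) (g := fun s => 0 + 1 * s) (by fun_prop)
    (by fun_prop) fun s hs => by linarith [hs.1]
  simp only [hc.rightPeriod_affine] at h
  linarith

theorem lowPeriod_id_le : lowPeriod c (fun s => s) ≤ c 0 * lowPeriod c (fun _ => 1) := by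
  rw [lowPeriod, lowPeriod, ← integral_const_mul]
  refine integral_lowMeasure_mono hc.pos.le (continuousOn_id.mul hc.continuousOn_lowWeight)
    (continuousOn_const.mul (continuousOn_const.mul hc.continuousOn_lowWeight)) fun s hs => ?_
  rw [one_mul]
  exact mul_le_mul_of_nonneg_right hs.2 (hc.lowWeight_pos hs).le

/-- The determinant of the linear system. -/
theorem det_pos : 0 < rightPeriod c (fun s => s) * leftPeriod c (fun _ => 1)
    - leftPeriod c (fun s => s) * rightPeriod c (fun _ => 1) := by
  have h1 := hc.leftPeriod_one_pos
  have h2 := hc.rightPeriod_one_pos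
  have h3 := mul_le_mul_of_nonneg_right hc.leftPeriod_id_le h2.le
  have h4 := mul_le_mul_of_nonneg_right hc.le_rightPeriod_id h1.le
  have h5 := mul_pos (mul_pos h1 h2) (sub_pos.2 hc.h23)
  linarith

variable {w : Fin 2 → ℝ}

/-- Test the system on the polynomial vanishing at the mean of the left interval, which kills the
left period. Its low period is positive because this mean is at least c₁ > c₀, and its right period
is minus the determinant. -/
theorem frequency_one_pos (hw : IsFrequency c w) : 0 < w 1 := by
  have e1 := hw (leftPeriod c (fun s => s)) (-leftPeriod c (fun _ => 1))
  rw [hc.leftPeriod_affine, hc.rightPeriod_affine, hc.lowPeriod_affine] at e1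
  have h1 := hc.leftPeriod_one_pos
  have h2 := hc.lowPeriod_one_pos
  have h3 := mul_le_mul_of_nonneg_right hc.lowPeriod_id_le h1.le
  have h4 := mul_le_mul_of_nonneg_right hc.le_leftPeriod_id h2.le
  have h5 := mul_pos (mul_pos h1 h2) (sub_pos.2 hc.h01)
  have h6 : 0 < 2 * w 1 * (rightPeriod c (fun s => s) * leftPeriod c (fun _ => 1)
    - leftPeriod c (fun s => s) * rightPeriod c (fun _ => 1)) := by linarith
  have := (mul_pos_iff_of_pos_right hc.det_pos).1 h6
  linarith

/-- The system in terms of weighted periods over two intervals. -/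
theorem weighted_eq (hw : IsFrequency c w) (α β : ℝ) :
    leftPeriod c (fun t => (α + β * t) * angle (c 0) t)
      - rightPeriod c (fun t => (α + β * t) * angle (c 0) t)
      = w 0 * leftPeriod c (fun s => α + β * s) - w 1 * rightPeriod c (fun s => α + β * s) := by
  have h1 := hw α β
  rw [hc.lowPeriod_eq] at h1
  linarith

theorem continuousOn_affine_mul_angle_left (α β : ℝ) :
    ContinuousOn (fun t => (α + β * t) * angle (c 0) t) (Icc (c 1) (c 2)) :=
  ContinuousOn.mul (by fun_prop) hc.continuousOn_angle_left

theorem continuousOn_affine_mul_angle_right (α β : ℝ) :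
    ContinuousOn (fun t => (α + β * t) * angle (c 0) t) (Icc (c 3) (c 4)) :=
  ContinuousOn.mul (by fun_prop) hc.continuousOn_angle_right

/-- Test the weighted system on m - t, where m is the mean of the right interval; this removes ω₂.
The weighted right period is nonnegative and can be dropped, and on the left `angle` is below 1/2.
-/
theorem frequency_zero_lt (hw : IsFrequency c w) : w 0 < 1 / 2 := by
  have hR1 := hc.rightPeriod_one_pos
  set m := rightPeriod c (fun s => s) / rightPeriod c (fun _ => 1) with hm
  have hm3 : c 3 ≤ m := (le_div_iff₀ hR1).2 hc.le_rightPeriod_id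
  have hm4 : m ≤ c 4 := (div_le_iff₀ hR1).2 hc.rightPeriod_id_le
  have hR0 : rightPeriod c (fun s => m + -1 * s) = 0 := by
    rw [hc.rightPeriod_affine, hm]; field_simp; ring
  have e := hc.weighted_eq hw m (-1)
  rw [hR0, mul_zero, sub_zero] at e
  have hpos : ∀ t ∈ Icc (c 1) (c 2), 0 < m + -1 * t := fun t ht => by
    linarith [ht.2, hc.h23]
  -- Chebyshev's argument: m - t and `angle (c 0) t` - `angle (c 0) m` have the same sign since
  -- `angle` decreases, and m - t has period zero.
  have hR : 0 ≤ rightPeriod c (fun t => (m + -1 * t) * angle (c 0) t) := by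
    have h := hc.rightPeriod_mono (f := fun t => angle (c 0) m * (m + -1 * t))
      (g := fun t => (m + -1 * t) * angle (c 0) t) (by fun_prop)
      (hc.continuousOn_affine_mul_angle_right _ _) fun t ht => by
        have h0 := angle_strictAntiOn hc.pos
        have ht0 : c 0 < t := sub_pos.1 (hc.pos_right ht).1
        have hm0 : c 0 < m := by linarith [hc.h01, hc.h12, hc.h23]
        rcases le_total t m with h | h
        · have := h0.antitoneOn ht0 hm0 h
          nlinarith
        · have := h0.antitoneOn hm0 ht0 h
          nlinarith
    rwa [rightPeriod_const_mul, hR0, mul_zero] at h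
  have hL : 0 < leftPeriod c (fun t => 1 / 2 * (m + -1 * t) + -1 * ((m + -1 * t) * angle (c 0) t)) := by
    refine hc.leftPeriod_pos (ContinuousOn.add (by fun_prop)
      (continuousOn_const.mul (hc.continuousOn_affine_mul_angle_left _ _))) fun t ht => ?_
    have h1 := hpos t ht
    have h2 := angle_lt_half hc.pos (sub_pos.1 (hc.pos_left ht).1)
    nlinarith
  rw [hc.leftPeriod_add_const_mul _ (by fun_prop) (hc.continuousOn_affine_mul_angle_left _ _),
    leftPeriod_const_mul] at hL
  have hLp := hc.leftPeriod_pos (f := fun t => m + -1 * t) (by fun_prop) hpos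
  by_contra! hle
  have := mul_le_mul_of_nonneg_right hle hLp.le
  linarith

theorem continuousOn_uncurry_sub {f : ℝ → ℝ} (hf : Continuous f) :
    ContinuousOn (Function.uncurry fun t u =>
      (f t / √(t - c 0) - f u / √(u - c 0)) / (u - t))
      (Icc (c 1) (c 2) ×ˢ Icc (c 3) (c 4)) := by
  refine ContinuousOn.div (ContinuousOn.sub (ContinuousOn.div ?_ ?_ ?_)
    (ContinuousOn.div ?_ ?_ ?_)) ?_ ?_
  any_goals fun_prop
  · intro z hz
    have := (hc.pos_left hz.1).1
    positivity
  · intro z hz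
    have := (hc.pos_right hz.2).1
    positivity
  · intro z hz
    exact (sub_pos.2 ((hz.1.2.trans_lt hc.h23).trans_le hz.2.1)).ne'

/-- The function 1/√(t - c₀) is decreasing, so the divided difference in
`leftPeriod_sub_rightPeriod` is positive. A constant lower bound on the rectangle gives strictness
after integration. -/
theorem rightPeriod_one_lt : rightPeriod c (fun _ => 1) < leftPeriod c (fun _ => 1) := by
  have hpi := Real.pi_pos
  have hM : 0 < √(c 4 - c 0) := Real.sqrt_pos.2 (by linarith [hc.h01, hc.h12, hc.h23, hc.h34])
  rw [← sub_pos, hc.leftPeriod_sub_rightPeriod continuousOn_const continuousOn_const]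
  refine mul_pos (inv_pos.2 hpi) (lt_of_lt_of_le ?_ (integral_integral_arcMeasure_mono hc.h12.le
    hc.h34.le (f := fun _ _ => 1 / (√(c 4 - c 0) * √(c 4 - c 0) * (2 * √(c 4 - c 0))))
    continuousOn_const (hc.continuousOn_uncurry_sub continuous_const) fun t ht u hu => ?_))
  · rw [integral_arcMeasure_const, integral_arcMeasure_const]
    positivity
  · have ht0 := (hc.pos_left ht).1
    have hu0 := (hc.pos_right hu).1
    have htu : 0 < u - t := sub_pos.2 ((ht.2.trans_lt hc.h23).trans_le hu.1)
    have hT : 0 < √(t - c 0) := Real.sqrt_pos.2 ht0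
    have hU : 0 < √(u - c 0) := Real.sqrt_pos.2 hu0
    have hTM : √(t - c 0) ≤ √(c 4 - c 0) := Real.sqrt_le_sqrt (by linarith [hu.2])
    have hUM : √(u - c 0) ≤ √(c 4 - c 0) := Real.sqrt_le_sqrt (by linarith [hu.2])
    have hdiff : u - t = (√(u - c 0) - √(t - c 0)) * (√(u - c 0) + √(t - c 0)) := by
      have := Real.sq_sqrt hu0.le
      have := Real.sq_sqrt ht0.le
      nlinarith
    have hlt : 0 < √(u - c 0) - √(t - c 0) := by
      rw [hdiff] at htu
      exact (mul_pos_iff_of_pos_right (by positivity)).1 htu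
    have : (1 / √(t - c 0) - 1 / √(u - c 0)) / (u - t)
        = 1 / (√(t - c 0) * √(u - c 0) * (√(u - c 0) + √(t - c 0))) := by
      rw [hdiff]; field_simp
    rw [this]
    gcongr
    linarith

/-- For the polynomial t - c₀ the divided difference is that of the square root, namely -1/(√(u -
c₀) + √(t - c₀)). So the difference of the two periods stays bounded even when c₂ and c₃ merge. -/
theorem period_sub_bounds : -(π / √(c 3 - c 0)) ≤
      leftPeriod c (fun s => -c 0 + 1 * s) - rightPeriod c (fun s => -c 0 + 1 * s) ∧
    leftPeriod c (fun s => -c 0 + 1 * s) - rightPeriod c (fun s => -c 0 + 1 * s) ≤ 0 := by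
  have hpi := Real.pi_pos
  have h3 : 0 < √(c 3 - c 0) := Real.sqrt_pos.2 (by linarith [hc.h01, hc.h12, hc.h23])
  have hval : ∀ t ∈ Icc (c 1) (c 2), ∀ u ∈ Icc (c 3) (c 4),
      ((-c 0 + 1 * t) / √(t - c 0) - (-c 0 + 1 * u) / √(u - c 0)) / (u - t)
        = -(1 / (√(u - c 0) + √(t - c 0))) := fun t ht u hu => by
    have ht0 := (hc.pos_left ht).1
    have hu0 := (hc.pos_right hu).1
    have htu : 0 < u - t := sub_pos.2 ((ht.2.trans_lt hc.h23).trans_le hu.1)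
    have hT : 0 < √(t - c 0) := Real.sqrt_pos.2 ht0
    have hU : 0 < √(u - c 0) := Real.sqrt_pos.2 hu0
    have e1 : -c 0 + 1 * t = √(t - c 0) * √(t - c 0) := by
      rw [Real.mul_self_sqrt ht0.le]; ring
    have e2 : -c 0 + 1 * u = √(u - c 0) * √(u - c 0) := by
      rw [Real.mul_self_sqrt hu0.le]; ring
    have hdiff : u - t = (√(u - c 0) - √(t - c 0)) * (√(u - c 0) + √(t - c 0)) := by
      have := Real.sq_sqrt hu0.le
      have := Real.sq_sqrt ht0.le
      nlinarith
    rw [e1, e2, mul_self_div_self, mul_self_div_self, ← neg_sub (√(u - c 0)), neg_div, hdiff]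
    have : √(u - c 0) - √(t - c 0) ≠ 0 := by
      intro h0
      rw [hdiff, h0, zero_mul] at htu
      exact htu.false
    field_simp
  rw [hc.leftPeriod_sub_rightPeriod (by fun_prop) (by fun_prop)]
  have hcont := hc.continuousOn_uncurry_sub (f := fun s => -c 0 + 1 * s) (by fun_prop)
  constructor
  · have h := integral_integral_arcMeasure_mono hc.h12.le hc.h34.le
      (f := fun _ _ => -(1 / √(c 3 - c 0))) continuousOn_const hcont fun t ht u hu => by
        rw [hval t ht u hu]
        have hT := Real.sqrt_nonneg (t - c 0)
        have hU : √(c 3 - c 0) ≤ √(u - c 0) := Real.sqrt_le_sqrt (by linarith [hu.1])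
        gcongr
        linarith
    rw [integral_arcMeasure_const, integral_arcMeasure_const] at h
    calc -(π / √(c 3 - c 0)) = π⁻¹ * (π * (π * -(1 / √(c 3 - c 0)))) := by field_simp
      _ ≤ _ := mul_le_mul_of_nonneg_left h (inv_pos.2 hpi).le
  · have h := integral_integral_arcMeasure_mono hc.h12.le hc.h34.le
      (g := fun _ _ => 0) hcont continuousOn_const fun t ht u hu => by
        rw [hval t ht u hu, neg_nonpos]
        positivity
    rw [integral_arcMeasure_const, integral_arcMeasure_const, mul_zero, mul_zero] at h
    exact mul_nonpos_of_nonneg_of_nonpos (inv_pos.2 hpi).le h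

/-- Test on t - x with x chosen to equalize the left and right periods. The two preceding period
comparisons give x ≤ c₀, so the polynomial is positive on both intervals. Then ω₁ - ω₂ is a
difference of two means of the decreasing function `angle`, the first over the interval further to
the left. -/
theorem frequency_one_lt_zero (hw : IsFrequency c w) : w 1 < w 0 := by
  have h1 := sub_pos.2 hc.rightPeriod_one_lt
  have h2 := hc.period_sub_bounds.2
  rw [hc.leftPeriod_affine, hc.rightPeriod_affine] at h2
  set x := (leftPeriod c (fun s => s) - rightPeriod c (fun s => s)) /
    (leftPeriod c (fun _ => 1) - rightPeriod c (fun _ => 1)) with hx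
  have hx0 : x ≤ c 0 := by rw [hx, div_le_iff₀ h1]; linarith
  have heq : rightPeriod c (fun s => -x + 1 * s) = leftPeriod c (fun s => -x + 1 * s) := by
    rw [hc.leftPeriod_affine, hc.rightPeriod_affine]
    have : x * (leftPeriod c (fun _ => 1) - rightPeriod c (fun _ => 1))
      = leftPeriod c (fun s => s) - rightPeriod c (fun s => s) := div_mul_cancel₀ _ h1.ne'
    linarith
  have e := hc.weighted_eq hw (-x) 1
  rw [heq] at e
  have hposL : ∀ t ∈ Icc (c 1) (c 2), 0 < -x + 1 * t := fun t ht => by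
    linarith [ht.1, hc.h01]
  have hposR : ∀ t ∈ Icc (c 3) (c 4), 0 < -x + 1 * t := fun t ht => by
    linarith [(hc.pos_right ht).1]
  have h0 := angle_strictAntiOn hc.pos
  have hc2 : c 0 < c 2 := hc.h01.trans hc.h12
  have hL := hc.leftPeriod_mono (f := fun t => angle (c 0) (c 2) * (-x + 1 * t))
    (g := fun t => (-x + 1 * t) * angle (c 0) t) (by fun_prop)
    (hc.continuousOn_affine_mul_angle_left _ _) fun t ht => by
      have := h0.antitoneOn (sub_pos.1 (hc.pos_left ht).1) hc2 ht.2
      nlinarith [hposL t ht]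
  have hR := hc.rightPeriod_mono (g := fun t => angle (c 0) (c 3) * (-x + 1 * t))
    (f := fun t => (-x + 1 * t) * angle (c 0) t)
    (hc.continuousOn_affine_mul_angle_right _ _) (by fun_prop) fun t ht => by
      have := h0.antitoneOn (hc2.trans hc.h23) (sub_pos.1 (hc.pos_right ht).1) ht.1
      nlinarith [hposR t ht]
  rw [leftPeriod_const_mul] at hL
  rw [rightPeriod_const_mul, heq] at hR
  have hLp := hc.leftPeriod_pos (f := fun t => -x + 1 * t) (by fun_prop) hposL
  have hlt := mul_lt_mul_of_pos_right (h0 hc2 (hc2.trans hc.h23) hc.h23) hLp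
  by_contra! hle
  have := mul_le_mul_of_nonneg_right hle hLp.le
  linarith

/-- The frequencies coalesce as `c₂` and `c₃` do. -/
theorem frequency_sub_le (hw : IsFrequency c w) (h4 : c 4 ≤ 1) :
    (w 0 - w 1) * (4 * Real.log (1 + 1 / √(c 3 - c 2))) ≤ π / √(c 3 - c 0) := by
  obtain ⟨hb, -⟩ := hc.period_sub_bounds
  -- For t - c₀ the low period is nonpositive, so (ω₁ - ω₂) times the right period is at most ω₁
  -- times the bounded difference of the right and left periods. The right period diverges
  -- logarithmically as c₂ and c₃ merge.
  have e := hw (-c 0) 1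
  have hlow : lowPeriod c (fun s => -c 0 + 1 * s) ≤ 0 := by
    rw [hc.lowPeriod_affine]
    linarith [hc.lowPeriod_id_le]
  have h0 : 0 < w 0 := (hc.frequency_one_pos hw).trans (hc.frequency_one_lt_zero hw)
  have h1 := hc.frequency_zero_lt hw
  have hR : 2 * 1 * Real.log (1 + 1 / √(c 3 - c 2)) ≤ rightPeriod c (fun s => -c 0 + 1 * s) := by
    refine log_le_integral_arcMeasure hc.h23 hc.h34.le
      (by linarith [hc.pos, hc.h01, hc.h12, hc.h23]) zero_le_one
      (ContinuousOn.mul (by fun_prop) hc.continuousOn_rightWeight) fun φ _ => ?_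
    have hu := arcPoint_mem hc.h34.le φ
    generalize arcPoint (c 3) (c 4) φ = u at hu
    obtain ⟨h5, h6, h7⟩ := hc.pos_right hu
    have e1 : -c 0 + 1 * u = √(u - c 0) * √(u - c 0) := by
      rw [Real.mul_self_sqrt h5.le]; ring
    have h8 := Real.sqrt_pos.2 h5
    have h9 := Real.sqrt_pos.2 h6
    have h10 := Real.sqrt_pos.2 h7
    have h11 : √(u - c 1) ≤ √(u - c 0) := Real.sqrt_le_sqrt (by linarith [hc.h01])
    beta_reduce
    rw [rightWeight, e1, Real.sqrt_mul h6.le, one_mul]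
    have h12 : √(u - c 0) * √(u - c 0) * (√(u - c 0) * (√(u - c 1) * √(u - c 2)))⁻¹
      = √(u - c 0) / √(u - c 1) * (1 / √(u - c 2)) := by field_simp
    rw [h12]
    calc Real.cos φ / √(u - c 2) ≤ 1 * (1 / √(u - c 2)) := by
          rw [one_mul]; gcongr; exact Real.cos_le_one φ
      _ ≤ _ := by
          gcongr
          rwa [le_div_iff₀ h9, one_mul]
  have h2 := mul_le_mul_of_nonneg_left hR (sub_pos.2 (hc.frequency_one_lt_zero hw)).le
  have hpos : 0 ≤ π / √(c 3 - c 0) := by positivity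
  nlinarith [mul_le_mul_of_nonneg_left hb h0.le]

/-- The polynomial c₃ - t leaves √(c₃ - t) in the numerator, which vanishes at c₂ if c₂ = c₃. The
factor cos φ allowed in `log_le_integral_arcMeasure` absorbs this, so the divergence as c₀ and c₁
merge is uniform in c₂. -/
theorem log_le_leftPeriod (h4 : c 4 ≤ 1) :
    2 * √(c 3 - c 1) * Real.log (1 + 1 / √(c 1 - c 0)) ≤ leftPeriod c (fun s => c 3 + -1 * s) := by
  refine log_le_integral_arcMeasure hc.h01 hc.h12.le
    (by linarith [hc.pos, hc.h01, hc.h12, hc.h23, hc.h34]) (Real.sqrt_nonneg _)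
    (ContinuousOn.mul (by fun_prop) hc.continuousOn_leftWeight) fun φ hφ => ?_
  have hcos : 0 ≤ Real.cos φ := Real.cos_nonneg_of_mem_Icc ⟨by linarith [hφ.1, Real.pi_pos], hφ.2⟩
  have ht := arcPoint_mem hc.h12.le φ
  have hge : (c 3 - c 1) * Real.cos φ ^ 2 ≤ c 3 - arcPoint (c 1) (c 2) φ := by
    have := Real.sin_sq_add_cos_sq φ
    rw [show Real.cos φ ^ 2 = 1 - Real.sin φ ^ 2 by linarith, arcPoint]
    nlinarith [sq_nonneg (Real.sin φ), hc.h23]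
  generalize arcPoint (c 1) (c 2) φ = t at ht hge
  obtain ⟨h5, h6, h7⟩ := hc.pos_left ht
  have h8 := Real.sqrt_pos.2 h5
  have h9 := Real.sqrt_pos.2 h6
  have h10 := Real.sqrt_pos.2 h7
  have e1 : c 3 + -1 * t = √(c 3 - t) * √(c 3 - t) := by
    rw [Real.mul_self_sqrt h6.le]; ring
  have h11 : √(c 4 - t) ≤ 1 := by
    exact Real.sqrt_le_one.2 (by linarith [ht.1, hc.pos, hc.h01])
  have h12 : √(c 3 - c 1) * Real.cos φ ≤ √(c 3 - t) := by
    rw [← Real.sqrt_sq hcos, ← Real.sqrt_mul (by linarith [hc.h12, hc.h23])]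
    exact Real.sqrt_le_sqrt hge
  beta_reduce
  rw [leftWeight, e1, Real.sqrt_mul h6.le]
  have h13 : √(c 3 - t) * √(c 3 - t) * (√(t - c 0) * (√(c 3 - t) * √(c 4 - t)))⁻¹
    = √(c 3 - t) / √(t - c 0) * (1 / √(c 4 - t)) := by field_simp
  rw [h13]
  calc √(c 3 - c 1) * (Real.cos φ / √(t - c 0))
      = √(c 3 - c 1) * Real.cos φ / √(t - c 0) * 1 := by ring
    _ ≤ _ := by
      gcongr
      rwa [le_div_iff₀ h10, one_mul]

/-- The first frequency tends to `1 / 2` as `c₀` and `c₁` coalesce. -/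
theorem half_sub_frequency_le (hw : IsFrequency c w) (h4 : c 4 ≤ 1) :
    (1 / 2 - w 0) * (2 * √(c 3 - c 1) * Real.log (1 + 1 / √(c 1 - c 0)))
      ≤ 1 / √(c 0) + π / (2 * √(c 3 - c 0)) := by
  have hpi := Real.pi_pos
  have h0 : 0 < √(c 0) := Real.sqrt_pos.2 hc.pos
  have h30 : 0 < √(c 3 - c 0) := Real.sqrt_pos.2 (by linarith [hc.h01, hc.h12, hc.h23])
  have hw1 := hc.frequency_one_pos hw
  have hw0 := hc.frequency_zero_lt hw
  -- For c₃ - t the system gives (1/2 - ω₁) times the left period as the left period of (1/2 -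
  -- angle)(c₃ - t) plus right terms. The former is at most 1/√c₀, and the latter are controlled by
  -- the sign of c₃ - t on the right interval and by ω₂ < 1/2.
  have e := hc.weighted_eq hw (c 3) (-1)
  have hL : leftPeriod c (fun t => 1 / 2 * (c 3 + -1 * t) + -1 * ((c 3 + -1 * t) * angle (c 0) t))
      ≤ 1 / √(c 0) := by
    have : 1 / √(c 0) = ∫ _, 1 / (π * √(c 0)) ∂arcMeasure (c 1) (c 2) := by
      rw [integral_arcMeasure_const]; field_simp
    rw [this]
    refine integral_arcMeasure_mono hc.h12.le (ContinuousOn.mul (ContinuousOn.add (by fun_prop)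
      (continuousOn_const.mul (hc.continuousOn_affine_mul_angle_left _ _)))
      hc.continuousOn_leftWeight) continuousOn_const fun t ht => ?_
    obtain ⟨h5, h6, h7⟩ := hc.pos_left ht
    have h8 := Real.sqrt_pos.2 h5
    have h9 := Real.sqrt_pos.2 h6
    have h10 := Real.sqrt_pos.2 h7
    have e1 : c 3 - t = √(c 3 - t) * √(c 3 - t) := (Real.mul_self_sqrt h6.le).symm
    have h11 := half_sub_angle_le hc.pos (sub_pos.1 h5)
    have h12 : √(c 3 - t) ≤ √(c 4 - t) := Real.sqrt_le_sqrt (by linarith [hc.h34])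
    calc (1 / 2 * (c 3 + -1 * t) + -1 * ((c 3 + -1 * t) * angle (c 0) t)) * leftWeight c t
        = (1 / 2 - angle (c 0) t) * ((c 3 - t) * leftWeight c t) := by ring
      _ = (1 / 2 - angle (c 0) t) * (√(c 3 - t) / (√(t - c 0) * √(c 4 - t))) := by
          rw [leftWeight, Real.sqrt_mul h6.le]
          nth_rewrite 1 [e1]
          field_simp
      _ ≤ √(t - c 0) / (π * √(c 0)) * (√(c 4 - t) / (√(t - c 0) * √(c 4 - t))) := by
          gcongr
      _ = 1 / (π * √(c 0)) := by field_simp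
  rw [hc.leftPeriod_add_const_mul _ (by fun_prop) (hc.continuousOn_affine_mul_angle_left _ _),
    leftPeriod_const_mul] at hL
  have hR : rightPeriod c (fun t => -c 3 + 1 * t) ≤ π / √(c 3 - c 0) := by
    have : π / √(c 3 - c 0) = ∫ _, 1 / √(c 3 - c 0) ∂arcMeasure (c 3) (c 4) := by
      rw [integral_arcMeasure_const]; field_simp
    rw [this]
    refine integral_arcMeasure_mono hc.h34.le (ContinuousOn.mul (by fun_prop)
      hc.continuousOn_rightWeight) continuousOn_const fun u hu => ?_
    obtain ⟨h5, h6, h7⟩ := hc.pos_right hu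
    have h8 := Real.sqrt_pos.2 h5
    have h9 := Real.sqrt_pos.2 (mul_pos h6 h7)
    have h10 : √(c 3 - c 0) ≤ √(u - c 0) := Real.sqrt_le_sqrt (by linarith [hu.1])
    have h11 : u - c 3 ≤ √((u - c 1) * (u - c 2)) := by
      refine Real.le_sqrt_of_sq_le ?_
      have := hu.1
      nlinarith [hc.h12, hc.h23]
    rw [rightWeight, ← div_eq_mul_inv, div_le_div_iff₀ (by positivity) h30, one_mul, mul_comm]
    have : -c 3 + 1 * u = u - c 3 := by ring
    beta_reduce
    rw [this]
    have : 0 ≤ u - c 3 := by linarith [hu.1]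
    gcongr
  have hRpos : 0 ≤ rightPeriod c (fun t => -c 3 + 1 * t) := by
    rw [hc.rightPeriod_affine]; linarith [hc.le_rightPeriod_id]
  have hRneg : rightPeriod c (fun t => c 3 + -1 * t) = -rightPeriod c (fun t => -c 3 + 1 * t) := by
    rw [hc.rightPeriod_affine, hc.rightPeriod_affine]; ring
  have hRang : rightPeriod c (fun t => (c 3 + -1 * t) * angle (c 0) t) ≤ 0 := by
    have h := hc.rightPeriod_mono (g := fun t => 0 * (-c 3 + 1 * t))
      (f := fun t => (c 3 + -1 * t) * angle (c 0) t)
      (hc.continuousOn_affine_mul_angle_right _ _) (by fun_prop) fun t ht => by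
        have := angle_pos hc.pos (sub_pos.1 (hc.pos_right ht).1)
        nlinarith [ht.1]
    rwa [rightPeriod_const_mul, zero_mul] at h
  rw [hRneg] at e
  have hlog := mul_le_mul_of_nonneg_left (hc.log_le_leftPeriod h4) (sub_pos.2 hw0).le
  have hfin : π / (2 * √(c 3 - c 0)) = 1 / 2 * (π / √(c 3 - c 0)) := by field_simp
  rw [hfin]
  have := mul_le_mul_of_nonneg_right
    ((hc.frequency_one_lt_zero hw).trans (hc.frequency_zero_lt hw)).le hRpos
  linarith

/-- The first frequency tends to `0` as `c₀` does. -/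
theorem frequency_zero_le (hw : IsFrequency c w) (h4 : c 4 ≤ 1) :
    w 0 * (2 * √(c 3 - c 1) * Real.log (1 + 1 / √(c 1 - c 0))) ≤ √(c 0) / (c 1 - c 0) := by
  have h10 : 0 < c 1 - c 0 := sub_pos.2 hc.h01
  have hw1 := hc.frequency_one_pos hw
  have h0 : 0 < w 0 := hw1.trans (hc.frequency_one_lt_zero hw)
  -- The polynomial c₃ - t is nonpositive on the right interval, so the ω₂ term can be dropped. The
  -- low period is O(√c₀), because the total mass of `lowMeasure` is 2√c₀.
  have e := hw (c 3) (-1)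
  have hR : rightPeriod c (fun t => c 3 + -1 * t) ≤ 0 := by
    rw [hc.rightPeriod_affine]; linarith [hc.le_rightPeriod_id]
  have hlow : lowPeriod c (fun t => c 3 + -1 * t) ≤ 2 * √(c 0) * (1 / (c 1 - c 0)) := by
    rw [← integral_lowMeasure_const]
    refine integral_lowMeasure_mono hc.pos.le (ContinuousOn.mul (by fun_prop)
      hc.continuousOn_lowWeight) continuousOn_const fun s hs => ?_
    obtain ⟨h5, h6, h7, h8⟩ := hc.pos_low hs
    have h9 : c 3 + -1 * s ≤ √((c 3 - s) * (c 4 - s)) :=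
      Real.le_sqrt_of_sq_le (by nlinarith [hc.h34])
    have h11 : c 1 - c 0 ≤ √((c 1 - s) * (c 2 - s)) :=
      Real.le_sqrt_of_sq_le (by nlinarith [hc.h12, hs.2])
    rw [lowWeight, ← div_eq_mul_inv, div_le_div_iff₀ (by positivity) h10, one_mul, mul_comm]
    have : 0 ≤ c 3 + -1 * s := by linarith
    gcongr
  have hlog := mul_le_mul_of_nonneg_left (hc.log_le_leftPeriod h4) h0.le
  have h5 := mul_nonpos_of_nonneg_of_nonpos hw1.le hR
  have h6 : 2 * √(c 0) * (1 / (c 1 - c 0)) = 2 * (√(c 0) / (c 1 - c 0)) := by ring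
  linarith

theorem leftPeriod_sub_nonneg : 0 ≤ leftPeriod c (fun s => -c 1 + 1 * s) := by
  rw [hc.leftPeriod_affine]; linarith [hc.le_leftPeriod_id]

theorem h03 : c 0 < c 3 := hc.h01.trans (hc.h12.trans hc.h23)

/-- Upper bound for the second frequency as `c₁` and `c₂` coalesce. -/
theorem frequency_one_le (hw : IsFrequency c w) (h4 : c 4 ≤ 1) :
    w 1 ≤ ellipticFrequency (c 0) (c 3) (c 4)
      + (c 2 - c 1) / (2 * (√(c 1 - c 0) * (c 3 - c 2))) := by
  have hpi := Real.pi_pos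
  have h10 : 0 < √(c 1 - c 0) := Real.sqrt_pos.2 (sub_pos.2 hc.h01)
  have h32 : 0 < c 3 - c 2 := sub_pos.2 hc.h23
  -- The polynomial t - c₁ cancels √((t - c₁)(t - c₂)) in the limit c₁ = c₂, so the low and right
  -- periods approach the genus one periods up to sign, while the left period tends to zero.
  have e := hw (-c 1) 1
  have hw1 := hc.frequency_one_pos hw
  have hw0 := hc.frequency_zero_lt hw
  have hHpos := ellipticHigh_pos hc.h03 hc.h34.le
  -- Here c₄ ≤ 1 bounds √(u - c₀) by 1. This lets the left period, at most π times the error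
  -- quotient, be divided by the genus one period.
  have hH : π ≤ ellipticHigh (c 0) (c 3) (c 4) := by
    rw [← mul_one π, ← integral_arcMeasure_const (c 3) (c 4)]
    refine integral_arcMeasure_mono hc.h34.le continuousOn_const
      (continuousOn_ellipticHigh hc.h03) fun u hu => ?_
    have h5 := Real.sqrt_pos.2 (hc.pos_right hu).1
    rw [one_le_inv₀ h5]
    exact Real.sqrt_le_one.2 (by linarith [hu.2, hc.pos])
  have hR : ellipticHigh (c 0) (c 3) (c 4) ≤ rightPeriod c (fun s => -c 1 + 1 * s) := by
    refine integral_arcMeasure_mono hc.h34.le (continuousOn_ellipticHigh hc.h03)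
      (ContinuousOn.mul (by fun_prop) hc.continuousOn_rightWeight) fun u hu => ?_
    obtain ⟨h5, h6, h7⟩ := hc.pos_right hu
    have h8 := Real.sqrt_pos.2 h5
    have h9 := Real.sqrt_pos.2 (mul_pos h6 h7)
    have h11 : √((u - c 1) * (u - c 2)) ≤ -c 1 + 1 * u :=
      (Real.sqrt_le_left (by linarith)).2 (by nlinarith [hc.h12])
    rw [rightWeight, mul_inv, mul_left_comm]
    refine le_mul_of_one_le_right (by positivity) ?_
    rwa [← div_eq_mul_inv, le_div_iff₀ h9, one_mul]
  have hN : -lowPeriod c (fun s => -c 1 + 1 * s) ≤ ellipticLow (c 0) (c 3) (c 4) := by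
    rw [lowPeriod, ← integral_neg]
    refine integral_lowMeasure_mono hc.pos.le (ContinuousOn.mul (by fun_prop)
      hc.continuousOn_lowWeight).neg (continuousOn_ellipticLow hc.h03 hc.h34.le) fun s hs => ?_
    obtain ⟨h5, h6, h7, h8⟩ := hc.pos_low hs
    have h9 := Real.sqrt_pos.2 (mul_pos h5 h6)
    have h11 : c 1 - s ≤ √((c 1 - s) * (c 2 - s)) :=
      Real.le_sqrt_of_sq_le (by nlinarith [hc.h12])
    rw [lowWeight, mul_inv, ← neg_mul, ← mul_assoc]
    refine mul_le_of_le_one_left (by positivity) ?_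
    rw [← div_eq_mul_inv, div_le_one h9]
    linarith
  have hL : leftPeriod c (fun s => -c 1 + 1 * s)
      ≤ π * ((c 2 - c 1) / (√(c 1 - c 0) * (c 3 - c 2))) := by
    rw [← integral_arcMeasure_const (c 1) (c 2)]
    refine integral_arcMeasure_mono hc.h12.le (ContinuousOn.mul (by fun_prop)
      hc.continuousOn_leftWeight) continuousOn_const fun t ht => ?_
    obtain ⟨h5, h6, h7⟩ := hc.pos_left ht
    have h11 : c 3 - c 2 ≤ √((c 3 - t) * (c 4 - t)) :=
      Real.le_sqrt_of_sq_le (by nlinarith [hc.h34, ht.2])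
    have h12 : √(c 1 - c 0) ≤ √(t - c 0) := Real.sqrt_le_sqrt (by linarith [ht.1])
    rw [leftWeight, ← div_eq_mul_inv]
    have := ht.2
    gcongr
    · linarith [hc.h12]
    · linarith
  have hLnn := hc.leftPeriod_sub_nonneg
  set H := ellipticHigh (c 0) (c 3) (c 4)
  set N := ellipticLow (c 0) (c 3) (c 4) with hNdef
  set q := (c 2 - c 1) / (√(c 1 - c 0) * (c 3 - c 2)) with hq
  have hq0 : 0 ≤ q := div_nonneg (by linarith [hc.h12]) (by positivity)
  have h1 : 2 * w 1 * H ≤ N + H * q := by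
    have a1 := mul_le_mul_of_nonneg_left hR hw1.le
    have a2 := mul_le_mul_of_nonneg_right hw0.le hLnn
    have a3 := mul_le_mul_of_nonneg_right hH hq0
    linarith
  have h2 : (c 2 - c 1) / (2 * (√(c 1 - c 0) * (c 3 - c 2))) = q / 2 := by
    rw [hq]; field_simp
  rw [h2, ellipticFrequency]
  have h3 : N / (2 * H) + q / 2 = (N + H * q) / (2 * H) := by field_simp
  rw [h3, le_div_iff₀ (by positivity)]
  linarith

/-- Lower bound for the second frequency as `c₁` and `c₂` coalesce. -/
theorem le_frequency_one (hw : IsFrequency c w) :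
    ellipticFrequency (c 0) (c 3) (c 4) * (√((c 1 - c 0) / (c 2 - c 0)) *
      √((c 3 - c 2) / (c 3 - c 1))) ≤ w 1 := by
  have h10 : 0 < c 1 - c 0 := sub_pos.2 hc.h01
  have h20 : 0 < c 2 - c 0 := by linarith [hc.h12]
  have h32 : 0 < c 3 - c 2 := sub_pos.2 hc.h23
  have h31 : 0 < c 3 - c 1 := by linarith [hc.h12]
  -- Same polynomial as for the upper bound. The ω₁ term is now discarded by sign, and the square
  -- roots in the statement measure the failure of (t - c₁)/√((t - c₁)(t - c₂)) to be ±1.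
  have e := hw (-c 1) 1
  have hw1 := hc.frequency_one_pos hw
  have hw0 := hw1.trans (hc.frequency_one_lt_zero hw)
  have hHpos := ellipticHigh_pos hc.h03 hc.h34.le
  have hR : √((c 3 - c 2) / (c 3 - c 1)) * rightPeriod c (fun s => -c 1 + 1 * s)
      ≤ ellipticHigh (c 0) (c 3) (c 4) := by
    rw [rightPeriod, ← integral_const_mul]
    refine integral_arcMeasure_mono hc.h34.le
      (continuousOn_const.mul (ContinuousOn.mul (by fun_prop) hc.continuousOn_rightWeight))
      (continuousOn_ellipticHigh hc.h03) fun u hu => ?_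
    obtain ⟨h5, h6, h7⟩ := hc.pos_right hu
    have h8 := Real.sqrt_pos.2 h5
    have h9 := Real.sqrt_pos.2 (mul_pos h6 h7)
    have h11 : √((c 3 - c 2) / (c 3 - c 1)) * (u - c 1) ≤ √((u - c 1) * (u - c 2)) := by
      refine Real.le_sqrt_of_sq_le ?_
      rw [mul_pow, Real.sq_sqrt (by positivity), div_mul_eq_mul_div, div_le_iff₀ h31]
      have := mul_nonneg h6.le (mul_nonneg (sub_pos.2 hc.h12).le (sub_nonneg.2 hu.1))
      nlinarith
    have h12 : √((c 3 - c 2) / (c 3 - c 1)) * ((-c 1 + 1 * u) * rightWeight c u)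
        = (√(u - c 0))⁻¹ * (√((c 3 - c 2) / (c 3 - c 1)) * (u - c 1) /
          √((u - c 1) * (u - c 2))) := by
      rw [rightWeight]; field_simp; ring
    rw [h12]
    refine mul_le_of_le_one_right (by positivity) ?_
    rwa [div_le_one h9]
  have hN : √((c 1 - c 0) / (c 2 - c 0)) * ellipticLow (c 0) (c 3) (c 4)
      ≤ -lowPeriod c (fun s => -c 1 + 1 * s) := by
    rw [lowPeriod, ← integral_neg, ellipticLow, ← integral_const_mul]
    refine integral_lowMeasure_mono hc.pos.le
      (continuousOn_const.mul (continuousOn_ellipticLow hc.h03 hc.h34.le))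
      (ContinuousOn.mul (by fun_prop) hc.continuousOn_lowWeight).neg fun s hs => ?_
    obtain ⟨h5, h6, h7, h8⟩ := hc.pos_low hs
    have h9 := Real.sqrt_pos.2 (mul_pos h5 h6)
    have h11 : √((c 1 - c 0) / (c 2 - c 0)) * √((c 1 - s) * (c 2 - s)) ≤ c 1 - s := by
      rw [← Real.sqrt_mul (by positivity)]
      refine (Real.sqrt_le_left h5.le).2 ?_
      rw [div_mul_eq_mul_div, div_le_iff₀ h20]
      have := mul_nonneg h5.le (mul_nonneg (sub_pos.2 hc.h12).le (sub_nonneg.2 hs.2))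
      nlinarith
    rw [lowWeight, mul_inv, ← neg_mul, ← mul_assoc]
    refine mul_le_mul_of_nonneg_right ?_ (by positivity)
    rw [← div_eq_mul_inv, le_div_iff₀ h9]
    linarith
  have hLnn := hc.leftPeriod_sub_nonneg
  set H := ellipticHigh (c 0) (c 3) (c 4)
  set N := ellipticLow (c 0) (c 3) (c 4) with hNdef
  set p := √((c 1 - c 0) / (c 2 - c 0))
  set q := √((c 3 - c 2) / (c 3 - c 1))
  have hq0 : 0 ≤ q := Real.sqrt_nonneg _
  have h1 : p * N ≤ 2 * w 1 * rightPeriod c (fun s => -c 1 + 1 * s) := by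
    have := mul_nonneg hw0.le hLnn
    linarith
  have h2 : p * N * q ≤ 2 * w 1 * H := by
    have a1 := mul_le_mul_of_nonneg_right h1 hq0
    have a2 := mul_le_mul_of_nonneg_left hR hw1.le
    linarith
  rw [ellipticFrequency, div_mul_eq_mul_div, div_le_iff₀ (by positivity)]
  linarith

end BranchOrdered

/-! ### The frequency map in terms of periods -/

/-- The sorting permutation is irrelevant: any permutation with a monotone result yields the same
list. This allows explicit permutations for each caustic type. -/
theorem branchPoint_eq {n : ℕ} {a : Fin (n + 1) → ℝ} {lam : Fin n → ℝ} {c : Fin (n + 1 + n) → ℝ}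
    (σ : Equiv.Perm (Fin (n + 1 + n))) (hσ : Fin.append a lam ∘ σ = c) (hc : Monotone c) :
    branchPoint a lam = Fin.cons 0 c := by
  rw [branchPoint, ← hσ]
  congr 1
  exact ((Tuple.comp_sort_eq_comp_iff_monotone).2 (hσ ▸ hc)).symm

theorem hyperellipticT_eq {n : ℕ} {a : Fin (n + 1) → ℝ} {lam : Fin n → ℝ}
    {c : Fin (n + 1 + n) → ℝ} (σ : Equiv.Perm (Fin (n + 1 + n)))
    (hσ : Fin.append a lam ∘ σ = c) (s : ℝ) : hyperellipticT a lam s = ∏ i, (c i - s) := by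
  rw [← hσ]
  simp only [Function.comp_apply]
  rw [Equiv.prod_comp σ (fun i => Fin.append a lam i - s), Fin.prod_univ_add]
  simp [hyperellipticT]

theorem BranchOrdered.monotone {c : Fin 5 → ℝ} (hc : BranchOrdered c) : Monotone c := by
  refine Fin.monotone_iff_le_succ.2 fun i => ?_
  fin_cases i
  · exact hc.h01.le
  · exact hc.h12.le
  · exact hc.h23.le
  · exact hc.h34.le

/-- The solution of the linear system for the frequencies by Cramer's rule. -/
def frequencyOf (c : Fin 5 → ℝ) : Fin 2 → ℝ :=
  ![(lowPeriod c (fun _ => 1) * rightPeriod c (fun s => s)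
        - lowPeriod c (fun s => s) * rightPeriod c (fun _ => 1)) /
      (2 * (rightPeriod c (fun s => s) * leftPeriod c (fun _ => 1)
        - leftPeriod c (fun s => s) * rightPeriod c (fun _ => 1))),
    (lowPeriod c (fun _ => 1) * leftPeriod c (fun s => s)
        - lowPeriod c (fun s => s) * leftPeriod c (fun _ => 1)) /
      (2 * (rightPeriod c (fun s => s) * leftPeriod c (fun _ => 1)
        - leftPeriod c (fun s => s) * rightPeriod c (fun _ => 1)))]

theorem BranchOrdered.isFrequency_frequencyOf {c : Fin 5 → ℝ} (hc : BranchOrdered c) :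
    IsFrequency c (frequencyOf c) := by
  intro α β
  have h := hc.det_pos.ne'
  rw [hc.lowPeriod_affine, hc.leftPeriod_affine, hc.rightPeriod_affine]
  simp only [frequencyOf, Matrix.cons_val_zero, Matrix.cons_val_one]
  generalize lowPeriod c (fun _ => 1) = l0, lowPeriod c (fun s => s) = l1,
    leftPeriod c (fun _ => 1) = p0, leftPeriod c (fun s => s) = p1,
    rightPeriod c (fun _ => 1) = r0, rightPeriod c (fun s => s) = r1 at h ⊢
  have h' : r1 * p0 - p1 * r0 ≠ 0 := fun h0 => h (by linear_combination h0)
  generalize hD : r1 * p0 - p1 * r0 = D at h' ⊢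
  field_simp
  rw [← hD]
  ring

section Genus2

variable {a : Fin (2 + 1) → ℝ} {lam : Fin 2 → ℝ} {c : Fin 5 → ℝ}

theorem hyperellipticT_two (σ : Equiv.Perm (Fin 5)) (hσ : Fin.append a lam ∘ σ = c) (s : ℝ) :
    hyperellipticT a lam s = (c 0 - s) * (c 1 - s) * (c 2 - s) * (c 3 - s) * (c 4 - s) :=
  (hyperellipticT_eq (n := 2) σ hσ s).trans (Fin.prod_univ_five fun i => c i - s)

theorem hyperellipticK_zero (hc : BranchOrdered c) (σ : Equiv.Perm (Fin 5))
    (hσ : Fin.append a lam ∘ σ = c) (i : Fin 2) :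
    hyperellipticK a lam i 0 = lowPeriod c (fun s => s ^ (i : ℕ)) := by
  have h1 : hyperellipticK a lam i 0
      = ∫ s in (0 : ℝ)..(c 0), s ^ (i : ℕ) / √(hyperellipticT a lam s) := by
    rw [hyperellipticK, branchPoint_eq (n := 2) σ hσ hc.monotone]
    rfl
  rw [h1, lowPeriod, ← intervalIntegral_div_sqrt_eq_lowMeasure (f := fun s => s ^ (i : ℕ) * lowWeight c s) hc.pos
    ((continuousOn_pow _).mul hc.continuousOn_lowWeight)]
  refine intervalIntegral.integral_congr fun s hs => ?_
  rw [uIcc_of_le hc.pos.le] at hs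
  obtain ⟨h2, h3, h4, h5⟩ := hc.pos_low hs
  have h0 : 0 ≤ c 0 - s := sub_nonneg.2 hs.2
  simp only [hyperellipticT_two σ hσ, lowWeight]
  rw [show (c 0 - s) * (c 1 - s) * (c 2 - s) * (c 3 - s) * (c 4 - s)
      = (c 0 - s) * (((c 1 - s) * (c 2 - s)) * ((c 3 - s) * (c 4 - s))) by ring,
    Real.sqrt_mul h0, Real.sqrt_mul (mul_pos h2 h3).le, div_mul_eq_div_div, ← div_eq_mul_inv,
    div_right_comm]

theorem hyperellipticK_one (hc : BranchOrdered c) (σ : Equiv.Perm (Fin 5))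
    (hσ : Fin.append a lam ∘ σ = c) (i : Fin 2) :
    hyperellipticK a lam i 1 = leftPeriod c (fun s => s ^ (i : ℕ)) := by
  have h1 : hyperellipticK a lam i 1
      = ∫ s in (c 1)..(c 2), s ^ (i : ℕ) / √(hyperellipticT a lam s) := by
    rw [hyperellipticK, branchPoint_eq (n := 2) σ hσ hc.monotone]
    rfl
  rw [h1, leftPeriod, ← intervalIntegral_div_sqrt_eq_arcMeasure (f := fun s => s ^ (i : ℕ) * leftWeight c s) hc.h12
    ((continuousOn_pow _).mul hc.continuousOn_leftWeight)]
  refine intervalIntegral.integral_congr fun t ht => ?_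
  rw [uIcc_of_le hc.h12.le] at ht
  obtain ⟨h2, h3, h4⟩ := hc.pos_left ht
  have h0 : 0 ≤ (t - c 1) * (c 2 - t) := mul_nonneg (sub_nonneg.2 ht.1) (sub_nonneg.2 ht.2)
  simp only [hyperellipticT_two σ hσ, leftWeight]
  rw [show (c 0 - t) * (c 1 - t) * (c 2 - t) * (c 3 - t) * (c 4 - t)
      = ((t - c 1) * (c 2 - t)) * ((t - c 0) * ((c 3 - t) * (c 4 - t))) by ring,
    Real.sqrt_mul h0, Real.sqrt_mul h2.le, div_mul_eq_div_div, ← div_eq_mul_inv, div_right_comm]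

theorem hyperellipticK_two (hc : BranchOrdered c) (σ : Equiv.Perm (Fin 5))
    (hσ : Fin.append a lam ∘ σ = c) (i : Fin 2) :
    hyperellipticK a lam i 2 = rightPeriod c (fun s => s ^ (i : ℕ)) := by
  have h1 : hyperellipticK a lam i 2
      = ∫ s in (c 3)..(c 4), s ^ (i : ℕ) / √(hyperellipticT a lam s) := by
    rw [hyperellipticK, branchPoint_eq (n := 2) σ hσ hc.monotone]
    rfl
  rw [h1, rightPeriod, ← intervalIntegral_div_sqrt_eq_arcMeasure (f := fun s => s ^ (i : ℕ) * rightWeight c s) hc.h34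
    ((continuousOn_pow _).mul hc.continuousOn_rightWeight)]
  refine intervalIntegral.integral_congr fun t ht => ?_
  rw [uIcc_of_le hc.h34.le] at ht
  obtain ⟨h2, h3, h4⟩ := hc.pos_right ht
  have h0 : 0 ≤ (t - c 3) * (c 4 - t) := mul_nonneg (sub_nonneg.2 ht.1) (sub_nonneg.2 ht.2)
  simp only [hyperellipticT_two σ hσ, rightWeight]
  rw [show (c 0 - t) * (c 1 - t) * (c 2 - t) * (c 3 - t) * (c 4 - t)
      = ((t - c 3) * (c 4 - t)) * ((t - c 0) * ((t - c 1) * (t - c 2))) by ring,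
    Real.sqrt_mul h0, Real.sqrt_mul h2.le, div_mul_eq_div_div, ← div_eq_mul_inv, div_right_comm]

theorem frequencyMap_eq (hc : BranchOrdered c) (σ : Equiv.Perm (Fin 5))
    (hσ : Fin.append a lam ∘ σ = c) : frequencyMap a lam = frequencyOf c := by
  have h := hc.isFrequency_frequencyOf
  have e0 := h 1 0
  have e1 := h 0 1
  simp only [one_mul, zero_mul, add_zero, zero_add] at e0 e1
  have hM : ∀ i j, frequencyMatrix a lam i j
      = !![-2 * leftPeriod c (fun _ => 1), 2 * rightPeriod c (fun _ => 1);
        -2 * leftPeriod c (fun s => s), 2 * rightPeriod c (fun s => s)] i j := by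
    have hj0 : (Fin.succ 0 : Fin (2 + 1)) = 1 := rfl
    have hj1 : (Fin.succ 1 : Fin (2 + 1)) = 2 := rfl
    intro i j
    fin_cases j <;> fin_cases i <;>
      simp [frequencyMatrix, hj0, hj1, hyperellipticK_one hc σ hσ, hyperellipticK_two hc σ hσ]
  have hM' : frequencyMatrix a lam = _ := Matrix.ext hM
  have hdet : IsUnit (frequencyMatrix a lam).det := by
    rw [hM', Matrix.det_fin_two_of, isUnit_iff_ne_zero]
    have := hc.det_pos
    intro h0
    linarith
  have hsol : (frequencyMatrix a lam).mulVec (frequencyOf c)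
      = fun i => -hyperellipticK a lam i 0 := by
    rw [hM']
    funext i
    rw [hyperellipticK_zero hc σ hσ]
    fin_cases i
    · simp [Matrix.mulVec, dotProduct, Fin.sum_univ_two]; linarith
    · simp [Matrix.mulVec, dotProduct, Fin.sum_univ_two]; linarith
  rw [frequencyMap, ← hsol, Matrix.mulVec_mulVec, Matrix.nonsing_inv_mul _ hdet, Matrix.one_mulVec]

end Genus2

section Genus1

variable {a : Fin (1 + 1) → ℝ} {lam : Fin 1 → ℝ} {c : Fin 3 → ℝ}

theorem frequencyMap_one_eq (h0 : 0 < c 0) (h01 : c 0 < c 1) (h12 : c 1 < c 2)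
    (σ : Equiv.Perm (Fin 3)) (hσ : Fin.append a lam ∘ σ = c) :
    frequencyMap a lam 0 = ellipticFrequency (c 0) (c 1) (c 2) := by
  have hmono : Monotone c := by
    refine Fin.monotone_iff_le_succ.2 fun i => ?_
    fin_cases i
    · exact h01.le
    · exact h12.le
  have hT : ∀ s, hyperellipticT a lam s = (c 0 - s) * (c 1 - s) * (c 2 - s) := fun s =>
    (hyperellipticT_eq (n := 1) σ hσ s).trans (Fin.prod_univ_three fun i => c i - s)
  have hK0 : hyperellipticK a lam 0 0 = ellipticLow (c 0) (c 1) (c 2) := by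
    have h1 : hyperellipticK a lam 0 0
        = ∫ s in (0 : ℝ)..(c 0), s ^ 0 / √(hyperellipticT a lam s) := by
      rw [hyperellipticK, branchPoint_eq (n := 1) σ hσ hmono]
      rfl
    rw [h1, ellipticLow, ← intervalIntegral_div_sqrt_eq_lowMeasure h0
      (continuousOn_ellipticLow h01 h12.le)]
    refine intervalIntegral.integral_congr fun s hs => ?_
    rw [uIcc_of_le h0.le] at hs
    simp only [hT]
    rw [mul_assoc, Real.sqrt_mul (sub_nonneg.2 hs.2), pow_zero, div_mul_eq_div_div_swap, one_div]
  have hK1 : hyperellipticK a lam 0 1 = ellipticHigh (c 0) (c 1) (c 2) := by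
    have h1 : hyperellipticK a lam 0 1
        = ∫ s in (c 1)..(c 2), s ^ 0 / √(hyperellipticT a lam s) := by
      rw [hyperellipticK, branchPoint_eq (n := 1) σ hσ hmono]
      rfl
    rw [h1, ellipticHigh, ← intervalIntegral_div_sqrt_eq_arcMeasure h12
      (continuousOn_ellipticHigh h01)]
    refine intervalIntegral.integral_congr fun s hs => ?_
    rw [uIcc_of_le h12.le] at hs
    have h3 : 0 ≤ (s - c 1) * (c 2 - s) := mul_nonneg (sub_nonneg.2 hs.1) (sub_nonneg.2 hs.2)
    simp only [hT]
    rw [show (c 0 - s) * (c 1 - s) * (c 2 - s) = (s - c 1) * (c 2 - s) * (s - c 0) by ring,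
      Real.sqrt_mul h3, pow_zero, div_mul_eq_div_div_swap, one_div]
  have hpos := ellipticHigh_pos h01 h12.le
  have hj : (Fin.succ 0 : Fin (1 + 1)) = 1 := rfl
  have hM : frequencyMatrix a lam = Matrix.of fun _ _ => -2 * ellipticHigh (c 0) (c 1) (c 2) := by
    ext i j
    fin_cases j; fin_cases i
    simp [frequencyMatrix, hj, hK1]
  have hdet : IsUnit (frequencyMatrix a lam).det := by
    rw [hM, Matrix.det_fin_one, isUnit_iff_ne_zero]
    simpa using hpos.ne'
  have hsol : (frequencyMatrix a lam).mulVec (fun _ => ellipticFrequency (c 0) (c 1) (c 2))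
      = fun i => -hyperellipticK a lam i 0 := by
    rw [hM]
    funext i
    fin_cases i
    simp [Matrix.mulVec, dotProduct, hK0, ellipticFrequency]
    field_simp
  rw [frequencyMap, ← hsol, Matrix.mulVec_mulVec, Matrix.nonsing_inv_mul _ hdet, Matrix.one_mulVec]

end Genus1

/-! ### Smoothness of integrals depending on parameters -/

/-- An integral over a compact interval of a function that is `C¹` jointly in the parameter and in
the integration variable is a `C¹` function of the parameter. -/
theorem contDiffAt_one_intervalIntegral {𝕜 : Type*} [RCLike 𝕜] {E : Type*} [NormedAddCommGroup E]
    [NormedSpace 𝕜 E] {x₀ : E} {a b : ℝ} {G : E × 𝕜 → 𝕜}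
    (h : ∀ t ∈ uIcc a b, ContDiffAt 𝕜 1 G (x₀, (t : 𝕜))) :
    ContDiffAt 𝕜 1 (fun x => ∫ t in a..b, G (x, (t : 𝕜))) x₀ := by
  have hι : Continuous fun p : E × ℝ => (p.1, (p.2 : 𝕜)) := by fun_prop
  set F' : E → ℝ → E →L[𝕜] 𝕜 := fun x t =>
    (fderiv 𝕜 G (x, (t : 𝕜))).comp (ContinuousLinearMap.inl 𝕜 E 𝕜) with hF'
  set S : Set (E × ℝ) := {p | ContDiffAt 𝕜 1 G (p.1, (p.2 : 𝕜))} with hS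
  have hSd : ∀ p ∈ S, ContDiffAt 𝕜 1 G (p.1, (p.2 : 𝕜)) := fun p hp => hp
  have hGc : ∀ p ∈ S, ContinuousAt (fun p : E × ℝ => G (p.1, (p.2 : 𝕜))) p := fun p hp =>
    ContinuousAt.comp (g := G) (f := fun p : E × ℝ => (p.1, (p.2 : 𝕜))) (hSd p hp).continuousAt
      hι.continuousAt
  have hF'c : ∀ p ∈ S, ContinuousAt (fun p : E × ℝ => F' p.1 p.2) p := fun p hp => by
    have h1 : ContinuousAt (fderiv 𝕜 G) (p.1, (p.2 : 𝕜)) :=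
      ((hSd p hp).fderiv_right (m := 0) (by norm_num)).continuousAt
    exact (ContinuousAt.comp (g := fderiv 𝕜 G) (f := fun p : E × ℝ => (p.1, (p.2 : 𝕜))) h1
      hι.continuousAt).clm_comp continuousAt_const
  have hmem : ∀ t ∈ uIcc a b, (x₀, t) ∈ S := h
  obtain ⟨C, hC⟩ : ∃ C, ∀ t ∈ uIcc a b, ‖F' x₀ t‖ ≤ C := by
    refine isCompact_uIcc.exists_bound_of_continuousOn fun t ht => ?_
    exact (ContinuousAt.comp (g := fun p : E × ℝ => F' p.1 p.2) (f := fun t : ℝ => (x₀, t))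
      (hF'c _ (hmem t ht)) (by fun_prop)).continuousWithinAt
  have hSev : ∀ p ∈ S, ∀ᶠ q in 𝓝 p, q ∈ S := fun p hp =>
    hι.continuousAt.eventually ((hSd p hp).eventually (by simp))
  -- B is open and contains {x₀} × [a, b], so the tube lemma gives a neighbourhood U of x₀ on which
  -- C + 1 dominates the derivative for all t simultaneously.
  set B : Set (E × ℝ) := {p | p ∈ S ∧ ‖F' p.1 p.2‖ < C + 1} with hB
  have hBo : IsOpen B := by
    refine isOpen_iff_eventually.2 fun p hp => ?_
    filter_upwards [hSev p hp.1, (hF'c p hp.1).norm.eventually_lt_const hp.2] with q h1 h2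
    exact ⟨h1, h2⟩
  obtain ⟨U, V, hU, -, hxU, hV, hUV⟩ := generalized_tube_lemma (isCompact_singleton (x := x₀))
    (isCompact_uIcc (a := a) (b := b)) hBo (by
      rintro ⟨x, t⟩ ⟨hx, ht⟩
      obtain rfl : x = x₀ := hx
      exact ⟨hmem t ht, (hC t ht).trans_lt (lt_add_one C)⟩)
  have hUB : ∀ x ∈ U, ∀ t ∈ uIcc a b, (x, t) ∈ B := fun x hx t ht => hUV ⟨hx, hV ht⟩
  have hGx : ∀ x ∈ U, ContinuousOn (fun t : ℝ => G (x, (t : 𝕜))) (uIcc a b) := fun x hx t ht =>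
    (ContinuousAt.comp (g := fun p : E × ℝ => G (p.1, (p.2 : 𝕜))) (f := fun t : ℝ => (x, t))
      (hGc _ (hUB x hx t ht).1) (by fun_prop)).continuousWithinAt
  have hFx : ∀ x ∈ U, ContinuousOn (fun t : ℝ => F' x t) (uIcc a b) := fun x hx t ht =>
    (ContinuousAt.comp (g := fun p : E × ℝ => F' p.1 p.2) (f := fun t : ℝ => (x, t))
      (hF'c _ (hUB x hx t ht).1) (by fun_prop)).continuousWithinAt
  have hsub : uIoc a b ⊆ uIcc a b := uIoc_subset_uIcc
  have hGm : ∀ x ∈ U, AEStronglyMeasurable (fun t : ℝ => G (x, (t : 𝕜)))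
      (volume.restrict (uIoc a b)) := fun x hx =>
    ((hGx x hx).mono hsub).aestronglyMeasurable measurableSet_uIoc
  have hFm : ∀ x ∈ U, AEStronglyMeasurable (F' x) (volume.restrict (uIoc a b)) := fun x hx =>
    ((hFx x hx).mono hsub).aestronglyMeasurable measurableSet_uIoc
  refine contDiffAt_one_iff.2 ⟨fun x => ∫ t in a..b, F' x t, U, hU.mem_nhds (hxU rfl), ?_, ?_⟩
  · intro x hx
    refine (intervalIntegral.continuousAt_of_dominated_interval (bound := fun _ => C + 1) ?_ ?_
      intervalIntegrable_const ?_).continuousWithinAt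
    · filter_upwards [hU.mem_nhds hx] with y hy using hFm y hy
    · filter_upwards [hU.mem_nhds hx] with y hy
      exact Eventually.of_forall fun t ht => (hUB y hy t (hsub ht)).2.le
    · exact Eventually.of_forall fun t ht => ContinuousAt.comp
        (g := fun p : E × ℝ => F' p.1 p.2) (f := fun y : E => (y, t))
        (hF'c _ (hUB x hx t (hsub ht)).1) (by fun_prop)
  · intro x hx
    refine intervalIntegral.hasFDerivAt_integral_of_dominated_of_fderiv_le (𝕜 := 𝕜)
      (bound := fun _ => C + 1)
      (hU.mem_nhds hx) ?_ (hGx x hx).intervalIntegrable (hFm x hx) ?_ intervalIntegrable_const ?_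
    · filter_upwards [hU.mem_nhds hx] with y hy using hGm y hy
    · exact Eventually.of_forall fun t ht y hy => (hUB y hy t (hsub ht)).2.le
    · refine Eventually.of_forall fun t ht y hy => ?_
      have h1 : HasFDerivAt G (fderiv 𝕜 G (y, (t : 𝕜))) (y, (t : 𝕜)) :=
        ((hSd _ (hUB y hy t (hsub ht)).1).differentiableAt (by simp)).hasFDerivAt
      exact h1.comp y (hasFDerivAt_prodMk_left y (t : 𝕜))

theorem contDiffAt_one_intervalIntegral_real {E : Type*} [NormedAddCommGroup E]
    [NormedSpace ℝ E] {x₀ : E} {a b : ℝ} {G : E → ℝ → ℝ}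
    (h : ∀ t ∈ uIcc a b, ContDiffAt ℝ 1 (fun p : E × ℝ => G p.1 p.2) (x₀, t)) :
    ContDiffAt ℝ 1 (fun x => ∫ t in a..b, G x t) x₀ :=
  contDiffAt_one_intervalIntegral (𝕜 := ℝ) (G := fun p : E × ℝ => G p.1 p.2) h

/-! ### Smoothness of the frequencies -/

theorem BranchOrdered.eventually {c : Fin 5 → ℝ} (hc : BranchOrdered c) :
    ∀ᶠ c' in 𝓝 c, BranchOrdered c' := by
  have h : ∀ i : Fin 5, Continuous fun c : Fin 5 → ℝ => c i := fun i => continuous_apply i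
  filter_upwards [(h 0).continuousAt.eventually_const_lt hc.pos,
    (h 0).continuousAt.eventually_lt (h 1).continuousAt hc.h01,
    (h 1).continuousAt.eventually_lt (h 2).continuousAt hc.h12,
    (h 2).continuousAt.eventually_lt (h 3).continuousAt hc.h23,
    (h 3).continuousAt.eventually_lt (h 4).continuousAt hc.h34] with c' h0 h1 h2 h3 h4
  exact ⟨h0, h1, h2, h3, h4⟩

theorem contDiff_apply_fst (i : Fin 5) :
    ContDiff ℝ 1 fun p : (Fin 5 → ℝ) × ℝ => p.1 i :=
  (contDiff_apply ℝ ℝ i).comp contDiff_fst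

theorem contDiff_arcPoint {E : Type*} [NormedAddCommGroup E] [NormedSpace ℝ E] {f g h : E → ℝ}
    (hf : ContDiff ℝ 1 f) (hg : ContDiff ℝ 1 g) (hh : ContDiff ℝ 1 h) :
    ContDiff ℝ 1 fun p => arcPoint (f p) (g p) (h p) := by
  unfold arcPoint
  exact hf.add ((hg.sub hf).mul (hh.sin.pow 2))

theorem sq_sub_mem {c u : ℝ} (hc : 0 ≤ c) (hu : u ∈ uIcc (0 : ℝ) 1) :
    c * (1 - u ^ 2) ∈ Icc 0 c := by
  rw [uIcc_of_le zero_le_one] at hu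
  have h1 : 0 ≤ 1 - u ^ 2 := by nlinarith [hu.1, hu.2]
  have h2 : 1 - u ^ 2 ≤ 1 := by nlinarith [hu.1, hu.2]
  exact ⟨mul_nonneg hc h1, mul_le_of_le_one_right hc h2⟩

namespace BranchOrdered

variable {c : Fin 5 → ℝ} (hc : BranchOrdered c) {f : ℝ → ℝ} (hf : ContDiff ℝ 1 f)
include hc hf

/-- After the substitution the interval of integration is fixed and the integrand is C¹ in the
branch points, with no endpoint singularity left. -/
theorem contDiffAt_lowPeriod : ContDiffAt ℝ 1 (fun c => lowPeriod c f) c := by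
  have key : ContDiffAt ℝ 1 (fun c' : Fin 5 → ℝ => 2 * √(c' 0) * ∫ u in (0 : ℝ)..1,
      f (c' 0 * (1 - u ^ 2)) * lowWeight c' (c' 0 * (1 - u ^ 2))) c := by
    refine ContDiffAt.mul (contDiffAt_const.mul
      ((contDiff_apply ℝ ℝ (0 : Fin 5)).contDiffAt.sqrt hc.pos.ne'))
      (contDiffAt_one_intervalIntegral_real fun u hu => ?_)
    have hs : ContDiff ℝ 1 fun p : (Fin 5 → ℝ) × ℝ => p.1 0 * (1 - p.2 ^ 2) :=
      (contDiff_apply_fst 0).mul (contDiff_const.sub (contDiff_snd.pow 2))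
    obtain ⟨h1, h2, h3, h4⟩ := hc.pos_low (sq_sub_mem hc.pos.le hu)
    refine (hf.comp hs).contDiffAt.mul (ContDiffAt.inv (ContDiffAt.mul ?_ ?_) ?_)
    · exact (((contDiff_apply_fst 1).sub hs).mul ((contDiff_apply_fst 2).sub hs)).contDiffAt.sqrt
        (mul_pos h1 h2).ne'
    · exact (((contDiff_apply_fst 3).sub hs).mul ((contDiff_apply_fst 4).sub hs)).contDiffAt.sqrt
        (mul_pos h3 h4).ne'
    · exact (mul_pos (Real.sqrt_pos.2 (mul_pos h1 h2)) (Real.sqrt_pos.2 (mul_pos h3 h4))).ne'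
  refine key.congr_of_eventuallyEq ?_
  filter_upwards [hc.eventually] with c' hc'
  exact integral_lowMeasure hc'.pos.le (hf.continuous.continuousOn.mul hc'.continuousOn_lowWeight)

theorem contDiffAt_leftPeriod : ContDiffAt ℝ 1 (fun c => leftPeriod c f) c := by
  have key : ContDiffAt ℝ 1 (fun c' : Fin 5 → ℝ => 2 * ∫ φ in (0 : ℝ)..(π / 2),
      f (arcPoint (c' 1) (c' 2) φ) * leftWeight c' (arcPoint (c' 1) (c' 2) φ)) c := by
    refine contDiffAt_const.mul (contDiffAt_one_intervalIntegral_real fun φ _ => ?_)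
    have hs : ContDiff ℝ 1 fun p : (Fin 5 → ℝ) × ℝ => arcPoint (p.1 1) (p.1 2) p.2 :=
      contDiff_arcPoint (contDiff_apply_fst 1) (contDiff_apply_fst 2) contDiff_snd
    obtain ⟨h1, h2, h3⟩ := hc.pos_left (arcPoint_mem hc.h12.le φ)
    refine (hf.comp hs).contDiffAt.mul (ContDiffAt.inv (ContDiffAt.mul ?_ ?_) ?_)
    · exact (hs.sub (contDiff_apply_fst 0)).contDiffAt.sqrt h1.ne'
    · exact (((contDiff_apply_fst 3).sub hs).mul ((contDiff_apply_fst 4).sub hs)).contDiffAt.sqrt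
        (mul_pos h2 h3).ne'
    · exact (mul_pos (Real.sqrt_pos.2 h1) (Real.sqrt_pos.2 (mul_pos h2 h3))).ne'
  refine key.congr_of_eventuallyEq ?_
  filter_upwards [hc.eventually] with c' hc'
  exact integral_arcMeasure hc'.h12.le (hf.continuous.continuousOn.mul hc'.continuousOn_leftWeight)

theorem contDiffAt_rightPeriod : ContDiffAt ℝ 1 (fun c => rightPeriod c f) c := by
  have key : ContDiffAt ℝ 1 (fun c' : Fin 5 → ℝ => 2 * ∫ φ in (0 : ℝ)..(π / 2),
      f (arcPoint (c' 3) (c' 4) φ) * rightWeight c' (arcPoint (c' 3) (c' 4) φ)) c := by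
    refine contDiffAt_const.mul (contDiffAt_one_intervalIntegral_real fun φ _ => ?_)
    have hs : ContDiff ℝ 1 fun p : (Fin 5 → ℝ) × ℝ => arcPoint (p.1 3) (p.1 4) p.2 :=
      contDiff_arcPoint (contDiff_apply_fst 3) (contDiff_apply_fst 4) contDiff_snd
    obtain ⟨h1, h2, h3⟩ := hc.pos_right (arcPoint_mem hc.h34.le φ)
    refine (hf.comp hs).contDiffAt.mul (ContDiffAt.inv (ContDiffAt.mul ?_ ?_) ?_)
    · exact (hs.sub (contDiff_apply_fst 0)).contDiffAt.sqrt h1.ne'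
    · exact ((hs.sub (contDiff_apply_fst 1)).mul (hs.sub (contDiff_apply_fst 2))).contDiffAt.sqrt
        (mul_pos h2 h3).ne'
    · exact (mul_pos (Real.sqrt_pos.2 h1) (Real.sqrt_pos.2 (mul_pos h2 h3))).ne'
  refine key.congr_of_eventuallyEq ?_
  filter_upwards [hc.eventually] with c' hc'
  exact integral_arcMeasure hc'.h34.le (hf.continuous.continuousOn.mul hc'.continuousOn_rightWeight)

omit hf in
theorem contDiffAt_frequencyOf : ContDiffAt ℝ 1 frequencyOf c := by
  have h1 : ContDiff ℝ 1 fun _ : ℝ => (1 : ℝ) := contDiff_const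
  have h2 : ContDiff ℝ 1 fun s : ℝ => s := contDiff_id
  have hdet : 2 * (rightPeriod c (fun s => s) * leftPeriod c (fun _ => 1)
      - leftPeriod c (fun s => s) * rightPeriod c (fun _ => 1)) ≠ 0 :=
    mul_ne_zero two_ne_zero hc.det_pos.ne'
  have hD := contDiffAt_const (c := (2 : ℝ)).mul
    (((hc.contDiffAt_rightPeriod h2).mul (hc.contDiffAt_leftPeriod h1)).sub
      ((hc.contDiffAt_leftPeriod h2).mul (hc.contDiffAt_rightPeriod h1)))
  refine contDiffAt_pi.2 fun i => ?_
  fin_cases i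
  · exact (((hc.contDiffAt_lowPeriod h1).mul (hc.contDiffAt_rightPeriod h2)).sub
      ((hc.contDiffAt_lowPeriod h2).mul (hc.contDiffAt_rightPeriod h1))).div hD hdet
  · exact (((hc.contDiffAt_lowPeriod h1).mul (hc.contDiffAt_leftPeriod h2)).sub
      ((hc.contDiffAt_lowPeriod h2).mul (hc.contDiffAt_leftPeriod h1))).div hD hdet

end BranchOrdered

/-! ### Monotonicity of the frequency of planar billiards -/

theorem mem_causticSpace_one {a : Fin (1 + 1) → ℝ} {t : ℝ} (h0 : 0 < t) (h1 : t ≠ a 0)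
    (h2 : t < a 1) : (fun _ => t) ∈ causticSpace a := by
  refine ⟨fun _ => h0, Subsingleton.strictMono _, fun i => ?_⟩
  fin_cases i
  rcases h1.lt_or_gt with h | h
  · exact Or.inl ⟨h0, h⟩
  · exact Or.inr ⟨h, h2⟩

theorem LocalDiffeoConjecture.exists_hasDerivAt (hconj : LocalDiffeoConjecture)
    {a : Fin (1 + 1) → ℝ} (ha : IsNondegenerate a) {t : ℝ} (h0 : 0 < t) (h1 : t ≠ a 0)
    (h2 : t < a 1) :
    ∃ d, d ≠ 0 ∧ HasDerivAt (fun t => frequencyMap a (fun _ => t) 0) d t := by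
  have h := hconj 1 le_rfl a ha _ (mem_causticSpace_one h0 h1 h2)
  set L := fderiv ℝ (frequencyMap a) (fun _ => t) with hL
  have hdet0 : (0 : (Fin 1 → ℝ) →L[ℝ] (Fin 1 → ℝ)).det = 0 := by
    simp [ContinuousLinearMap.det]
  -- Differentiability is a consequence of the conjecture here: at a point without derivative
  -- `fderiv` is zero by convention, and so is its determinant on a one-dimensional space.
  have hdiff : DifferentiableAt ℝ (frequencyMap a) (fun _ => t) := by
    by_contra hn
    rw [hL, fderiv_zero_of_not_differentiableAt hn] at h
    exact h hdet0
  have h3 : HasDerivAt (fun t : ℝ => (fun _ : Fin 1 => t)) (fun _ => 1) t :=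
    hasDerivAt_pi.2 fun _ => hasDerivAt_id t
  have h4 := hasDerivAt_pi.1 (hdiff.hasFDerivAt.comp_hasDerivAt t h3) 0
  refine ⟨_, fun hz => h ?_, h4⟩
  have hL0 : L = 0 := by
    ext v i
    have hv : v = v 0 • fun _ => (1 : ℝ) := by
      funext j
      simp [Subsingleton.elim j 0]
    rw [Subsingleton.elim i 0]
    conv_lhs => rw [hv]
    rw [map_smul, Pi.smul_apply, hz, smul_zero]
    rfl
  rw [hL0, hdet0]

/-! ### The planar frequency as a function of its first two branch points -/

section

variable {x y z : ℝ}

theorem isNondegenerate_pair (h0 : 0 < x) (h : x < y) : IsNondegenerate (n := 1) ![x, y] := by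
  refine ⟨h0, Fin.strictMono_iff_lt_succ.2 fun i => ?_⟩
  fin_cases i
  exact h

theorem frequencyMap_pair_low (h0 : 0 < x) (h1 : x < y) (h2 : y < z) :
    frequencyMap (n := 1) ![y, z] (fun _ => x) 0 = ellipticFrequency x y z := by
  refine frequencyMap_one_eq (c := ![x, y, z]) h0 h1 h2 ⟨![2, 0, 1], ![1, 2, 0], by decide,
    by decide⟩ ?_
  funext i
  fin_cases i <;> rfl

theorem frequencyMap_pair_mid (h0 : 0 < x) (h1 : x < y) (h2 : y < z) :
    frequencyMap (n := 1) ![x, z] (fun _ => y) 0 = ellipticFrequency x y z := by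
  refine frequencyMap_one_eq (c := ![x, y, z]) h0 h1 h2 ⟨![0, 2, 1], ![0, 2, 1], by decide,
    by decide⟩ ?_
  funext i
  fin_cases i <;> rfl

/-- Here x plays the role of an elliptic caustic, below the ellipse parameters y < z. -/
theorem LocalDiffeoConjecture.exists_hasDerivAt_fst (hconj : LocalDiffeoConjecture)
    (h0 : 0 < x) (h1 : x < y) (h2 : y < z) :
    ∃ d, d ≠ 0 ∧ HasDerivAt (fun x => ellipticFrequency x y z) d x := by
  obtain ⟨d, hd, h⟩ := hconj.exists_hasDerivAt (isNondegenerate_pair (h0.trans h1) h2) h0 h1.ne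
    (h1.trans h2)
  refine ⟨d, hd, h.congr_of_eventuallyEq ?_⟩
  filter_upwards [Ioo_mem_nhds h0 h1] with t ht
  exact (frequencyMap_pair_low ht.1 ht.2 h2).symm

/-- Here y is a hyperbolic caustic between the ellipse parameters x < z. The planar frequency
depends only on the sorted branch points, so the same conjecture controls both variables. -/
theorem LocalDiffeoConjecture.exists_hasDerivAt_snd (hconj : LocalDiffeoConjecture)
    (h0 : 0 < x) (h1 : x < y) (h2 : y < z) :
    ∃ d, d ≠ 0 ∧ HasDerivAt (fun y => ellipticFrequency x y z) d y := by
  obtain ⟨d, hd, h⟩ := hconj.exists_hasDerivAt (isNondegenerate_pair h0 (h1.trans h2))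
    (h0.trans h1) h1.ne' h2
  refine ⟨d, hd, h.congr_of_eventuallyEq ?_⟩
  filter_upwards [Ioo_mem_nhds h1 h2] with t ht
  exact (frequencyMap_pair_mid h0 ht.1 ht.2).symm

end

/-- Darboux: a derivative that never vanishes on an interval has constant sign, with no continuity
assumed. -/
theorem strictMonoOn_or_strictAntiOn_of_hasDerivAt_ne_zero {f : ℝ → ℝ} {a b : ℝ}
    (h : ∀ x ∈ Ioo a b, ∃ d, d ≠ 0 ∧ HasDerivAt f d x) :
    StrictMonoOn f (Ioo a b) ∨ StrictAntiOn f (Ioo a b) := by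
  have hd : ∀ x ∈ Ioo a b, HasDerivWithinAt f (deriv f x) (Ioo a b) x := fun x hx => by
    obtain ⟨d, -, hd⟩ := h x hx
    exact hd.differentiableAt.hasDerivAt.hasDerivWithinAt
  have hne : ∀ x ∈ Ioo a b, deriv f x ≠ 0 := fun x hx => by
    obtain ⟨d, h0, hd⟩ := h x hx
    rwa [hd.deriv]
  have hc : ContinuousOn f (Ioo a b) := fun x hx => (hd x hx).continuousWithinAt
  rcases hasDerivWithinAt_forall_lt_or_forall_gt_of_forall_ne (convex_Ioo a b) hd hne with h1 | h1
  · exact Or.inr (strictAntiOn_of_deriv_neg (convex_Ioo a b) hc (by rwa [interior_Ioo]))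
  · exact Or.inl (strictMonoOn_of_deriv_pos (convex_Ioo a b) hc (by rwa [interior_Ioo]))

theorem tendsto_log_one_add_inv_sqrt :
    Tendsto (fun x : ℝ => Real.log (1 + 1 / √x)) (𝓝[>] 0) atTop := by
  refine Real.tendsto_log_atTop.comp (tendsto_atTop_add_const_left _ _ ?_)
  simp only [one_div]
  refine tendsto_inv_nhdsGT_zero.comp (tendsto_nhdsWithin_iff.2 ⟨?_, ?_⟩)
  · exact (Real.continuous_sqrt.tendsto' 0 0 Real.sqrt_zero).mono_left nhdsWithin_le_nhds
  · filter_upwards [self_mem_nhdsWithin] with x hx using Real.sqrt_pos.2 hx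

/-- A bounded product with a factor `log (1 + 1 / √x)`, `x → 0`, forces the other factor to
vanish in the limit. -/
theorem tendsto_zero_of_mul_log_le {ι : Type*} {l : Filter ι} {f x B : ι → ℝ} {M : ℝ}
    (hx : Tendsto x l (𝓝[>] 0)) (hf : ∀ᶠ i in l, 0 ≤ f i) (hB : ∀ᶠ i in l, B i ≤ M)
    (h : ∀ᶠ i in l, f i * Real.log (1 + 1 / √(x i)) ≤ B i) : Tendsto f l (𝓝 0) := by
  have hlog : Tendsto (fun i => Real.log (1 + 1 / √(x i))) l atTop :=
    tendsto_log_one_add_inv_sqrt.comp hx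
  have hM : Tendsto (fun i => M / Real.log (1 + 1 / √(x i))) l (𝓝 0) := hlog.const_div_atTop M
  refine tendsto_of_tendsto_of_tendsto_of_le_of_le' tendsto_const_nhds hM hf ?_
  filter_upwards [h, hB, hlog.eventually_gt_atTop 0] with i h1 h2 h3
  exact (le_div_iff₀ h3).2 (h1.trans h2)

theorem tendsto_sub_nhdsGT_zero (a : ℝ) : Tendsto (fun x => a - x) (𝓝[<] a) (𝓝[>] 0) := by
  refine tendsto_nhdsWithin_iff.2 ⟨?_, ?_⟩
  · exact ((continuous_const.sub continuous_id).tendsto' a 0 (sub_self a)).mono_left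
      nhdsWithin_le_nhds
  · exact eventually_mem_nhdsWithin.mono fun x hx => sub_pos.2 (mem_Iio.1 hx)

theorem tendsto_sub_nhdsGT_zero' (a : ℝ) : Tendsto (fun x => x - a) (𝓝[>] a) (𝓝[>] 0) := by
  refine tendsto_nhdsWithin_iff.2 ⟨?_, ?_⟩
  · exact ((continuous_id.sub continuous_const).tendsto' a 0 (sub_self a)).mono_left
      nhdsWithin_le_nhds
  · exact eventually_mem_nhdsWithin.mono fun x hx => sub_pos.2 (mem_Ioi.1 hx)

/-! ### Limits and monotonicity of the planar frequency -/

section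

variable {x y : ℝ}

theorem tendsto_ellipticFrequency_zero (hy : 0 < y) (hy1 : y < 1) :
    Tendsto (fun x => ellipticFrequency x y 1) (𝓝[>] 0) (𝓝 0) := by
  have hang : Tendsto (fun x => angle x y) (𝓝[>] 0) (𝓝 0) := by
    have h : ContinuousAt (fun x => angle x y) 0 := by
      unfold angle
      have : ContinuousAt (fun x => x / (y - x)) 0 :=
        continuousAt_id.div (continuousAt_const.sub continuousAt_id) (by simpa using hy.ne')
      exact (Real.continuous_arctan.continuousAt.comp
        (Real.continuous_sqrt.continuousAt.comp this)).div_const π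
    have h0 : angle 0 y = 0 := by simp [angle]
    have := h.tendsto
    rw [h0] at this
    exact this.mono_left nhdsWithin_le_nhds
  refine tendsto_of_tendsto_of_tendsto_of_le_of_le' tendsto_const_nhds hang ?_ ?_
  · filter_upwards [Ioo_mem_nhdsGT hy] with x hx
    exact (ellipticFrequency_pos hx.1 hx.2 hy1.le).le
  · filter_upwards [Ioo_mem_nhdsGT hy] with x hx
    exact ellipticFrequency_le hx.1 hx.2 hy1.le

theorem tendsto_ellipticFrequency_fst (hy : 0 < y) (hy1 : y < 1) :
    Tendsto (fun x => ellipticFrequency x y 1) (𝓝[<] y) (𝓝 (1 / 2)) := by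
  have h1 : Tendsto (fun x => 1 / 2 - ellipticFrequency x y 1) (𝓝[<] y) (𝓝 0) := by
    -- The bound 1/√x / 2 is uniform once x > y / 2.
    refine tendsto_zero_of_mul_log_le (M := 1 / √(y / 2) / 2) (tendsto_sub_nhdsGT_zero y)
      (B := fun x => 1 / √x / 2) ?_ ?_ ?_
    · filter_upwards [Ioo_mem_nhdsLT hy] with x hx
      exact (sub_pos.2 (ellipticFrequency_lt_half hx.1 hx.2 hy1.le)).le
    · filter_upwards [Ioo_mem_nhdsLT (half_lt_self hy)] with x hx
      have := Real.sqrt_le_sqrt hx.1.le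
      have h2 := Real.sqrt_pos.2 (half_pos hy)
      gcongr
    · filter_upwards [Ioo_mem_nhdsLT hy] with x hx
      have := half_sub_ellipticFrequency_mul_log_le hx.1 hx.2 hy1.le (by linarith)
      linarith
  have h2 := h1.const_sub (1 / 2)
  rw [sub_zero] at h2
  exact h2.congr fun t => by ring

theorem tendsto_ellipticFrequency_snd (hx : 0 < x) (hx1 : x < 1) :
    Tendsto (fun y => ellipticFrequency x y 1) (𝓝[>] x) (𝓝 (1 / 2)) := by
  have h1 : Tendsto (fun y => 1 / 2 - ellipticFrequency x y 1) (𝓝[>] x) (𝓝 0) := by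
    refine tendsto_zero_of_mul_log_le (M := 1 / √x / 2) (tendsto_sub_nhdsGT_zero' x)
      (B := fun _ => 1 / √x / 2) ?_ (Eventually.of_forall fun _ => le_rfl) ?_
    · filter_upwards [Ioo_mem_nhdsGT hx1] with y hy
      exact (sub_pos.2 (ellipticFrequency_lt_half hx hy.1 hy.2.le)).le
    · filter_upwards [Ioo_mem_nhdsGT hx1] with y hy
      have := half_sub_ellipticFrequency_mul_log_le hx hy.1 hy.2.le (by linarith [hy.1])
      linarith
  have h2 := h1.const_sub (1 / 2)
  rw [sub_zero] at h2
  exact h2.congr fun t => by ring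

/-- The sign of the derivative is decided by the end x → 0, where the positive frequency tends to 0.
-/
theorem LocalDiffeoConjecture.strictMonoOn_ellipticFrequency (hconj : LocalDiffeoConjecture)
    (hy : 0 < y) (hy1 : y < 1) : StrictMonoOn (fun x => ellipticFrequency x y 1) (Ioo 0 y) := by
  refine (strictMonoOn_or_strictAntiOn_of_hasDerivAt_ne_zero fun x hx =>
    hconj.exists_hasDerivAt_fst hx.1 hx.2 hy1).resolve_right fun hanti => ?_
  have hm : y / 2 ∈ Ioo 0 y := ⟨half_pos hy, half_lt_self hy⟩
  have h1 := ellipticFrequency_pos hm.1 hm.2 hy1.le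
  obtain ⟨x, h2, h3⟩ := (((tendsto_ellipticFrequency_zero hy hy1).eventually_lt_const h1).and
    (Ioo_mem_nhdsGT hm.1)).exists
  exact lt_asymm h2 (hanti ⟨h3.1, h3.2.trans hm.2⟩ hm h3.2)

/-- The sign is decided by the end y → x, where the frequency tends to 1/2 from below. -/
theorem LocalDiffeoConjecture.strictAntiOn_ellipticFrequency (hconj : LocalDiffeoConjecture)
    (hx : 0 < x) (hx1 : x < 1) : StrictAntiOn (fun y => ellipticFrequency x y 1) (Ioo x 1) := by
  refine (strictMonoOn_or_strictAntiOn_of_hasDerivAt_ne_zero fun y hy =>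
    hconj.exists_hasDerivAt_snd hx hy.1 hy.2).resolve_left fun hmono => ?_
  obtain ⟨m, hm⟩ := exists_between hx1
  have h1 := ellipticFrequency_lt_half hx hm.1 hm.2.le
  obtain ⟨y, h2, h3⟩ := (((tendsto_ellipticFrequency_snd hx hx1).eventually_const_lt h1).and
    (Ioo_mem_nhdsGT hm.1)).exists
  exact lt_asymm h2 (hmono ⟨h3.1, h3.2.trans hm.2⟩ hm h3.2)

/-! ### The boundary curve of the region H1H1 -/

/-- The number `c ∈ (0, b)` such that the planar frequency with branch points `c, b, 1` is `r`. -/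
def regionBoundary (r b : ℝ) : ℝ :=
  Classical.epsilon fun c => c ∈ Ioo 0 b ∧ ellipticFrequency c b 1 = r

variable {r b : ℝ}

theorem LocalDiffeoConjecture.regionBoundary_spec (hconj : LocalDiffeoConjecture)
    (hr : r ∈ Ioo (0 : ℝ) (1 / 2)) (hb : b ∈ Ioo (0 : ℝ) 1) :
    regionBoundary r b ∈ Ioo 0 b ∧ ellipticFrequency (regionBoundary r b) b 1 = r := by
  have h : ∃ c ∈ Ioo 0 b, ellipticFrequency c b 1 = r := by
    obtain ⟨x, h2, h3⟩ := (((tendsto_ellipticFrequency_zero hb.1 hb.2).eventually_lt_const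
      hr.1).and (Ioo_mem_nhdsGT hb.1)).exists
    obtain ⟨y, h4, h5⟩ := (((tendsto_ellipticFrequency_fst hb.1 hb.2).eventually_const_lt
      hr.2).and (Ioo_mem_nhdsLT h3.2)).exists
    have hc : ContinuousOn (fun x => ellipticFrequency x b 1) (Icc x y) := fun t ht => by
      obtain ⟨d, -, hd⟩ := hconj.exists_hasDerivAt_fst (h3.1.trans_le ht.1)
        (ht.2.trans_lt h5.2) hb.2
      exact hd.continuousAt.continuousWithinAt
    obtain ⟨c, hc1, hc2⟩ := intermediate_value_Icc h5.1.le hc ⟨h2.le, h4.le⟩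
    exact ⟨c, ⟨h3.1.trans_le hc1.1, hc1.2.trans_lt h5.2⟩, hc2⟩
  exact Classical.epsilon_spec h

theorem LocalDiffeoConjecture.ellipticFrequency_lt_iff (hconj : LocalDiffeoConjecture)
    (hr : r ∈ Ioo (0 : ℝ) (1 / 2)) (hb : b ∈ Ioo (0 : ℝ) 1) {c : ℝ} (hc : c ∈ Ioo 0 b) :
    ellipticFrequency c b 1 < r ↔ c < regionBoundary r b := by
  obtain ⟨h1, h2⟩ := hconj.regionBoundary_spec hr hb
  have := (hconj.strictMonoOn_ellipticFrequency hb.1 hb.2).lt_iff_lt hc h1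
  simp only [h2] at this
  exact this

theorem LocalDiffeoConjecture.eq_regionBoundary (hconj : LocalDiffeoConjecture)
    (hr : r ∈ Ioo (0 : ℝ) (1 / 2)) (hb : b ∈ Ioo (0 : ℝ) 1) {c : ℝ} (hc : c ∈ Ioo 0 b)
    (h : ellipticFrequency c b 1 = r) : regionBoundary r b = c := by
  obtain ⟨h1, h2⟩ := hconj.regionBoundary_spec hr hb
  exact (hconj.strictMonoOn_ellipticFrequency hb.1 hb.2).injOn h1 hc (h2.trans h.symm)

theorem LocalDiffeoConjecture.strictMonoOn_regionBoundary (hconj : LocalDiffeoConjecture)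
    (hr : r ∈ Ioo (0 : ℝ) (1 / 2)) : StrictMonoOn (regionBoundary r) (Ioo 0 1) := by
  intro b₁ hb₁ b₂ hb₂ h
  obtain ⟨h1, h2⟩ := hconj.regionBoundary_spec hr hb₁
  refine (hconj.ellipticFrequency_lt_iff hr hb₂ ⟨h1.1, h1.2.trans h⟩).1 ?_
  have h3 := hconj.strictAntiOn_ellipticFrequency h1.1 (h1.2.trans hb₁.2) ⟨h1.2, hb₁.2⟩
    ⟨h1.2.trans h, hb₂.2⟩ h
  exact h3.trans_eq h2

/-- For c the boundary value, `angle c 1` ≤ r ≤ `angle c b`, and sin² (π · `angle c t`) = c/t. The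
two bounds pinch as b tends to 1. -/
theorem LocalDiffeoConjecture.regionBoundary_mem (hconj : LocalDiffeoConjecture)
    (hr : r ∈ Ioo (0 : ℝ) (1 / 2)) (hb : b ∈ Ioo (0 : ℝ) 1) :
    regionBoundary r b ∈ Icc (b * Real.sin (π * r) ^ 2) (Real.sin (π * r) ^ 2) := by
  obtain ⟨h1, h2⟩ := hconj.regionBoundary_spec hr hb
  set c := regionBoundary r b
  have hc1 : c < 1 := h1.2.trans hb.2
  have hle := ellipticFrequency_le h1.1 h1.2 hb.2.le
  have hge := le_ellipticFrequency h1.1 h1.2 hb.2.le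
  rw [h2] at hle hge
  have hmono : ∀ {s t : ℝ}, 0 ≤ s → s ≤ t → t ≤ 1 / 2 →
      Real.sin (π * s) ^ 2 ≤ Real.sin (π * t) ^ 2 := fun {s t} h0 hst ht => by
    have hπ := Real.pi_pos
    refine pow_le_pow_left₀ (Real.sin_nonneg_of_nonneg_of_le_pi (by positivity) ?_) ?_ 2
    · nlinarith
    · exact Real.sin_le_sin_of_le_of_le_pi_div_two (by nlinarith) (by nlinarith) (by nlinarith)
  have e1 := hmono (angle_pos h1.1 hc1).le hge hr.2.le
  have e2 := hmono hr.1.le hle (angle_lt_half h1.1 h1.2).le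
  rw [sin_sq_pi_mul_angle h1.1 hc1] at e1
  rw [sin_sq_pi_mul_angle h1.1 h1.2, le_div_iff₀ hb.1] at e2
  exact ⟨by linarith, by simpa using e1⟩

theorem LocalDiffeoConjecture.tendsto_regionBoundary (hconj : LocalDiffeoConjecture)
    (hr : r ∈ Ioo (0 : ℝ) (1 / 2)) :
    Tendsto (regionBoundary r) (𝓝[<] 1) (𝓝 (Real.sin (π * r) ^ 2)) := by
  have h : Tendsto (fun b : ℝ => b * Real.sin (π * r) ^ 2) (𝓝[<] 1)
      (𝓝 (Real.sin (π * r) ^ 2)) :=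
    ((continuous_mul_const _).tendsto' 1 _ (one_mul _)).mono_left nhdsWithin_le_nhds
  refine tendsto_of_tendsto_of_tendsto_of_le_of_le' h tendsto_const_nhds ?_ ?_
  · filter_upwards [Ioo_mem_nhdsLT zero_lt_one] with b hb
    exact (hconj.regionBoundary_mem hr hb).1
  · filter_upwards [Ioo_mem_nhdsLT zero_lt_one] with b hb
    exact (hconj.regionBoundary_mem hr hb).2

end

/-! ### Degenerations of the branch points -/

section Degeneration

variable {ι : Type*} {l : Filter ι} [l.NeBot] {c : ι → Fin 5 → ℝ} {w : ι → Fin 2 → ℝ}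
  {c' : Fin 5 → ℝ} {w' : Fin 2 → ℝ} (hc : ∀ i, BranchOrdered (c i))
  (hw : ∀ i, IsFrequency (c i) (w i)) (h4 : ∀ i, c i 4 ≤ 1) (hc' : ∀ j, Tendsto (c · j) l (𝓝 (c' j)))
  (hw' : ∀ j, Tendsto (w · j) l (𝓝 (w' j)))
include hc hw hw' h4 hc'

omit hw h4 hw' [l.NeBot] in
theorem tendsto_sub_nhdsGT (j k : Fin 5) (hjk : ∀ {d : Fin 5 → ℝ}, BranchOrdered d → d j < d k)
    (h : c' j = c' k) : Tendsto (fun i => c i k - c i j) l (𝓝[>] 0) :=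
  tendsto_nhdsWithin_iff.2 ⟨by simpa [h] using (hc' k).sub (hc' j),
    Eventually.of_forall fun i => sub_pos.2 (hjk (hc i))⟩

theorem frequency_zero_eq_one_of_tendsto (h03 : c' 0 < c' 3) (h23 : c' 2 = c' 3) :
    w' 0 = w' 1 := by
  have hB : Tendsto (fun i => π / √(c i 3 - c i 0) / 4) l (𝓝 (π / √(c' 3 - c' 0) / 4)) :=
    (tendsto_const_nhds.div ((hc' 3).sub (hc' 0)).sqrt
      (Real.sqrt_pos.2 (sub_pos.2 h03)).ne').div_const 4
  have h := tendsto_zero_of_mul_log_le (f := fun i => w i 0 - w i 1)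
    (tendsto_sub_nhdsGT hc hc' 2 3 (fun h => h.h23) h23)
    (Eventually.of_forall fun i => (sub_pos.2 ((hc i).frequency_one_lt_zero (hw i))).le)
    ((hB.eventually_lt_const (lt_add_one _)).mono fun _ h => h.le)
    (Eventually.of_forall fun i => by linarith [(hc i).frequency_sub_le (hw i) (h4 i)])
  exact sub_eq_zero.1 (tendsto_nhds_unique ((hw' 0).sub (hw' 1)) h)

theorem frequency_zero_eq_half_of_tendsto (h0 : 0 < c' 0) (h13 : c' 1 < c' 3) (h01 : c' 0 = c' 1) :
    w' 0 = 1 / 2 := by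
  have hs3 := Real.sqrt_pos.2 (sub_pos.2 (h01.trans_lt h13))
  have hB : Tendsto (fun i => 1 / √(c i 0) + π / (2 * √(c i 3 - c i 0))) l
      (𝓝 (1 / √(c' 0) + π / (2 * √(c' 3 - c' 0)))) :=
    (tendsto_const_nhds.div (hc' 0).sqrt (Real.sqrt_pos.2 h0).ne').add
      (tendsto_const_nhds.div (((hc' 3).sub (hc' 0)).sqrt.const_mul 2) (by positivity))
  have h := tendsto_zero_of_mul_log_le (f := fun i => (1 / 2 - w i 0) * (2 * √(c i 3 - c i 1)))
    (tendsto_sub_nhdsGT hc hc' 0 1 (fun h => h.h01) h01)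
    (Eventually.of_forall fun i => mul_nonneg
      (sub_pos.2 ((hc i).frequency_zero_lt (hw i))).le (by positivity))
    ((hB.eventually_lt_const (lt_add_one _)).mono fun _ h => h.le)
    (Eventually.of_forall fun i => by
      rw [mul_assoc]; exact (hc i).half_sub_frequency_le (hw i) (h4 i))
  have h2 := tendsto_nhds_unique (((hw' 0).const_sub (1 / 2)).mul
    (((hc' 3).sub (hc' 1)).sqrt.const_mul 2)) h
  have hs := Real.sqrt_pos.2 (sub_pos.2 h13)
  rcases mul_eq_zero.1 h2 with h3 | h3
  · linarith
  · linarith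

theorem frequency_zero_nonpos_of_tendsto (h0 : c' 0 = 0) (h1 : 0 < c' 1) (h13 : c' 1 < c' 3) :
    w' 0 ≤ 0 := by
  have hd : 0 < c' 1 - c' 0 := by rw [h0, sub_zero]; exact h1
  have hs := Real.sqrt_pos.2 hd
  have hlog : 0 < Real.log (1 + 1 / √(c' 1 - c' 0)) :=
    Real.log_pos (lt_add_of_pos_right _ (by positivity))
  have hL : Tendsto (fun i => w i 0 * (2 * √(c i 3 - c i 1) * Real.log (1 + 1 / √(c i 1 - c i 0))))
      l (𝓝 (w' 0 * (2 * √(c' 3 - c' 1) * Real.log (1 + 1 / √(c' 1 - c' 0))))) := by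
    refine (hw' 0).mul ((((hc' 3).sub (hc' 1)).sqrt.const_mul 2).mul (Tendsto.log ?_ ?_))
    · exact tendsto_const_nhds.add (tendsto_const_nhds.div ((hc' 1).sub (hc' 0)).sqrt hs.ne')
    · positivity
  have hR : Tendsto (fun i => √(c i 0) / (c i 1 - c i 0)) l (𝓝 (√(c' 0) / (c' 1 - c' 0))) :=
    (hc' 0).sqrt.div ((hc' 1).sub (hc' 0)) hd.ne'
  have h := le_of_tendsto_of_tendsto' hL hR fun i => (hc i).frequency_zero_le (hw i) (h4 i)
  rw [show √(c' 0) / (c' 1 - c' 0) = 0 by rw [h0, Real.sqrt_zero, zero_div]] at h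
  have h2 := mul_pos (mul_pos two_pos (Real.sqrt_pos.2 (sub_pos.2 h13))) hlog
  exact nonpos_of_mul_nonpos_left h h2

/-- The planar frequency is bounded along the family by a constant rather than passed to the limit,
so no joint continuity in c₀, c₃, c₄ is needed. -/
theorem frequency_one_le_of_tendsto (h01 : c' 0 < c' 1) (h23 : c' 2 < c' 3) (h12 : c' 1 = c' 2)
    {M : ℝ} (hM : ∀ i, ellipticFrequency (c i 0) (c i 3) (c i 4) ≤ M) : w' 1 ≤ M := by
  have hne : 2 * (√(c' 1 - c' 0) * (c' 3 - c' 2)) ≠ 0 := by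
    have := mul_pos (Real.sqrt_pos.2 (sub_pos.2 h01)) (sub_pos.2 h23)
    positivity
  have hR : Tendsto (fun i => M + (c i 2 - c i 1) / (2 * (√(c i 1 - c i 0) * (c i 3 - c i 2)))) l
      (𝓝 (M + (c' 2 - c' 1) / (2 * (√(c' 1 - c' 0) * (c' 3 - c' 2))))) :=
    tendsto_const_nhds.add (((hc' 2).sub (hc' 1)).div
      ((((hc' 1).sub (hc' 0)).sqrt.mul ((hc' 3).sub (hc' 2))).const_mul 2) hne)
  have h := le_of_tendsto_of_tendsto' (hw' 1) hR fun i =>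
    ((hc i).frequency_one_le (hw i) (h4 i)).trans (add_le_add_left (hM i) _)
  simpa [h12] using h

omit h4 in
theorem le_frequency_one_of_tendsto (h01 : c' 0 < c' 1) (h23 : c' 2 < c' 3) (h12 : c' 1 = c' 2)
    {M : ℝ} (hM : ∀ i, M ≤ ellipticFrequency (c i 0) (c i 3) (c i 4)) : M ≤ w' 1 := by
  have h20 : 0 < c' 2 - c' 0 := by linarith
  have h31 : 0 < c' 3 - c' 1 := by linarith
  have hR : Tendsto (fun i => M * (√((c i 1 - c i 0) / (c i 2 - c i 0))
      * √((c i 3 - c i 2) / (c i 3 - c i 1)))) l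
      (𝓝 (M * (√((c' 1 - c' 0) / (c' 2 - c' 0)) * √((c' 3 - c' 2) / (c' 3 - c' 1))))) :=
    ((((hc' 1).sub (hc' 0)).div ((hc' 2).sub (hc' 0)) h20.ne').sqrt.mul
      (((hc' 3).sub (hc' 2)).div ((hc' 3).sub (hc' 1)) h31.ne').sqrt).const_mul M
  have h := le_of_tendsto_of_tendsto' hR (hw' 1) fun i =>
    (mul_le_mul_of_nonneg_right (hM i) (by positivity)).trans ((hc i).le_frequency_one (hw i))
  rw [h12] at h31 h
  rwa [div_self h20.ne', div_self h31.ne', Real.sqrt_one, mul_one, mul_one] at h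

end Degeneration

/-! ### The branch points for the types EH1 and H1H1 -/

def branchEH1 (p : ℝ × ℝ) (lam : Fin 2 → ℝ) : Fin 5 → ℝ := ![lam 0, p.2, lam 1, p.1, 1]

def branchH1H1 (p : ℝ × ℝ) (lam : Fin 2 → ℝ) : Fin 5 → ℝ := ![p.2, lam 0, lam 1, p.1, 1]

section

variable {p : ℝ × ℝ} (hp : p ∈ paramSpace) {lam : Fin 2 → ℝ}
include hp

theorem branchOrdered_EH1 (hl : lam ∈ typeEH1 p) : BranchOrdered (branchEH1 p lam) :=
  ⟨hl.1.1, hl.1.2, hl.2.1, hl.2.2, hp.2.2⟩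

theorem branchOrdered_H1H1 (hl : lam ∈ typeH1H1 p) : BranchOrdered (branchH1H1 p lam) :=
  ⟨hp.1, hl.1.1, hl.2.2, hl.2.1.2, hp.2.2⟩

theorem frequencyMap_EH1 (hl : lam ∈ typeEH1 p) :
    frequencyMap (triaxial p) lam = frequencyOf (branchEH1 p lam) := by
  refine frequencyMap_eq (branchOrdered_EH1 hp hl) ⟨![3, 0, 4, 1, 2], ![1, 3, 4, 0, 2], by decide,
    by decide⟩ ?_
  funext i
  fin_cases i <;> rfl

theorem frequencyMap_H1H1 (hl : lam ∈ typeH1H1 p) :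
    frequencyMap (triaxial p) lam = frequencyOf (branchH1H1 p lam) := by
  refine frequencyMap_eq (branchOrdered_H1H1 hp hl) ⟨![0, 3, 4, 1, 2], ![0, 3, 4, 1, 2], by decide,
    by decide⟩ ?_
  funext i
  fin_cases i <;> rfl

theorem isNondegenerate_triaxial : IsNondegenerate (n := 2) (triaxial p) := by
  refine ⟨hp.1, Fin.strictMono_iff_lt_succ.2 fun i => ?_⟩
  fin_cases i
  · exact hp.2.1
  · exact hp.2.2

theorem typeEH1_subset : typeEH1 p ⊆ causticSpace (n := 2) (triaxial p) := by
  intro lam hl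
  refine ⟨fun i => ?_, Fin.strictMono_iff_lt_succ.2 fun i => ?_, fun i => ?_⟩ <;> fin_cases i
  · exact hl.1.1
  · exact hp.1.trans hl.2.1
  · exact hl.1.2.trans hl.2.1
  · exact Or.inl hl.1
  · exact Or.inl hl.2

theorem typeH1H1_subset : typeH1H1 p ⊆ causticSpace (n := 2) (triaxial p) := by
  intro lam hl
  refine ⟨fun i => ?_, Fin.strictMono_iff_lt_succ.2 fun i => ?_, fun i => ?_⟩ <;> fin_cases i
  · exact hp.1.trans hl.1.1
  · exact hp.1.trans hl.2.1.1
  · exact hl.2.2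
  · exact Or.inr hl.1
  · exact Or.inl hl.2.1

end

theorem isOpen_typeEH1 (p : ℝ × ℝ) : IsOpen (typeEH1 p) :=
  (isOpen_Ioo.preimage (continuous_apply 0)).inter (isOpen_Ioo.preimage (continuous_apply 1))

theorem isOpen_typeH1H1 (p : ℝ × ℝ) : IsOpen (typeH1H1 p) :=
  (isOpen_Ioo.preimage (continuous_apply 0)).inter
    ((isOpen_Ioo.preimage (continuous_apply 1)).inter
      (isOpen_lt (continuous_apply 0) (continuous_apply 1)))

theorem contDiff_branchEH1 (p : ℝ × ℝ) : ContDiff ℝ 1 (branchEH1 p) := by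
  refine contDiff_pi.2 fun i => ?_
  fin_cases i
  · exact contDiff_apply ℝ ℝ 0
  · exact contDiff_const
  · exact contDiff_apply ℝ ℝ 1
  · exact contDiff_const
  · exact contDiff_const

theorem contDiff_branchH1H1 (p : ℝ × ℝ) : ContDiff ℝ 1 (branchH1H1 p) := by
  refine contDiff_pi.2 fun i => ?_
  fin_cases i
  · exact contDiff_const
  · exact contDiff_apply ℝ ℝ 0
  · exact contDiff_apply ℝ ℝ 1
  · exact contDiff_const
  · exact contDiff_const

/-! ### Openness of images and their limit points -/

section Image

variable {a : Fin (2 + 1) → ℝ} {D : Set (Fin 2 → ℝ)} {br : (Fin 2 → ℝ) → Fin 5 → ℝ}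
  (hbr : ContDiff ℝ 1 br) (hD : IsOpen D) (hord : ∀ lam ∈ D, BranchOrdered (br lam))
  (heq : ∀ lam ∈ D, frequencyMap a lam = frequencyOf (br lam))
include hbr hD hord heq

theorem contDiffAt_frequencyMap {lam : Fin 2 → ℝ} (hl : lam ∈ D) :
    ContDiffAt ℝ 1 (frequencyMap a) lam := by
  refine ContDiffAt.congr_of_eventuallyEq
    ((hord lam hl).contDiffAt_frequencyOf.comp lam hbr.contDiffAt) ?_
  filter_upwards [hD.mem_nhds hl] with x hx using heq x hx

/-- A nonzero determinant makes the derivative surjective; with strict differentiability, known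
because the periods are C¹, the map is locally open. -/
theorem LocalDiffeoConjecture.isOpen_image (hconj : LocalDiffeoConjecture) (ha : IsNondegenerate a)
    (hsub : D ⊆ causticSpace a) : IsOpen (frequencyMap a '' D) := by
  refine isOpen_iff_mem_nhds.2 ?_
  rintro _ ⟨lam, hl, rfl⟩
  have h1 : HasStrictFDerivAt (frequencyMap a) (fderiv ℝ (frequencyMap a) lam) lam :=
    (contDiffAt_frequencyMap hbr hD hord heq hl).hasStrictFDerivAt one_ne_zero
  have h2 := hconj 2 one_le_two a ha lam (hsub hl)
  have h3 : (fderiv ℝ (frequencyMap a) lam).range = ⊤ :=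
    LinearMap.range_eq_top.2
      (LinearMap.equivOfDetNeZero (fderiv ℝ (frequencyMap a) lam : (Fin 2 → ℝ) →ₗ[ℝ] (Fin 2 → ℝ))
        h2).surjective
  rw [← h1.map_nhds_eq_of_surj h3]
  exact image_mem_map (hD.mem_nhds hl)

theorem mem_image_of_tendsto {u : ℕ → Fin 2 → ℝ} {lam w : Fin 2 → ℝ} (hl : lam ∈ D)
    (hu : Tendsto u atTop (𝓝 lam)) (hf : Tendsto (fun k => frequencyMap a (u k)) atTop (𝓝 w)) :
    w ∈ frequencyMap a '' D :=
  ⟨lam, hl, tendsto_nhds_unique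
    ((contDiffAt_frequencyMap hbr hD hord heq hl).continuousAt.tendsto.comp hu) hf⟩

end Image

/-- A limit of frequencies comes from caustic parameters that converge in the closed component,
after passing to a subsequence. It then remains to exclude boundary limits. -/
theorem exists_seq_of_mem_closure_image {D K : Set (Fin 2 → ℝ)} {f : (Fin 2 → ℝ) → Fin 2 → ℝ}
    (hK : IsCompact K) (hDK : D ⊆ K) {w : Fin 2 → ℝ} (hw : w ∈ closure (f '' D)) :
    ∃ u : ℕ → Fin 2 → ℝ, (∀ k, u k ∈ D) ∧ Tendsto (fun k => f (u k)) atTop (𝓝 w) ∧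
      ∃ lam ∈ K, Tendsto u atTop (𝓝 lam) := by
  obtain ⟨x, hx, hxw⟩ := mem_closure_iff_seq_limit.1 hw
  choose u hu hux using hx
  obtain ⟨lam, hlam, φ, hφ, hφl⟩ := hK.tendsto_subseq fun k => hDK (hu k)
  refine ⟨u ∘ φ, fun k => hu _, ?_, lam, hlam, hφl⟩
  refine (hxw.comp hφ.tendsto_atTop).congr fun k => ?_
  exact (hux (φ k)).symm

/-- The part of the frequency space between the levels `r` and `s` of the second frequency. -/
def frequencyStrip (r s : ℝ) : Set (Fin 2 → ℝ) :=
  {w | (r < w 1 ∧ w 1 < s) ∧ w 1 < w 0 ∧ w 0 < 1 / 2}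

theorem isPreconnected_frequencyStrip (r s : ℝ) : IsPreconnected (frequencyStrip r s) := by
  refine Convex.isPreconnected ?_
  have h1 := convex_halfSpace_gt (LinearMap.proj (R := ℝ) (φ := fun _ : Fin 2 => ℝ) 1).isLinear r
  have h2 := convex_halfSpace_lt (LinearMap.proj (R := ℝ) (φ := fun _ : Fin 2 => ℝ) 1).isLinear s
  have h3 := convex_halfSpace_lt (LinearMap.proj (R := ℝ) (φ := fun _ : Fin 2 => ℝ) 1
    - LinearMap.proj 0).isLinear 0
  have h4 := convex_halfSpace_lt (LinearMap.proj (R := ℝ) (φ := fun _ : Fin 2 => ℝ) 0).isLinear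
    (1 / 2)
  have h3' : Convex ℝ {w : Fin 2 → ℝ | w 1 < w 0} := by
    refine (congrArg (Convex ℝ) (Set.ext fun w => ?_)).mp h3
    exact sub_neg (a := w 1) (b := w 0)
  exact (h1.inter h2).inter (h3'.inter h4)

/-! ### Ranges of the frequency map on the components EH1 and H1H1 -/

section Types

variable {p : ℝ × ℝ} (hp : p ∈ paramSpace)
include hp

theorem isFrequency_EH1 {lam : Fin 2 → ℝ} (hl : lam ∈ typeEH1 p) :
    IsFrequency (branchEH1 p lam) (frequencyMap (triaxial p) lam) := by
  rw [frequencyMap_EH1 hp hl]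
  exact (branchOrdered_EH1 hp hl).isFrequency_frequencyOf

theorem isFrequency_H1H1 {lam : Fin 2 → ℝ} (hl : lam ∈ typeH1H1 p) :
    IsFrequency (branchH1H1 p lam) (frequencyMap (triaxial p) lam) := by
  rw [frequencyMap_H1H1 hp hl]
  exact (branchOrdered_H1H1 hp hl).isFrequency_frequencyOf

/-- The boundary limits λ₂ = b, λ₁ = c and λ₁ = λ₂ would force ω₁ = ω₂, ω₁ = 1/2 and ω₂ = ρ(c, b)
respectively. The corners are covered, since the first two degenerations allow λ₁ = λ₂. -/
theorem mem_image_typeH1H1_of_mem_closure {w : Fin 2 → ℝ}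
    (hw : w ∈ closure (frequencyMap (triaxial p) '' typeH1H1 p)) (h10 : w 1 < w 0)
    (h0 : w 0 < 1 / 2) (hne : w 1 ≠ ellipticFrequency p.2 p.1 1) :
    w ∈ frequencyMap (triaxial p) '' typeH1H1 p := by
  obtain ⟨u, hu, hf, lam, hlam, hul⟩ := exists_seq_of_mem_closure_image
    (K := Icc (fun _ => p.2) (fun _ => p.1) ∩ {x | x 0 ≤ x 1})
    (isCompact_Icc.inter_right (isClosed_le (continuous_apply 0) (continuous_apply 1)))
    (fun x hx => ⟨⟨Fin.forall_fin_two.2 ⟨hx.1.1.le, hx.2.1.1.le⟩,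
      Fin.forall_fin_two.2 ⟨hx.1.2.le, hx.2.1.2.le⟩⟩, hx.2.2.le⟩) hw
  have hc := fun k => branchOrdered_H1H1 hp (hu k)
  have hF := fun k => isFrequency_H1H1 hp (hu k)
  have h4 : ∀ k, branchH1H1 p (u k) 4 ≤ 1 := fun k => le_rfl
  have hc' : ∀ j, Tendsto (fun k => branchH1H1 p (u k) j) atTop (𝓝 (branchH1H1 p lam j)) :=
    fun j => ((continuous_apply j).comp (contDiff_branchH1H1 p).continuous).continuousAt.tendsto.comp
      hul
  have hw' := fun j => ((continuous_apply j).tendsto w).comp hf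
  have e1 : p.2 ≤ lam 0 := hlam.1.1 0
  have e2 : lam 1 ≤ p.1 := hlam.1.2 1
  have e3 : lam 0 ≤ lam 1 := hlam.2
  rcases e2.lt_or_eq with h2 | h2
  swap
  · exact absurd (frequency_zero_eq_one_of_tendsto hc hF h4 hc' hw' hp.2.1 h2) h10.ne'
  rcases e1.lt_or_eq with h1 | h1
  swap
  · exact absurd (frequency_zero_eq_half_of_tendsto hc hF h4 hc' hw' hp.1 (e3.trans_lt h2) h1) h0.ne
  rcases e3.lt_or_eq with h3 | h3
  · exact mem_image_of_tendsto (contDiff_branchH1H1 p) (isOpen_typeH1H1 p)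
      (fun _ => branchOrdered_H1H1 hp) (fun _ => frequencyMap_H1H1 hp)
      ⟨⟨h1, e3.trans_lt h2⟩, ⟨h1.trans_le e3, h2⟩, h3⟩ hul hf
  · exact absurd (le_antisymm
      (frequency_one_le_of_tendsto hc hF h4 hc' hw' h1 h2 h3 fun _ => le_rfl)
      (le_frequency_one_of_tendsto hc hF hc' hw' h1 h2 h3 fun _ => le_rfl)) hne

/-- The boundary limits λ₂ = b, λ₁ = 0, λ₁ = c and λ₂ = c would force ω₁ = ω₂, ω₁ ≤ 0, ω₁ = 1/2 and
ω₂ ≤ ρ(c, b) respectively. -/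
theorem LocalDiffeoConjecture.mem_image_typeEH1_of_mem_closure (hconj : LocalDiffeoConjecture)
    {w : Fin 2 → ℝ} (hw : w ∈ closure (frequencyMap (triaxial p) '' typeEH1 p)) (h10 : w 1 < w 0)
    (h0 : w 0 < 1 / 2) (h1 : ellipticFrequency p.2 p.1 1 < w 1) :
    w ∈ frequencyMap (triaxial p) '' typeEH1 p := by
  obtain ⟨u, hu, hf, lam, hlam, hul⟩ := exists_seq_of_mem_closure_image
    (K := Icc ![0, p.2] ![p.2, p.1]) isCompact_Icc
    (fun x hx => ⟨Fin.forall_fin_two.2 ⟨hx.1.1.le, hx.2.1.le⟩,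
      Fin.forall_fin_two.2 ⟨hx.1.2.le, hx.2.2.le⟩⟩) hw
  have hc := fun k => branchOrdered_EH1 hp (hu k)
  have hF := fun k => isFrequency_EH1 hp (hu k)
  have h4 : ∀ k, branchEH1 p (u k) 4 ≤ 1 := fun k => le_rfl
  have hc' : ∀ j, Tendsto (fun k => branchEH1 p (u k) j) atTop (𝓝 (branchEH1 p lam j)) :=
    fun j => ((continuous_apply j).comp (contDiff_branchEH1 p).continuous).continuousAt.tendsto.comp
      hul
  have hw' := fun j => ((continuous_apply j).tendsto w).comp hf
  have e0 : 0 ≤ lam 0 := hlam.1 0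
  have e1 : lam 0 ≤ p.2 := hlam.2 0
  have e2 : p.2 ≤ lam 1 := hlam.1 1
  have e3 : lam 1 ≤ p.1 := hlam.2 1
  have hρ := ellipticFrequency_pos hp.1 hp.2.1 hp.2.2.le
  rcases e3.lt_or_eq with h3 | h3
  swap
  · exact absurd (frequency_zero_eq_one_of_tendsto hc hF h4 hc' hw' (e1.trans_lt hp.2.1) h3)
      h10.ne'
  rcases e0.lt_or_eq with h4' | h4'
  swap
  · exact absurd (frequency_zero_nonpos_of_tendsto hc hF h4 hc' hw' h4'.symm hp.1 hp.2.1)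
      (hρ.trans (h1.trans h10)).not_ge
  rcases e1.lt_or_eq with h5 | h5
  swap
  · exact absurd (frequency_zero_eq_half_of_tendsto hc hF h4 hc' hw' h4' hp.2.1 h5) h0.ne
  rcases e2.lt_or_eq with h6 | h6
  · exact mem_image_of_tendsto (contDiff_branchEH1 p) (isOpen_typeEH1 p)
      (fun _ => branchOrdered_EH1 hp) (fun _ => frequencyMap_EH1 hp)
      ⟨⟨h4', h5⟩, h6, h3⟩ hul hf
  -- The remaining genus one branch points are λ₁, b, 1, and λ₁ < c, so monotonicity in the first
  -- branch point bounds the planar frequency by ρ(c, b).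
  · refine absurd (frequency_one_le_of_tendsto hc hF h4 hc' hw' h5 h3 h6 fun k => ?_) h1.not_ge
    exact ((hconj.strictMonoOn_ellipticFrequency (hp.1.trans hp.2.1) hp.2.2).le_iff_le
      ⟨(hu k).1.1, (hu k).1.2.trans hp.2.1⟩ ⟨hp.1, hp.2.1⟩).2 (hu k).1.2.le

theorem typeH1H1_nonempty : (typeH1H1 p).Nonempty := by
  obtain ⟨x, hx⟩ := exists_between hp.2.1
  obtain ⟨y, hy⟩ := exists_between hx.2
  exact ⟨![x, y], hx, ⟨hx.1.trans hy.1, hy.2⟩, hy.1⟩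

theorem LocalDiffeoConjecture.isOpen_image_typeH1H1 (hconj : LocalDiffeoConjecture) :
    IsOpen (frequencyMap (triaxial p) '' typeH1H1 p) :=
  hconj.isOpen_image (contDiff_branchH1H1 p) (isOpen_typeH1H1 p)
    (fun _ => branchOrdered_H1H1 hp) (fun _ => frequencyMap_H1H1 hp) (isNondegenerate_triaxial hp)
    (typeH1H1_subset hp)

theorem LocalDiffeoConjecture.isOpen_image_typeEH1 (hconj : LocalDiffeoConjecture) :
    IsOpen (frequencyMap (triaxial p) '' typeEH1 p) :=
  hconj.isOpen_image (contDiff_branchEH1 p) (isOpen_typeEH1 p)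
    (fun _ => branchOrdered_EH1 hp) (fun _ => frequencyMap_EH1 hp) (isNondegenerate_triaxial hp)
    (typeEH1_subset hp)

theorem frequencyMap_mem_frequencySpace {lam : Fin 2 → ℝ} (hl : lam ∈ typeH1H1 p) :
    frequencyMap (triaxial p) lam ∈ frequencySpace :=
  have hc := branchOrdered_H1H1 hp hl
  have hw := isFrequency_H1H1 hp hl
  ⟨hc.frequency_one_pos hw, hc.frequency_one_lt_zero hw, hc.frequency_zero_lt hw⟩

/-- If the image met the strip 0 < ω₂ < ρ(c, b), connectedness would put the whole strip in it. Its
closure reaches ω₂ = 0, where no boundary degeneration is possible, so a frequency with ω₂ = 0 would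
be attained. -/
theorem LocalDiffeoConjecture.disjoint_frequencyStrip (hconj : LocalDiffeoConjecture)
    {w : Fin 2 → ℝ} (hw : w ∈ frequencyMap (triaxial p) '' typeH1H1 p) :
    w ∉ frequencyStrip 0 (ellipticFrequency p.2 p.1 1) := by
  intro hwV
  set ρ := ellipticFrequency p.2 p.1 1 with hρ
  have hρ0 : 0 < ρ := ellipticFrequency_pos hp.1 hp.2.1 hp.2.2.le
  have hsub := (isPreconnected_frequencyStrip 0 ρ).subset_of_closure_inter_subset
    (hconj.isOpen_image_typeH1H1 hp) ⟨w, hwV, hw⟩ fun v hv =>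
      mem_image_typeH1H1_of_mem_closure hp hv.1 hv.2.2.1 hv.2.2.2 hv.2.1.2.ne
  -- Any point with ω₂ = 0 and 0 < ω₁ < 1/2 would do.
  have hcl : (![1 / 4, 0] : Fin 2 → ℝ) ∈ closure (frequencyMap (triaxial p) '' typeH1H1 p) := by
    refine closure_mono hsub (mem_closure_of_tendsto (b := 𝓝[>] (0 : ℝ))
      (f := fun t : ℝ => (![1 / 4, t] : Fin 2 → ℝ)) ?_ ?_)
    · refine (tendsto_pi_nhds.2 fun i => ?_)
      fin_cases i
      · exact tendsto_const_nhds
      · exact nhdsWithin_le_nhds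
    · filter_upwards [Ioo_mem_nhdsGT hρ0, Ioo_mem_nhdsGT (show (0 : ℝ) < 1 / 4 by norm_num)]
        with t h1 h2
      exact ⟨h1, h2.2, by norm_num⟩
  obtain ⟨lam, hl, h⟩ := mem_image_typeH1H1_of_mem_closure hp hcl (by norm_num) (by norm_num)
    hρ0.ne
  have h1 := (frequencyMap_mem_frequencySpace hp hl).1
  rw [h] at h1
  exact lt_irrefl _ h1

/-- The range of the frequency map on the component `H₁ ⊗ H₁`. -/
theorem LocalDiffeoConjecture.image_typeH1H1 (hconj : LocalDiffeoConjecture) :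
    frequencyMap (triaxial p) '' typeH1H1 p
      = {w | w ∈ frequencySpace ∧ ellipticFrequency p.2 p.1 1 < w 1} := by
  set ρ := ellipticFrequency p.2 p.1 1 with hρ
  set A := frequencyMap (triaxial p) '' typeH1H1 p with hA
  have hρ0 : 0 < ρ := ellipticFrequency_pos hp.1 hp.2.1 hp.2.2.le
  have hmem : ∀ w ∈ A, w ∈ frequencySpace ∧ ρ < w 1 := by
    rintro w hw
    have hΩ : w ∈ frequencySpace := by
      obtain ⟨lam, hl, rfl⟩ := hw
      exact frequencyMap_mem_frequencySpace hp hl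
    refine ⟨hΩ, lt_of_not_ge fun hle => ?_⟩
    -- Lowering ω₂ slightly stays inside the open image. This also rules out the level ω₂ = ρ(c, b),
    -- not only the strip below it.
    have ht : Tendsto (fun t : ℝ => (![w 0, w 1 - t] : Fin 2 → ℝ)) (𝓝[>] 0) (𝓝 w) := by
      refine tendsto_pi_nhds.2 fun i => ?_
      fin_cases i
      · exact tendsto_const_nhds
      · exact ((continuous_const.sub continuous_id).tendsto' 0 _ (sub_zero (w 1))).mono_left
          nhdsWithin_le_nhds
    obtain ⟨t, h1, h2⟩ := ((ht.eventually ((hconj.isOpen_image_typeH1H1 hp).mem_nhds hw)).and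
      (Ioo_mem_nhdsGT hΩ.1)).exists
    refine hconj.disjoint_frequencyStrip hp h1 ⟨⟨?_, ?_⟩, ?_, hΩ.2.2⟩
    · exact sub_pos.2 h2.2
    · exact (sub_lt_self _ h2.1).trans_le hle
    · exact (sub_lt_self _ h2.1).trans hΩ.2.1
  refine Subset.antisymm hmem fun w hw => ?_
  have hstrip : ∀ w, w ∈ frequencySpace ∧ ρ < w 1 → w ∈ frequencyStrip ρ (1 / 2) := fun w hw =>
    ⟨⟨hw.2, hw.1.2.1.trans hw.1.2.2⟩, hw.1.2⟩
  obtain ⟨lam, hl⟩ := typeH1H1_nonempty hp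
  have hl' : frequencyMap (triaxial p) lam ∈ A := mem_image_of_mem _ hl
  -- Above the level, the image is nonempty, open and relatively closed in a convex set, hence
  -- everything.
  exact (isPreconnected_frequencyStrip ρ (1 / 2)).subset_of_closure_inter_subset
    (hconj.isOpen_image_typeH1H1 hp) ⟨_, hstrip _ (hmem _ hl'), hl'⟩ (fun v hv =>
      mem_image_typeH1H1_of_mem_closure hp hv.1 hv.2.2.1 hv.2.2.2 hv.2.1.1.ne') (hstrip w hw)

/-- Let λ tend to the corner (c, b). Then c₀, c₁ merge, giving ω₁ → 1/2, and simultaneously c₂, c₃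
merge, giving ω₁ - ω₂ → 0 along a subsequence. Thus ω₂ comes arbitrarily close to 1/2. -/
theorem exists_frequencyMap_typeEH1_gt {r : ℝ} (hr : r < 1 / 2) :
    ∃ lam ∈ typeEH1 p, r < frequencyMap (triaxial p) lam 1 := by
  have hcb : 0 < p.1 - p.2 := sub_pos.2 hp.2.1
  obtain ⟨s, -, hs⟩ := exists_seq_strictAnti_tendsto' (lt_min hp.1 hcb)
  set u : ℕ → Fin 2 → ℝ := fun k => ![p.2 - s k, p.1 - s k] with hu'
  have hu : ∀ k, u k ∈ typeEH1 p := fun k => by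
    have h1 := (hs.1 k).1
    have h2 := lt_min_iff.1 (hs.1 k).2
    refine ⟨⟨sub_pos.2 h2.1, sub_lt_self _ h1⟩, ?_, sub_lt_self _ h1⟩
    show p.2 < p.1 - s k
    linarith
  have hF := fun k => isFrequency_EH1 hp (hu k)
  have hc := fun k => branchOrdered_EH1 hp (hu k)
  have hK : ∀ k, frequencyMap (triaxial p) (u k) ∈ Icc (fun _ => (0 : ℝ)) (fun _ => 1 / 2) :=
    fun k => by
      have h1 := (hc k).frequency_one_pos (hF k)
      have h2 := (hc k).frequency_one_lt_zero (hF k)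
      have h3 := (hc k).frequency_zero_lt (hF k)
      exact ⟨Fin.forall_fin_two.2 ⟨(h1.trans h2).le, h1.le⟩,
        Fin.forall_fin_two.2 ⟨h3.le, (h2.trans h3).le⟩⟩
  obtain ⟨w, -, φ, hφ, hw⟩ := isCompact_Icc.tendsto_subseq hK
  have hsφ : Tendsto (fun k => s (φ k)) atTop (𝓝 0) := hs.2.comp hφ.tendsto_atTop
  have hc' : ∀ j, Tendsto (fun k => branchEH1 p (u (φ k)) j) atTop
      (𝓝 ((![p.2, p.2, p.1, p.1, 1] : Fin 5 → ℝ) j)) := by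
    intro j
    fin_cases j
    · have h := hsφ.const_sub p.2
      rwa [sub_zero] at h
    · exact tendsto_const_nhds
    · have h := hsφ.const_sub p.1
      rwa [sub_zero] at h
    · exact tendsto_const_nhds
    · exact tendsto_const_nhds
  have hw' := fun j => ((continuous_apply j).tendsto w).comp hw
  have h4 : ∀ k, branchEH1 p (u (φ k)) 4 ≤ 1 := fun k => le_rfl
  have e1 := frequency_zero_eq_one_of_tendsto (fun k => hc (φ k)) (fun k => hF (φ k)) h4 hc' hw'
    hp.2.1 rfl
  have e2 := frequency_zero_eq_half_of_tendsto (fun k => hc (φ k)) (fun k => hF (φ k)) h4 hc' hw'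
    hp.1 hp.2.1 rfl
  obtain ⟨k, hk⟩ := ((hw' 1).eventually_const_lt (hr.trans_eq (e2.symm.trans e1))).exists
  exact ⟨_, hu (φ k), hk⟩

/-- The same clopen argument on the strip above ρ(c, b). The corner point of EH1 provides the
initial frequency; nothing is claimed below that level. -/
theorem LocalDiffeoConjecture.subset_image_typeEH1 (hconj : LocalDiffeoConjecture) :
    {w | w ∈ frequencySpace ∧ ellipticFrequency p.2 p.1 1 < w 1}
      ⊆ frequencyMap (triaxial p) '' typeEH1 p := by
  intro w hw
  set ρ := ellipticFrequency p.2 p.1 1 with hρ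
  obtain ⟨lam, hl, h⟩ := exists_frequencyMap_typeEH1_gt hp
    (ellipticFrequency_lt_half hp.1 hp.2.1 hp.2.2.le)
  have hF := isFrequency_EH1 hp hl
  have hc := branchOrdered_EH1 hp hl
  have h2 := hc.frequency_one_lt_zero hF
  have h3 := hc.frequency_zero_lt hF
  exact (isPreconnected_frequencyStrip ρ (1 / 2)).subset_of_closure_inter_subset
    (hconj.isOpen_image_typeEH1 hp) ⟨_, ⟨⟨h, h2.trans h3⟩, h2, h3⟩, mem_image_of_mem _ hl⟩
    (fun v hv => hconj.mem_image_typeEH1_of_mem_closure hp hv.1 hv.2.2.1 hv.2.2.2 hv.2.1.1)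
    ⟨⟨hw.2, hw.1.2.1.trans hw.1.2.2⟩, hw.1.2⟩

end Types

/-! ### Complex extension of the periods in genus one -/

/-- The principal branch of `z ↦ 1 / √z`. -/
def complexInvSqrt (z : ℂ) : ℂ := z ^ (-(1 / 2) : ℂ)

theorem complexInvSqrt_ofReal {x : ℝ} (hx : 0 < x) : complexInvSqrt x = ((√x)⁻¹ : ℝ) := by
  rw [complexInvSqrt, Real.sqrt_eq_rpow, ← Real.rpow_neg hx.le, Complex.ofReal_cpow hx.le]
  push_cast
  rfl

theorem contDiffAt_complexInvSqrt {E : Type*} [NormedAddCommGroup E] [NormedSpace ℂ E] {f : E → ℂ}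
    {v : E} {x : ℝ} (hf : ContDiffAt ℂ 1 f v) (hx : 0 < x) (hfx : f v = x) :
    ContDiffAt ℂ 1 (fun v => complexInvSqrt (f v)) v := by
  have h : AnalyticAt ℂ complexInvSqrt (f v) :=
    analyticAt_id.cpow analyticAt_const (by rw [hfx]; exact Complex.ofReal_mem_slitPlane.2 hx)
  exact h.contDiffAt.comp v hf

/-- The pair is (b, c). The factor c · c^(-1/2) stands for √c, and the integral is the substituted
form of `ellipticLow c b 1`, so that holomorphy reduces to that of one principal branch near
positive reals. -/
def complexLow (v : ℂ × ℂ) : ℂ :=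
  2 * (v.2 * complexInvSqrt v.2) * ∫ u in (0 : ℝ)..1,
    complexInvSqrt (v.1 - v.2 * (1 - (u : ℂ) ^ 2)) * complexInvSqrt (1 - v.2 * (1 - (u : ℂ) ^ 2))

def complexHigh (v : ℂ × ℂ) : ℂ :=
  2 * ∫ φ in (0 : ℝ)..(π / 2),
    complexInvSqrt (v.1 + (1 - v.1) * Complex.sin (φ : ℂ) ^ 2 - v.2)

section

variable {b c : ℝ}

theorem complexLow_ofReal (hc : 0 < c) (hcb : c < b) (hb : b < 1) :
    complexLow (b, c) = ellipticLow c b 1 := by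
  rw [ellipticLow, integral_lowMeasure hc.le (continuousOn_ellipticLow hcb hb.le), complexLow]
  dsimp only
  rw [complexInvSqrt_ofReal hc, ← Complex.ofReal_mul, ← div_eq_mul_inv, Real.div_sqrt]
  push_cast
  rw [← intervalIntegral.integral_ofReal]
  congr 1
  refine intervalIntegral.integral_congr fun u hu => ?_
  have hs := sq_sub_mem hc.le hu
  have h1 : 0 < b - c * (1 - u ^ 2) := by linarith [hs.2]
  have h2 : 0 < 1 - c * (1 - u ^ 2) := by linarith
  have e1 := complexInvSqrt_ofReal h1
  have e2 := complexInvSqrt_ofReal h2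
  push_cast at e1 e2
  rw [e1, e2, Real.sqrt_mul h1.le, mul_inv]
  push_cast
  rfl

theorem complexHigh_ofReal (hcb : c < b) (hb : b < 1) :
    complexHigh (b, c) = ellipticHigh c b 1 := by
  rw [ellipticHigh, integral_arcMeasure hb.le (continuousOn_ellipticHigh hcb), complexHigh]
  push_cast
  rw [← intervalIntegral.integral_ofReal]
  congr 1
  refine intervalIntegral.integral_congr fun φ _ => ?_
  have hs := arcPoint_mem hb.le φ
  have h1 : 0 < arcPoint b 1 φ - c := by linarith [hs.1]
  have e1 := complexInvSqrt_ofReal h1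
  unfold arcPoint at e1 ⊢
  push_cast at e1 ⊢
  exact e1

theorem contDiffAt_complexLow (hc : 0 < c) (hcb : c < b) (hb : b < 1) :
    ContDiffAt ℂ 1 complexLow ((b : ℂ), (c : ℂ)) := by
  refine (contDiffAt_const.mul (contDiffAt_snd.mul
    (contDiffAt_complexInvSqrt contDiffAt_snd hc rfl))).mul
    (contDiffAt_one_intervalIntegral (𝕜 := ℂ) (G := fun q : (ℂ × ℂ) × ℂ =>
      complexInvSqrt (q.1.1 - q.1.2 * (1 - q.2 ^ 2)) * complexInvSqrt (1 - q.1.2 * (1 - q.2 ^ 2)))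
      fun u hu => ?_)
  have hs := sq_sub_mem hc.le hu
  have h1 : 0 < b - c * (1 - u ^ 2) := by linarith [hs.2]
  have h2 : 0 < 1 - c * (1 - u ^ 2) := by linarith
  refine ContDiffAt.mul (contDiffAt_complexInvSqrt (by fun_prop) h1 ?_)
    (contDiffAt_complexInvSqrt (by fun_prop) h2 ?_)
  · push_cast
    rfl
  · push_cast
    rfl

theorem contDiffAt_complexHigh (hcb : c < b) (hb : b < 1) :
    ContDiffAt ℂ 1 complexHigh ((b : ℂ), (c : ℂ)) := by
  refine contDiffAt_const.mul
    (contDiffAt_one_intervalIntegral (𝕜 := ℂ) (G := fun q : (ℂ × ℂ) × ℂ =>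
      complexInvSqrt (q.1.1 + (1 - q.1.1) * Complex.sin q.2 ^ 2 - q.1.2)) fun φ _ => ?_)
  have hs := arcPoint_mem hb.le φ
  have h1 : 0 < arcPoint b 1 φ - c := by linarith [hs.1]
  have hsin : ContDiff ℂ 1 Complex.sin := Complex.contDiff_sin
  refine contDiffAt_complexInvSqrt (by fun_prop) h1 ?_
  unfold arcPoint
  push_cast
  rfl

end

/-! ### Analyticity of the boundary curve -/

theorem isInvertible_of_apply_one_ne_zero {L : ℂ →L[ℂ] ℂ} (h : L 1 ≠ 0) : L.IsInvertible := by
  refine ⟨ContinuousLinearEquiv.smulLeft (Units.mk0 (L 1) h), ?_⟩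
  ext
  simp

section

variable {r : ℝ} (hconj : LocalDiffeoConjecture) (hr : r ∈ Ioo (0 : ℝ) (1 / 2))
include hconj hr

/-- For fixed c just below or above the boundary value, continuity of ρ(c, ·) keeps the strict
inequality with r for nearby b, and `ellipticFrequency_lt_iff` turns it back into an inequality for
the boundary. -/
theorem continuousAt_regionBoundary {b : ℝ} (hb : b ∈ Ioo (0 : ℝ) 1) :
    ContinuousAt (regionBoundary r) b := by
  obtain ⟨h1, h2⟩ := hconj.regionBoundary_spec hr hb
  have hcont : ∀ c ∈ Ioo 0 b, ContinuousAt (fun y => ellipticFrequency c y 1) b := fun c hc => by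
    obtain ⟨d, -, hd⟩ := hconj.exists_hasDerivAt_snd hc.1 hc.2 hb.2
    exact hd.continuousAt
  refine tendsto_order.2 ⟨fun x hx => ?_, fun x hx => ?_⟩
  · obtain ⟨c, hc1, hc2⟩ := exists_between (max_lt hx h1.1)
    obtain ⟨hxc, hc0⟩ := max_lt_iff.1 hc1
    have hcb : c ∈ Ioo 0 b := ⟨hc0, hc2.trans h1.2⟩
    filter_upwards [(hcont c hcb).eventually_lt_const
      ((hconj.ellipticFrequency_lt_iff hr hb hcb).2 hc2), Ioo_mem_nhds hcb.2 hb.2] with y h3 h4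
    exact hxc.trans ((hconj.ellipticFrequency_lt_iff hr ⟨hc0.trans h4.1, h4.2⟩ ⟨hc0, h4.1⟩).1 h3)
  · obtain ⟨c, hc1, hc2⟩ := exists_between (lt_min hx h1.2)
    obtain ⟨hcx, hcb'⟩ := lt_min_iff.1 hc2
    have hcb : c ∈ Ioo 0 b := ⟨h1.1.trans hc1, hcb'⟩
    have hrc : r < ellipticFrequency c b 1 := by
      have := hconj.strictMonoOn_ellipticFrequency hb.1 hb.2 h1 hcb hc1
      exact h2.symm.trans_lt this
    filter_upwards [(hcont c hcb).eventually_const_lt hrc, Ioo_mem_nhds hcb.2 hb.2] with y h3 h4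
    refine lt_of_le_of_lt (le_of_not_gt fun h => ?_) hcx
    exact lt_asymm h3
      ((hconj.ellipticFrequency_lt_iff hr ⟨hcb.1.trans h4.1, h4.2⟩ ⟨hcb.1, h4.1⟩).2 h)

/-- The boundary is the zero set of Φ = low - 2 r · high, continued to complex (b, c). On this set
∂Φ/∂c is 2 · high times ∂ρ/∂c, nonzero by the conjecture for n = 1. The complex implicit function is
differentiable near b, hence analytic. -/
theorem analyticAt_regionBoundary {b : ℝ} (hb : b ∈ Ioo (0 : ℝ) 1) :
    AnalyticAt ℝ (regionBoundary r) b := by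
  obtain ⟨h1, h2⟩ := hconj.regionBoundary_spec hr hb
  set c := regionBoundary r b with hc
  set Φ : ℂ × ℂ → ℂ := fun v => complexLow v - 2 * (r : ℂ) * complexHigh v with hΦ
  have hN := contDiffAt_complexLow h1.1 h1.2 hb.2
  have hD := contDiffAt_complexHigh h1.2 hb.2
  have cdf : ContDiffAt ℂ 1 Φ ((b : ℂ), (c : ℂ)) := hN.sub (contDiffAt_const.mul hD)
  have hzero : ∀ {b' c' : ℝ}, 0 < c' → c' < b' → b' < 1 → ellipticFrequency c' b' 1 = r →
      Φ ((b' : ℂ), (c' : ℂ)) = 0 := fun {b' c'} hc0 hcb hb1 h => by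
    have hpos := ellipticHigh_pos hcb hb1.le
    rw [ellipticFrequency, div_eq_iff (by positivity)] at h
    simp only [hΦ]
    rw [complexLow_ofReal hc0 hcb hb1, complexHigh_ofReal hcb hb1, h]
    push_cast
    ring
  have hne : (fderiv ℂ Φ ((b : ℂ), (c : ℂ)) ∘L .inr ℂ ℂ ℂ) 1 ≠ 0 := by
    set LN := fderiv ℂ complexLow ((b : ℂ), (c : ℂ)) with hLN
    set LD := fderiv ℂ complexHigh ((b : ℂ), (c : ℂ)) with hLD
    have hN' := (hN.differentiableAt one_ne_zero).hasFDerivAt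
    have hD' := (hD.differentiableAt one_ne_zero).hasFDerivAt
    have hL : fderiv ℂ Φ ((b : ℂ), (c : ℂ)) = LN - (2 * (r : ℂ)) • LD :=
      (hN'.sub (hD'.const_mul (2 * (r : ℂ)))).fderiv
    have hinr : HasDerivAt (fun z : ℂ => ((b : ℂ), z)) (0, 1) (c : ℂ) :=
      (hasDerivAt_const _ _).prodMk (hasDerivAt_id _)
    have hlow : HasDerivAt (fun t => ellipticLow t b 1) (LN (0, 1)).re c := by
      refine (hN'.comp_hasDerivAt (c : ℂ) hinr).real_of_complex.congr_of_eventuallyEq ?_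
      filter_upwards [Ioo_mem_nhds h1.1 h1.2] with t ht
      simp [complexLow_ofReal ht.1 ht.2 hb.2]
    have hhigh : HasDerivAt (fun t => ellipticHigh t b 1) (LD (0, 1)).re c := by
      refine (hD'.comp_hasDerivAt (c : ℂ) hinr).real_of_complex.congr_of_eventuallyEq ?_
      filter_upwards [Iio_mem_nhds h1.2] with t ht
      simp [complexHigh_ofReal ht hb.2]
    have hpos := ellipticHigh_pos h1.2 hb.2.le
    obtain ⟨d, hd0, hd⟩ := hconj.exists_hasDerivAt_fst h1.1 h1.2 hb.2
    have heq := hd.unique (hlow.div (hhigh.const_mul 2) (by positivity))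
    have h2' := h2
    rw [ellipticFrequency, div_eq_iff (by positivity)] at h2'
    intro h0
    rw [hL] at h0
    have h0' := congrArg Complex.re h0
    simp only [ContinuousLinearMap.comp_apply, ContinuousLinearMap.inr_apply,
      sub_apply, smul_apply, smul_eq_mul, Complex.sub_re,
      Complex.zero_re] at h0'
    rw [show (2 * (r : ℂ)) = ((2 * r : ℝ) : ℂ) by push_cast; ring, Complex.re_ofReal_mul] at h0'
    apply hd0
    rw [heq, h2', div_eq_zero_iff]
    left
    linear_combination (2 * ellipticHigh c b 1) * h0'
  have hinv := isInvertible_of_apply_one_ne_zero hne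
  set ψ := cdf.implicitFunction one_ne_zero hinv with hψ
  have hψa : AnalyticAt ℂ ψ (b : ℂ) := by
    refine Complex.analyticAt_iff_eventually_differentiableAt.2 ?_
    filter_upwards [(cdf.contDiffAt_implicitFunction one_ne_zero hinv).eventually (by simp)]
      with z hz using hz.differentiableAt one_ne_zero
  refine hψa.re_ofReal.congr ?_
  -- Uniqueness in the implicit function theorem is only local, so continuity of the boundary is
  -- needed to identify it with the implicit function.
  have ht : Tendsto (fun b' : ℝ => (((b' : ℂ), (regionBoundary r b' : ℂ)) : ℂ × ℂ)) (𝓝 b)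
      (𝓝 ((b : ℂ), (c : ℂ))) :=
    (Complex.continuous_ofReal.tendsto b).prodMk_nhds
      ((Complex.continuous_ofReal.tendsto c).comp (continuousAt_regionBoundary hconj hr hb))
  filter_upwards [ht.eventually (cdf.eventually_apply_eq_iff_implicitFunction one_ne_zero hinv),
    Ioo_mem_nhds hb.1 hb.2] with b' h3 h4
  obtain ⟨h5, h6⟩ := hconj.regionBoundary_spec hr h4
  have h7 := h3.1 ((hzero h5.1 h5.2 h4.2 h6).trans (hzero h1.1 h1.2 hb.2 h2).symm)
  exact congrArg Complex.re h7

end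

/-! ### Elliptic integrals of the first kind: involution and duplication -/

/-- The integrand `1 / √(v (v + B) (v - A))` of the normalized elliptic integral. -/
def firstKind (A B v : ℝ) : ℝ := (√(v * (v + B) * (v - A)))⁻¹

/-- The involution exchanging `A` with `∞` and `0` with `-B`. -/
def halfShift (A B v : ℝ) : ℝ := A + A * (A + B) / (v - A)

/-- The duplication map of the elliptic curve `y² = v (v + B) (v - A)`. -/
def doubling (A B v : ℝ) : ℝ := (v ^ 2 + A * B) ^ 2 / (4 * (v * (v + B) * (v - A)))

theorem inv_sqrt_eq_mul_inv_sqrt {k x y : ℝ} (hk : 0 ≤ k) (h : x = k ^ 2 * y) (hk0 : k ≠ 0) :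
    (√y)⁻¹ = k * (√x)⁻¹ := by
  rw [h, Real.sqrt_mul (sq_nonneg k), Real.sqrt_sq hk, mul_inv, mul_inv_cancel_left₀ hk0]

section

variable {A B : ℝ} (hA : 0 < A) (hB : 0 < B)
include hA hB

/-- `halfShift` is the x-coordinate of translation by the 2-torsion point (A, 0), which preserves
dv/y up to sign. -/
theorem setIntegral_firstKind_halfShift {v : ℝ} (hv : A < v) :
    ∫ t in Ioi (halfShift A B v), firstKind A B t = ∫ t in Ioo A v, firstKind A B t := by
  have hAB : 0 < A * (A + B) := by positivity
  have himg : halfShift A B '' Ioo A v = Ioi (halfShift A B v) := by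
    ext y
    constructor
    · rintro ⟨t, ht, rfl⟩
      have h1 : 0 < t - A := sub_pos.2 ht.1
      have h2 : t - A < v - A := sub_lt_sub_right ht.2 A
      simp only [halfShift, mem_Ioi]
      gcongr
    · intro hy
      have hv' : 0 < v - A := sub_pos.2 hv
      have h0 : 0 < A * (A + B) / (v - A) := by positivity
      have hy' : A * (A + B) / (v - A) < y - A := by
        simp only [halfShift, mem_Ioi] at hy
        linarith
      have hy0 : 0 < y - A := h0.trans hy'
      refine ⟨halfShift A B y, ⟨?_, ?_⟩, ?_⟩
      · simp only [halfShift]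
        have : 0 < A * (A + B) / (y - A) := by positivity
        linarith
      · simp only [halfShift]
        have : A * (A + B) / (y - A) < v - A := by
          rw [div_lt_iff₀ hy0]
          rw [div_lt_iff₀ hv'] at hy'
          linarith
        linarith
      · simp only [halfShift]
        rw [add_sub_cancel_left, div_div_cancel₀ hAB.ne']
        ring
  have hder : ∀ t ∈ Ioo A v, HasDerivWithinAt (halfShift A B) (-(A * (A + B)) / (t - A) ^ 2)
      (Ioo A v) t := fun t ht => by
    have h1 : t - A ≠ 0 := (sub_pos.2 ht.1).ne'
    have := (((hasDerivAt_const t (A * (A + B))).div ((hasDerivAt_id t).sub_const A) h1).const_add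
      A).hasDerivWithinAt (s := Ioo A v)
    refine this.congr_deriv ?_
    simp
  have hinj : InjOn (halfShift A B) (Ioo A v) := by
    intro s hs t ht h
    have h1 : s - A ≠ 0 := (sub_pos.2 hs.1).ne'
    have h2 : t - A ≠ 0 := (sub_pos.2 ht.1).ne'
    simp only [halfShift, add_right_inj] at h
    rw [div_eq_div_iff h1 h2] at h
    have := mul_left_cancel₀ hAB.ne' h
    linarith
  rw [← himg, integral_image_eq_integral_abs_deriv_smul measurableSet_Ioo hder hinj]
  refine setIntegral_congr_fun measurableSet_Ioo fun t ht => ?_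
  have h1 : 0 < t - A := sub_pos.2 ht.1
  have ht0 : 0 < t := hA.trans ht.1
  have h2 : 0 < A * (A + B) / (t - A) ^ 2 := by positivity
  simp only [smul_eq_mul, neg_div, abs_neg, abs_of_pos h2, firstKind]
  refine (inv_sqrt_eq_mul_inv_sqrt h2.le ?_ h2.ne').symm
  simp only [halfShift]
  field_simp
  ring

theorem hasDerivAt_doubling {v : ℝ} (hv : A < v) : HasDerivAt (doubling A B)
    ((v ^ 2 + A * B) * ((v ^ 2 - 2 * A * v - A * B) * (v ^ 2 + 2 * B * v - A * B))
      / (4 * (v * (v + B) * (v - A)) ^ 2)) v := by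
  have h1 : 0 < v - A := sub_pos.2 hv
  have hv0 : 0 < v := hA.trans hv
  have hP : 4 * (v * (v + B) * (v - A)) ≠ 0 := by positivity
  have hid := hasDerivAt_id v
  have := (((hid.pow 2).add_const (A * B)).pow 2).div
    (((hid.mul (hid.add_const B)).mul (hid.sub_const A)).const_mul 4) hP
  refine this.congr_deriv ?_
  simp only [Pi.mul_apply, Pi.pow_apply, id_eq]
  field_simp
  push_cast
  ring

/-- Duplication pulls dv/y back to 2 dv/y. The hypothesis `hq` puts v beyond A + √(A (A + B)), the
fixed point of `halfShift`, where `doubling` is increasing. -/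
theorem firstKind_doubling {v : ℝ} (hv : A < v) (hq : 0 < v ^ 2 - 2 * A * v - A * B) :
    |(v ^ 2 + A * B) * ((v ^ 2 - 2 * A * v - A * B) * (v ^ 2 + 2 * B * v - A * B))
      / (4 * (v * (v + B) * (v - A)) ^ 2)| * firstKind A B (doubling A B v)
      = 2 * firstKind A B v := by
  have h1 : 0 < v - A := sub_pos.2 hv
  have hv0 : 0 < v := hA.trans hv
  have hq' : 0 < v ^ 2 + 2 * B * v - A * B := by nlinarith [mul_pos hB h1, mul_pos hB hA]
  have hk : 0 < (v ^ 2 + A * B) * ((v ^ 2 - 2 * A * v - A * B) * (v ^ 2 + 2 * B * v - A * B))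
      / (4 * (v * (v + B) * (v - A)) ^ 2) := by positivity
  rw [abs_of_pos hk]
  have h2 : firstKind A B v = ((v ^ 2 + A * B) * ((v ^ 2 - 2 * A * v - A * B)
      * (v ^ 2 + 2 * B * v - A * B)) / (4 * (v * (v + B) * (v - A)) ^ 2) / 2)
      * firstKind A B (doubling A B v) := by
    refine inv_sqrt_eq_mul_inv_sqrt (half_pos hk).le ?_ (half_pos hk).ne'
    simp only [doubling]
    have e1 : (v ^ 2 + A * B) ^ 2 / (4 * (v * (v + B) * (v - A))) + B
        = (v ^ 2 + 2 * B * v - A * B) ^ 2 / (4 * (v * (v + B) * (v - A))) := by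
      field_simp
      ring
    have e2 : (v ^ 2 + A * B) ^ 2 / (4 * (v * (v + B) * (v - A))) - A
        = (v ^ 2 - 2 * A * v - A * B) ^ 2 / (4 * (v * (v + B) * (v - A))) := by
      field_simp
      ring
    rw [e1, e2]
    field_simp
    ring
  rw [h2]
  ring

theorem setIntegral_firstKind_doubling {v : ℝ} (hv : A < v)
    (hq : 0 < v ^ 2 - 2 * A * v - A * B) :
    ∫ t in Ioi (doubling A B v), firstKind A B t = 2 * ∫ t in Ioi v, firstKind A B t := by
  have hqt : ∀ t, v ≤ t → 0 < t ^ 2 - 2 * A * t - A * B := fun t ht => by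
    nlinarith [mul_nonneg (sub_nonneg.2 ht) (sub_pos.2 hv).le,
      mul_nonneg (sub_nonneg.2 ht) (sub_nonneg.2 ht)]
  have hd : ∀ t, v ≤ t → HasDerivAt (doubling A B) _ t := fun t ht =>
    hasDerivAt_doubling hA hB (hv.trans_le ht)
  have hcont : ContinuousOn (doubling A B) (Ici v) := fun t ht =>
    (hd t ht).continuousAt.continuousWithinAt
  have hmono : StrictMonoOn (doubling A B) (Ici v) := by
    refine strictMonoOn_of_deriv_pos (convex_Ici v) hcont fun t ht => ?_
    rw [interior_Ici] at ht
    have hvt : v < t := ht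
    rw [(hd t hvt.le).deriv]
    have h1 : 0 < t - A := sub_pos.2 (hv.trans hvt)
    have ht0 : 0 < t := hA.trans (hv.trans hvt)
    have hq := hqt t hvt.le
    have hq' : 0 < t ^ 2 + 2 * B * t - A * B := by nlinarith [mul_pos hB h1, mul_pos hB hA]
    positivity
  have himg : doubling A B '' Ioi v = Ioi (doubling A B v) := by
    ext y
    constructor
    · rintro ⟨t, ht, rfl⟩
      exact hmono self_mem_Ici (mem_Ioi.1 ht).le ht
    · intro hy
      -- For v large, `doubling` grows like v/4; once M ≥ B it is at least M/8, which suffices to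
      -- exceed y.
      set M := max v (max B (8 * y)) with hM
      have hvM : v ≤ M := le_max_left _ _
      have hBM : B ≤ M := (le_max_left _ _).trans (le_max_right _ _)
      have hyM : 8 * y ≤ M := (le_max_right _ _).trans (le_max_right _ _)
      have hAM : 0 < M - A := sub_pos.2 (hv.trans_le hvM)
      have hM0 : 0 < M := by linarith
      have hyD : y ≤ doubling A B M := by
        rw [doubling, le_div_iff₀ (by positivity)]
        have hP : M * (M + B) * (M - A) ≤ M * (2 * M) * M := by
          gcongr <;> linarith
        have hP0 : 0 ≤ M * (M + B) * (M - A) := by positivity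
        have h1 : (M ^ 2) ^ 2 ≤ (M ^ 2 + A * B) ^ 2 := by
          have := mul_pos hA hB
          gcongr
          linarith
        have h2 : y * (4 * (M * (M + B) * (M - A))) ≤ M / 8 * (4 * (M * (2 * M) * M)) := by
          have : y ≤ M / 8 := by linarith
          gcongr
        calc _ ≤ _ := h2
          _ = (M ^ 2) ^ 2 := by ring
          _ ≤ _ := h1
      obtain ⟨t, ht, rfl⟩ := intermediate_value_Icc hvM (hcont.mono Icc_subset_Ici_self)
        ⟨(mem_Ioi.1 hy).le, hyD⟩
      refine ⟨t, lt_of_le_of_ne ht.1 ?_, rfl⟩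
      rintro rfl
      exact lt_irrefl _ (mem_Ioi.1 hy)
  rw [← himg, integral_image_eq_integral_abs_deriv_smul measurableSet_Ioi
    (fun t ht => (hd t (mem_Ioi.1 ht).le).hasDerivWithinAt)
    (hmono.injOn.mono Ioi_subset_Ici_self), ← integral_const_mul]
  refine setIntegral_congr_fun measurableSet_Ioi fun t ht => ?_
  exact firstKind_doubling hA hB (hv.trans (mem_Ioi.1 ht)) (hqt t (mem_Ioi.1 ht).le)

end

/-! ### Reduction of the planar periods to the normalized elliptic integral -/

section

variable {b c : ℝ} (hc : 0 < c) (hcb : c < b) (hb : b < 1)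
include hc hcb hb

theorem ellipticLow_eq_setIntegral : ellipticLow c b 1
    = ∫ v in Ioi ((b - c) / c), firstKind (b - c) (1 - b) v := by
  have hA : 0 < b - c := sub_pos.2 hcb
  have hC : 0 < 1 - c := by linarith
  rw [ellipticLow, ← intervalIntegral_div_sqrt_eq_lowMeasure hc
    (continuousOn_ellipticLow hcb hb.le), intervalIntegral.integral_of_le hc.le,
    integral_Ioc_eq_integral_Ioo]
  -- The Möbius map taking c, 1, b, ∞ to ∞, 0, -B, A, with A = b - c and B = 1 - b. The endpoint 0
  -- goes to (b - c)/c.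
  set f : ℝ → ℝ := fun s => (b - c) * (1 - s) / (c - s) with hf
  have himg : f '' Ioo 0 c = Ioi ((b - c) / c) := by
    ext y
    constructor
    · rintro ⟨s, hs, rfl⟩
      have h1 : 0 < c - s := sub_pos.2 hs.2
      simp only [hf, mem_Ioi]
      rw [div_lt_div_iff₀ hc h1]
      nlinarith [mul_pos hA (mul_pos hs.1 hC)]
    · intro hy
      have hy1 : (b - c) / c < y := hy
      have hy2 : b - c < y * c := (div_lt_iff₀ hc).1 hy1
      have hy0 : 0 < y := (div_pos hA hc).trans hy1
      have hyA : 0 < y - (b - c) := by nlinarith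
      refine ⟨(c * y - (b - c)) / (y - (b - c)), ⟨div_pos (by linarith) hyA, ?_⟩, ?_⟩
      · rw [div_lt_iff₀ hyA]
        nlinarith
      · simp only [hf]
        have e1 : 1 - (c * y - (b - c)) / (y - (b - c)) = y * (1 - c) / (y - (b - c)) := by
          field_simp
          ring
        have e2 : c - (c * y - (b - c)) / (y - (b - c)) = (b - c) * (1 - c) / (y - (b - c)) := by
          field_simp
          ring
        rw [e1, e2]
        field_simp
  have hder : ∀ s ∈ Ioo 0 c, HasDerivWithinAt f ((b - c) * (1 - c) / (c - s) ^ 2) (Ioo 0 c) s :=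
    fun s hs => by
      have h1 : c - s ≠ 0 := (sub_pos.2 hs.2).ne'
      refine (((((hasDerivAt_id s).const_sub 1).const_mul (b - c)).div
        ((hasDerivAt_id s).const_sub c) h1).hasDerivWithinAt).congr_deriv ?_
      simp only [id_eq]
      congr 1
      ring
  have hinj : InjOn f (Ioo 0 c) := by
    intro s hs t ht h
    have h1 : c - s ≠ 0 := (sub_pos.2 hs.2).ne'
    have h2 : c - t ≠ 0 := (sub_pos.2 ht.2).ne'
    simp only [hf] at h
    rw [div_eq_div_iff h1 h2] at h
    have h3 : (b - c) * (1 - c) * s = (b - c) * (1 - c) * t := by linear_combination h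
    exact mul_left_cancel₀ (mul_pos hA hC).ne' h3
  rw [← himg, integral_image_eq_integral_abs_deriv_smul measurableSet_Ioo hder hinj]
  refine setIntegral_congr_fun measurableSet_Ioo fun s hs => ?_
  have h1 : 0 < c - s := sub_pos.2 hs.2
  have h2 : 0 < b - s := by linarith
  have h3 : 0 < 1 - s := by linarith
  have hk : 0 < (b - c) * (1 - c) / (c - s) ^ 2 := by positivity
  simp only [smul_eq_mul, abs_of_pos hk, firstKind]
  rw [div_eq_mul_inv, ← mul_inv, ← Real.sqrt_mul (mul_pos h2 h3).le]
  refine inv_sqrt_eq_mul_inv_sqrt hk.le ?_ hk.ne'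
  have e1 : f s + (1 - b) = (b - s) * (1 - c) / (c - s) := by
    simp only [hf]
    field_simp
    ring
  have e2 : f s - (b - c) = (b - c) * (1 - c) / (c - s) := by
    simp only [hf]
    field_simp
    ring
  rw [e1, e2]
  simp only [hf]
  field_simp

omit hc in
theorem ellipticHigh_eq_setIntegral : ellipticHigh c b 1
    = ∫ v in Ioi (b - c), firstKind (b - c) (1 - b) v := by
  have hA : 0 < b - c := sub_pos.2 hcb
  have hB : 0 < 1 - b := sub_pos.2 hb
  rw [ellipticHigh, ← intervalIntegral_div_sqrt_eq_arcMeasure hb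
    (continuousOn_ellipticHigh hcb), intervalIntegral.integral_of_le hb.le,
    integral_Ioc_eq_integral_Ioo]
  -- The Möbius map taking b, 1, c, ∞ to ∞, A, -B, 0, so that both periods become integrals of the
  -- same form.
  set f : ℝ → ℝ := fun u => (b - c) * (1 - b) / (u - b) with hf
  have himg : f '' Ioo b 1 = Ioi (b - c) := by
    ext y
    constructor
    · rintro ⟨u, hu, rfl⟩
      have h1 : 0 < u - b := sub_pos.2 hu.1
      simp only [hf, mem_Ioi]
      rw [lt_div_iff₀ h1]
      exact mul_lt_mul_of_pos_left (by linarith [hu.2]) hA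
    · intro hy
      have hy1 : b - c < y := hy
      have hy0 : 0 < y := hA.trans hy1
      refine ⟨b + (b - c) * (1 - b) / y, ⟨lt_add_of_pos_right _ (by positivity), ?_⟩, ?_⟩
      · have : (b - c) * (1 - b) / y < 1 - b := by
          rw [div_lt_iff₀ hy0]
          nlinarith
        linarith
      · simp only [hf, add_sub_cancel_left]
        rw [div_div_cancel₀ (mul_pos hA hB).ne']
  have hder : ∀ u ∈ Ioo b 1, HasDerivWithinAt f (-((b - c) * (1 - b)) / (u - b) ^ 2) (Ioo b 1) u :=
    fun u hu => by
      have h1 : u - b ≠ 0 := (sub_pos.2 hu.1).ne'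
      refine (((hasDerivAt_const u ((b - c) * (1 - b))).div
        ((hasDerivAt_id u).sub_const b) h1).hasDerivWithinAt).congr_deriv ?_
      simp
  have hinj : InjOn f (Ioo b 1) := by
    intro s hs t ht h
    have h1 : s - b ≠ 0 := (sub_pos.2 hs.1).ne'
    have h2 : t - b ≠ 0 := (sub_pos.2 ht.1).ne'
    simp only [hf] at h
    rw [div_eq_div_iff h1 h2] at h
    have := mul_left_cancel₀ (mul_pos hA hB).ne' h
    linarith
  rw [← himg, integral_image_eq_integral_abs_deriv_smul measurableSet_Ioo hder hinj]
  refine setIntegral_congr_fun measurableSet_Ioo fun u hu => ?_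
  have h1 : 0 < u - b := sub_pos.2 hu.1
  have h2 : 0 < 1 - u := sub_pos.2 hu.2
  have h3 : 0 < u - c := by linarith
  have hk : 0 < (b - c) * (1 - b) / (u - b) ^ 2 := by positivity
  simp only [smul_eq_mul, neg_div, abs_neg, abs_of_pos hk, firstKind]
  rw [div_eq_mul_inv, ← mul_inv, ← Real.sqrt_mul h3.le]
  refine inv_sqrt_eq_mul_inv_sqrt hk.le ?_ hk.ne'
  have e1 : f u + (1 - b) = (1 - b) * (u - c) / (u - b) := by
    simp only [hf]
    field_simp
    ring
  have e2 : f u - (b - c) = (b - c) * (1 - u) / (u - b) := by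
    simp only [hf]
    field_simp
    ring
  rw [e1, e2]
  simp only [hf]
  field_simp

/-- The complete elliptic integral splits along the involution, which exchanges `b` with
`(b - c) / c`. -/
theorem ellipticHigh_eq_add : ellipticHigh c b 1
    = ellipticLow c b 1 + ∫ v in Ioi b, firstKind (b - c) (1 - b) v := by
  have hA : 0 < b - c := sub_pos.2 hcb
  have hB : 0 < 1 - b := sub_pos.2 hb
  -- A nonintegrable function has integral zero by convention, but the value here is a positive
  -- period.
  have hint : IntegrableOn (firstKind (b - c) (1 - b)) (Ioi (b - c)) := by
    by_contra h
    have h1 := ellipticHigh_pos hcb hb.le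
    rw [ellipticHigh_eq_setIntegral hcb hb, integral_undef h] at h1
    exact lt_irrefl _ h1
  have hv : b - c < (b - c) / c := by
    rw [lt_div_iff₀ hc]
    nlinarith
  have h1 := setIntegral_firstKind_halfShift hA hB hv
  have h2 : halfShift (b - c) (1 - b) ((b - c) / c) = b := by
    have : (b - c) / c - (b - c) = (b - c) * (1 - c) / c := by
      field_simp
    have hC : 0 < 1 - c := by linarith
    rw [halfShift, this]
    field_simp
    ring
  rw [h2] at h1
  rw [h1, ellipticLow_eq_setIntegral hc hcb hb, ellipticHigh_eq_setIntegral hcb hb,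
    ← integral_Ioc_eq_integral_Ioo, add_comm, ← Ioc_union_Ioi_eq_Ioi hv.le,
    setIntegral_union (Ioc_disjoint_Ioi le_rfl) measurableSet_Ioi
      (hint.mono_set Ioc_subset_Ioi_self) (hint.mono_set (Ioi_subset_Ioi hv.le))]

end

/-! ### Closed forms for the frequencies 1/4 and 1/3 -/

section

variable {b : ℝ} (hb : b ∈ Ioo (0 : ℝ) 1)
include hb

theorem ellipticFrequency_eq_quarter :
    b / (1 + b) ∈ Ioo 0 b ∧ ellipticFrequency (b / (1 + b)) b 1 = 1 / 4 := by
  have hb1 : 0 < 1 + b := by linarith [hb.1]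
  have hmem : b / (1 + b) ∈ Ioo 0 b :=
    ⟨div_pos hb.1 hb1, div_lt_self hb.1 (by linarith [hb.1])⟩
  refine ⟨hmem, ?_⟩
  have h1 := ellipticHigh_eq_add hmem.1 hmem.2 hb.2
  have h2 := ellipticLow_eq_setIntegral hmem.1 hmem.2 hb.2
  -- Frequency 1/4 means high = 2 · low. By `ellipticHigh_eq_add` it suffices that the integrals
  -- from b and from (b - c)/c agree, that is (b - c)/c = b.
  have h3 : (b - b / (1 + b)) / (b / (1 + b)) = b := by
    have := hb.1
    field_simp
    ring
  rw [h3] at h2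
  have hpos := ellipticLow_pos hmem.1 hmem.2 hb.2.le
  rw [ellipticFrequency, h1, ← h2]
  field_simp
  norm_num

/-- Frequency 1/3 means high = 3/2 · low, so the integral from b must be half the one from (b -
c)/c. This holds if (b - c)/c is the double of b, i.e. (b² + (b - c)(1 - b))² = 4 b (b - c), or (1 -
b)² c² + 2 b (1 + b) c - 3 b² = 0, whose positive root is the stated c. -/
theorem ellipticFrequency_eq_third :
    3 * b / (1 + b + 2 * √(1 - b + b ^ 2)) ∈ Ioo 0 b ∧
      ellipticFrequency (3 * b / (1 + b + 2 * √(1 - b + b ^ 2))) b 1 = 1 / 3 := by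
  obtain ⟨hb0, hb1⟩ := hb
  set R := √(1 - b + b ^ 2) with hR
  have hR2 : R ^ 2 = 1 - b + b ^ 2 := Real.sq_sqrt (by nlinarith)
  have hR0 : 0 < R := Real.sqrt_pos.2 (by nlinarith)
  have hD : 0 < 1 + b + 2 * R := by linarith
  set c := 3 * b / (1 + b + 2 * R) with hc
  have hcD : c * (1 + b + 2 * R) = 3 * b := div_mul_cancel₀ _ hD.ne'
  have hRb : 2 - b < 2 * R := by nlinarith
  have hR1 : R < 1 := by nlinarith
  have hc0 : 0 < c := by positivity
  have hcb : c < b := by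
    rw [hc, div_lt_iff₀ hD]
    nlinarith
  refine ⟨⟨hc0, hcb⟩, ?_⟩
  have hA : 0 < b - c := sub_pos.2 hcb
  have hB : 0 < 1 - b := sub_pos.2 hb1
  have hAD : (b - c) * (1 + b + 2 * R) = b * (b - 2 + 2 * R) := by linear_combination -hcD
  have hq : 0 < b ^ 2 - 2 * (b - c) * b - (b - c) * (1 - b) := by
    have h : 0 < (b ^ 2 - 2 * (b - c) * b - (b - c) * (1 - b)) * (1 + b + 2 * R) := by
      have : (b ^ 2 - 2 * (b - c) * b - (b - c) * (1 - b)) * (1 + b + 2 * R)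
          = 2 * b * (1 + b - R) := by linear_combination -(1 + b) * hAD
      rw [this]
      have : 0 < 1 + b - R := by linarith
      positivity
    exact pos_of_mul_pos_left h hD.le
  have hdouble : doubling (b - c) (1 - b) b = (b - c) / c := by
    have h : (b ^ 2 + (b - c) * (1 - b)) ^ 2 = 4 * b * (b - c) := by
      have h1 : (b ^ 2 + (b - c) * (1 - b)) * (1 + b + 2 * R) = 2 * b * (2 * b - 1 + R) := by
        linear_combination (1 - b) * hAD
      have h2 : (b ^ 2 + (b - c) * (1 - b)) ^ 2 * (1 + b + 2 * R) ^ 2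
          = 4 * b * (b - c) * (1 + b + 2 * R) ^ 2 := by
        rw [← mul_pow, h1]
        linear_combination (-(4 * b) * (1 + b + 2 * R)) * hAD - 12 * b ^ 2 * hR2
      exact mul_right_cancel₀ (pow_pos hD 2).ne' h2
    rw [doubling, h, show b * (b + (1 - b)) * (b - (b - c)) = b * c by ring]
    field_simp
  have h1 := setIntegral_firstKind_doubling hA hB (sub_lt_self b hc0) hq
  rw [hdouble, ← ellipticLow_eq_setIntegral hc0 hcb hb1] at h1
  have h2 := ellipticHigh_eq_add hc0 hcb hb1
  have hpos := ellipticLow_pos hc0 hcb hb1.le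
  have h3 : ellipticHigh c b 1 = 3 / 2 * ellipticLow c b 1 := by linarith
  rw [ellipticFrequency, h3]
  field_simp

end

/-! ### The regions of ellipsoids with billiard trajectories of a given frequency -/

/-- Every nonsingular caustic parameter one of whose entries lies between the two smallest
parameters of the ellipsoid is the caustic parameter of a billiard trajectory. -/
theorem exists_trajectory {p : ℝ × ℝ} (hp : p ∈ paramSpace) {lam : Fin 2 → ℝ}
    (hl : lam ∈ causticSpace (n := 2) (triaxial p)) (h1 : lam 1 ∈ Ioo p.2 p.1)
    (h0 : lam 0 < p.1) (h0c : lam 0 ≠ p.2) :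
    ∃ q, IsBilliardTrajectory (triaxial p) q ∧ HasCausticParameter (triaxial p) q lam := by
  have hne : ∀ μ, μ ≠ p.2 → μ < p.1 → ∀ i, triaxial p i ≠ μ := fun μ hμ hμ' =>
    Fin.forall_fin_succ.2 ⟨hμ.symm, Fin.forall_fin_two.2 ⟨hμ'.ne', (hμ'.trans hp.2.2).ne'⟩⟩
  obtain ⟨z, hz, hz1, hz0⟩ := exists_inwardVector_lineTangent hp h1
    ⟨hl.1 0, h0.trans hp.2.2⟩ h0.ne h0c
  obtain ⟨q, hq, hqt⟩ := exists_billiardTrajectory (triaxial_pos hp) z hz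
  refine ⟨q, hq, hl, fun k => Fin.forall_fin_two.2 ⟨?_, ?_⟩⟩
  · exact hqt _ (hl.1 0).ne' (hne _ h0c h0) hz0 k
  · exact hqt _ (hl.1 1).ne' (hne _ h1.1.ne' h1.2) hz1 k

/-- Since every caustic parameter of this type is realized by a trajectory, the region depends only
on the range of the frequency map. -/
theorem mem_regionEH1_iff {w : Fin 2 → ℝ} {p : ℝ × ℝ} : p ∈ regionEH1 w ↔
    p ∈ paramSpace ∧ w ∈ frequencyMap (triaxial p) '' typeEH1 p := by
  constructor
  · rintro ⟨hp, q, lam, -, -, hl, h⟩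
    exact ⟨hp, lam, hl, h⟩
  · rintro ⟨hp, lam, hl, h⟩
    obtain ⟨q, hq, hq'⟩ := exists_trajectory hp (typeEH1_subset hp hl) hl.2
      (hl.1.2.trans hp.2.1) hl.1.2.ne
    exact ⟨hp, q, lam, hq, hq', hl, h⟩

theorem mem_regionH1H1_iff {w : Fin 2 → ℝ} {p : ℝ × ℝ} : p ∈ regionH1H1 w ↔
    p ∈ paramSpace ∧ w ∈ frequencyMap (triaxial p) '' typeH1H1 p := by
  constructor
  · rintro ⟨hp, q, lam, -, -, hl, h⟩
    exact ⟨hp, lam, hl, h⟩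
  · rintro ⟨hp, lam, hl, h⟩
    obtain ⟨q, hq, hq'⟩ := exists_trajectory hp (typeH1H1_subset hp hl) hl.2.1 hl.1.2 hl.1.1.ne'
    exact ⟨hp, q, lam, hq, hq', hl, h⟩

section

variable {w : Fin 2 → ℝ} (hconj : LocalDiffeoConjecture) (hw : w ∈ frequencySpace)
include hconj hw

omit hw in
theorem regionH1H1_subset_regionEH1 : regionH1H1 w ⊆ regionEH1 w := fun p hp => by
  obtain ⟨h1, h2⟩ := mem_regionH1H1_iff.1 hp
  rw [hconj.image_typeH1H1 h1] at h2
  exact mem_regionEH1_iff.2 ⟨h1, hconj.subset_image_typeEH1 h1 h2⟩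

theorem regionH1H1_eq :
    regionH1H1 w = {p : ℝ × ℝ | p ∈ paramSpace ∧ p.2 < regionBoundary (w 1) p.1} := by
  ext p
  rw [mem_regionH1H1_iff, mem_ofPred_eq]
  refine and_congr_right fun hp => ?_
  rw [hconj.image_typeH1H1 hp, mem_ofPred_eq, hconj.ellipticFrequency_lt_iff
    ⟨hw.1, hw.2.1.trans hw.2.2⟩ ⟨hp.1.trans hp.2.1, hp.2.2⟩ ⟨hp.1, hp.2.1⟩]
  exact and_iff_right hw

end

end EllipsoidBilliard

end

theorem proposition5p5 (hconj : EllipsoidBilliard.LocalDiffeoConjecture) :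
    (∀ w ∈ EllipsoidBilliard.frequencySpace,
      EllipsoidBilliard.regionH1H1 w ⊆ EllipsoidBilliard.regionEH1 w) ∧
    (∀ w ∈ EllipsoidBilliard.frequencySpace, ∀ w' ∈ EllipsoidBilliard.frequencySpace,
      w 1 = w' 1 → EllipsoidBilliard.regionH1H1 w = EllipsoidBilliard.regionH1H1 w') ∧
    (∀ w ∈ EllipsoidBilliard.frequencySpace, ∃ g : ℝ → ℝ,
      EllipsoidBilliard.regionH1H1 w =
        {p : ℝ × ℝ | p ∈ EllipsoidBilliard.paramSpace ∧ p.2 < g p.1} ∧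
      AnalyticOnNhd ℝ g (Set.Ioo 0 1) ∧
      StrictMonoOn g (Set.Ioo 0 1) ∧
      (∀ b ∈ Set.Ioo (0 : ℝ) 1, 0 < g b ∧ g b < b) ∧
      Filter.Tendsto g (nhdsWithin 1 (Set.Iio 1)) (nhds (Real.sin (Real.pi * w 1) ^ 2)) ∧
      (w 1 = 1 / 3 → ∀ b ∈ Set.Ioo (0 : ℝ) 1,
        g b = 3 * b / (1 + b + 2 * √(1 - b + b ^ 2))) ∧
      (w 1 = 1 / 4 → ∀ b ∈ Set.Ioo (0 : ℝ) 1, g b = b / (1 + b))) := by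
  refine ⟨fun w _ => EllipsoidBilliard.regionH1H1_subset_regionEH1 hconj,
    fun w hw w' hw' h => ?_, fun w hw => ?_⟩
  · rw [EllipsoidBilliard.regionH1H1_eq hconj hw, EllipsoidBilliard.regionH1H1_eq hconj hw', h]
  · have hr : w 1 ∈ Set.Ioo (0 : ℝ) (1 / 2) := ⟨hw.1, hw.2.1.trans hw.2.2⟩
    refine ⟨EllipsoidBilliard.regionBoundary (w 1), EllipsoidBilliard.regionH1H1_eq hconj hw,
      fun b hb => EllipsoidBilliard.analyticAt_regionBoundary hconj hr hb,
      hconj.strictMonoOn_regionBoundary hr, fun b hb => (hconj.regionBoundary_spec hr hb).1,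
      hconj.tendsto_regionBoundary hr, fun h b hb => ?_, fun h b hb => ?_⟩
    · have h3 := EllipsoidBilliard.ellipticFrequency_eq_third hb
      exact hconj.eq_regionBoundary hr hb h3.1 (h3.2.trans h.symm)
    · have h4 := EllipsoidBilliard.ellipticFrequency_eq_quarter hb
      exact hconj.eq_regionBoundary hr hb h4.1 (h4.2.trans h.symm)
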